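/- **Setting.** A base station with $M$ antennas serves $K$ single-antenna users, $1\le K\le M$. Let $c\in(0,1]$ be such that $cM$ is an integer, let ${\bf A}$ be an $M\times cM$ matrix with ${\bf A}^H{\bf A}={\bf I}$, and put ${\bf R}=\frac1c{\bf A}{\bf A}^H$. The channel is ${\bf H}=[{\bf h}_1,\dots,{\bf h}_K]$ with ${\bf h}_k={\bf R}^{1/2}{\bf z}_k$, where ${\bf z}_1,\dots,{\bf z}_K$ are independent with law $\mathcal{CN}({\bf 0},{\bf I}_M)$. Let ${\bf G}={\bf H}^H{\bf H}/M$. For a relaxation parameter $\omega>0$, the first-order identity-Neumann-series (INS) approximate zero-forcing precoder is $${\bf W}=\frac{\beta}{M}{\bf H}\left({\bf D}^{-1}-{\bf D}^{-1}({\bf G}-{\bf D}){\bf D}^{-1}\right),\qquad {\bf D}=\omega{\bf I}_K,$$ with a real $\beta$ such that ${\rm E}\{{\rm tr}({\bf W}{\bf W}^H)\}=1$. With $\tilde{\bf H}={\bf H}^H{\bf W}$ and transmit power $\rho_t>0$, the ergodic sum-rate is $$R=\sum_{k=1}^K{\rm E}\left\{\log_2\left(1+\frac{|[\tilde{\bf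 H}]_{kk}|^2}{\frac1{\rho_t}+\sum_{j\ne k}|[\tilde{\bf H}]_{kj}|^2}\right)\right\},$$ and $\tilde R$ denotes the same expression with each $|[\tilde{\bf H}]_{kj}|^2$ (including $j=k$) replaced by its expectation and the outer expectation dropped. Put $$C_1=\left(2-\tfrac1\omega\right)^2+\tfrac{4}{cM}\left(1-\tfrac1\omega\right)^2-\tfrac{2K}{cM\omega}\left(2-\tfrac1\omega\right)+\tfrac{K}{c^2M^2\omega}\left(-4+\tfrac5\omega\right)+\tfrac{K^2}{c^2M^2\omega^2}+\tfrac{K^2}{c^3M^3\omega^2},$$ $$C_2=\left(2-\tfrac1\omega\right)^2+\tfrac{K}{cM\omega}\left(-4+\tfrac3\omega\right)+\tfrac{K^2}{c^2M^2\omega^2},$$ $$C_3=\tfrac{4}{cM}\left(1-\tfrac1\omega\right)^2+\tfrac{K}{c^2M^2\omega}\left(-4+\tfrac5\omega\right)+\tfrac{K^2}{c^3M^3\omega^2},$$ $$r^{INS}=\log_2\left(1+\frac{C_1}{\frac1{\rho_t}\frac KM C_2+(K-1)C_3}\right).$$ **Theorem.** Fix $c_0>0$, $\rho_t>0$ and $\delta>0$.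 Consider all systems as above with $c\ge c_0$ and $\left|2\omega-1-\frac K{cM}\right|\ge\delta$. All the expectations in $R$ and $\tilde R$ are finite, and: 1. For every $\varepsilon>0$ there is $N$, depending only on $\varepsilon,c_0,\rho_t,\delta$, such that for all such systems with $M\ge N$, $$\left|R-K\,r^{INS}\right|\le\varepsilon\,K\,r^{INS},$$ and, if moreover $K\ge N$ or $\omega=1+\frac K{cM}$, then also $\left|R-K\,r^{INS}\right|\le\varepsilon K$. 2. There is a constant $B$, depending only on $c_0,\rho_t,\delta$, such that for all such systems $\left|\tilde R-K\,r^{INS}\right|\le BK/M^2$. -/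

import Mathlib

open MeasureTheory ProbabilityTheory
open scoped Matrix ComplexOrder MatrixOrder

universe u

noncomputable section

namespace MassiveMIMO

/-- The law `CN(0, 1)` on `ℂ`: independent centred real and imaginary parts of variance `1/2`. -/
def stdComplexGaussian : Measure ℂ :=
  ((gaussianReal 0 (1 / 2)).prod (gaussianReal 0 (1 / 2))).map
    (fun p : ℝ × ℝ => (⟨p.1, p.2⟩ : ℂ))

/-- The law `CN(0, I_M)` on `ℂ^M`. -/
def stdComplexGaussianVec (M : ℕ) : Measure (Fin M → ℂ) :=
  Measure.pi (fun _ => stdComplexGaussian)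

/-- The channel covariance matrix `R = (1/c) A Aᴴ`. -/
def channelCov {M m : ℕ} (c : ℝ) (A : Matrix (Fin M) (Fin m) ℂ) : Matrix (Fin M) (Fin M) ℂ :=
  ((1 / c : ℝ) : ℂ) • (A * Aᴴ)

/-- `H = [h_1, …, h_K]` is the correlated channel with `M` antennas, `K` users and correlation
level `c`: `h_k = R^{1/2} z_k` with `z_1, …, z_K` independent, each of law `CN(0, I_M)`, and
`R = (1/c) A Aᴴ` for a semi-unitary `M × cM` matrix `A` (so `cM` is an integer). -/
def IsCorrelatedChannel {Ω : Type*} [MeasurableSpace Ω] (P : Measure Ω) {M K : ℕ} (c : ℝ)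
    (H : Ω → Matrix (Fin M) (Fin K) ℂ) : Prop :=
  ∃ (m : ℕ) (A : Matrix (Fin M) (Fin m) ℂ) (z : Fin K → Ω → Fin M → ℂ),
    (m : ℝ) = c * M ∧ Aᴴ * A = 1 ∧
    iIndepFun z P ∧ (∀ k, HasLaw (z k) (stdComplexGaussianVec M) P) ∧
    ∀ x i k, H x i k = (CFC.sqrt (channelCov c A) *ᵥ z k x) i

/-- The Gram matrix `G = Hᴴ H / M`. -/
def gram {M K : ℕ} (H : Matrix (Fin M) (Fin K) ℂ) : Matrix (Fin K) (Fin K) ℂ :=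
  ((1 / M : ℝ) : ℂ) • (Hᴴ * H)

/-- The first-order Neumann-series approximate ZF precoder with precondition matrix `D`,
`W = (β/M) H (D⁻¹ - D⁻¹ E D⁻¹)` with `E = G - D`. -/
def neumannPrecoder {M K : ℕ} (β : ℝ) (D : Matrix (Fin K) (Fin K) ℂ)
    (H : Matrix (Fin M) (Fin K) ℂ) : Matrix (Fin M) (Fin K) ℂ :=
  ((β / M : ℝ) : ℂ) • (H * (D⁻¹ - D⁻¹ * (gram H - D) * D⁻¹))

/-- The INS precoder: the precondition matrix is `ω I_K`. -/
def insPrecoder {M K : ℕ} (β ω : ℝ) (H : Matrix (Fin M) (Fin K) ℂ) : Matrix (Fin M) (Fin K) ℂ :=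
  neumannPrecoder β ((ω : ℂ) • (1 : Matrix (Fin K) (Fin K) ℂ)) H

section Rates

variable {Ω : Type*} [MeasurableSpace Ω] {M K : ℕ}

/-- The power normalization `E{tr{W Wᴴ}} = 1`. -/
def PowerNormalized (P : Measure Ω) (W : Ω → Matrix (Fin M) (Fin K) ℂ) : Prop :=
  ∫ x, (W x * (W x)ᴴ).trace ∂P = 1

/-- The power `|[Hᴴ W]_{kj}|²` that user `k` receives of the symbol meant for user `j`. -/
def rxPower (H W : Matrix (Fin M) (Fin K) ℂ) (k j : Fin K) : ℝ :=
  ‖(Hᴴ * W) k j‖ ^ 2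

/-- The instantaneous SINR of user `k` at transmit power `ρ`. -/
def sinr (ρ : ℝ) (H W : Matrix (Fin M) (Fin K) ℂ) (k : Fin K) : ℝ :=
  rxPower H W k k / (1 / ρ + ∑ j ∈ Finset.univ.erase k, rxPower H W k j)

/-- The ergodic sum-rate `∑_k E{log₂(1 + SINR_k)}`. -/
def ergodicSumRate (P : Measure Ω) (ρ : ℝ) (H W : Ω → Matrix (Fin M) (Fin K) ℂ) : ℝ :=
  ∑ k, ∫ x, Real.logb 2 (1 + sinr ρ (H x) (W x) k) ∂P

/-- The sum-rate with each SINR replaced by the ratio of the expected signal power to the noise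
power plus the expected interference power. -/
def meanPowerSumRate (P : Measure Ω) (ρ : ℝ) (H W : Ω → Matrix (Fin M) (Fin K) ℂ) : ℝ :=
  ∑ k, Real.logb 2 (1 + (∫ x, rxPower (H x) (W x) k k ∂P) /
    (1 / ρ + ∑ j ∈ Finset.univ.erase k, ∫ x, rxPower (H x) (W x) k j ∂P))

end Rates

/-- Normalized signal power. -/
def C₁ (ω c M K : ℝ) : ℝ :=
  (2 - 1 / ω) ^ 2 + 4 / (c * M) * (1 - 1 / ω) ^ 2 - 2 * K / (c * M * ω) * (2 - 1 / ω)
    + K / (c ^ 2 * M ^ 2 * ω) * (-4 + 5 / ω) + K ^ 2 / (c ^ 2 * M ^ 2 * ω ^ 2)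
    + K ^ 2 / (c ^ 3 * M ^ 3 * ω ^ 2)

/-- Coefficient of the normalized noise power. -/
def C₂ (ω c M K : ℝ) : ℝ :=
  (2 - 1 / ω) ^ 2 + K / (c * M * ω) * (-4 + 3 / ω) + K ^ 2 / (c ^ 2 * M ^ 2 * ω ^ 2)

/-- Normalized power of one interferer. -/
def C₃ (ω c M K : ℝ) : ℝ :=
  4 / (c * M) * (1 - 1 / ω) ^ 2 + K / (c ^ 2 * M ^ 2 * ω) * (-4 + 5 / ω)
    + K ^ 2 / (c ^ 3 * M ^ 3 * ω ^ 2)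

/-- The closed form of the rate of one user of the INS scheme. -/
def insUserRate (ρ ω c M K : ℝ) : ℝ :=
  Real.logb 2 (1 + C₁ ω c M K / (1 / ρ * (K / M) * C₂ ω c M K + (K - 1) * C₃ ω c M K))

/-- The setting in which the INS scheme is analysed: correlation level `c ∈ [c₀, 1]`, at least one
and at most `M` users, relaxation parameter `ω > 0` at distance at least `δ / 2` from the value
`(1 + K / (cM)) / 2` at which the useful signal cancels to leading order, and power
normalization. -/
structure INSSetting {Ω : Type*} [MeasurableSpace Ω] (P : Measure Ω) (c₀ δ c ω β : ℝ) {M K : ℕ}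
    (H : Ω → Matrix (Fin M) (Fin K) ℂ) : Prop where
  corr_ge : c₀ ≤ c
  corr_le : c ≤ 1
  one_le_users : 1 ≤ K
  users_le : K ≤ M
  relax_pos : 0 < ω
  relax_away : δ ≤ |2 * ω - 1 - K / (c * M)|
  channel : IsCorrelatedChannel P c H
  power : PowerNormalized P (fun x => insPrecoder β ω (H x))

end MassiveMIMO

end

/-!
Write `m = cM`, `q = 1 / ω`, `a = 1 / m` and `κ = K a`. Since `CN(0, I)` is invariant under
co-isometries (`map_mulVec_stdComplexGaussianVec`), the vectors `y_k = Aᴴ z_k` are independent of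
law `CN(0, I_m)`, and `G` is their normalized Gram matrix. The matrix `Hᴴ W` is a scalar multiple
of `T = 2G - qG²`, and the transmit power is a multiple of the trace of `G (2 - qG)²`. Dividing by
the scalar, which is determined by the power normalization, leaves the signal power `|T_kk|²`, the
interference power `∑ |T_kj|²` over `j ≠ k`, and a noise power of order `K / M`.

These depend on row `k` and the matrix `B` of the other rows only through `‖y_k‖²` and the squared
norms of `B v`, `Bᴴ B v` and `B Bᴴ B v`, where `v` is the conjugate of `y_k`. Rotating `v` onto a
multiple of a basis vector, and repeating this for the remaining columns (Golub–Kahan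
bidiagonalization, `lintegral_krylovNorms`), expresses all of them as polynomials in four
independent Gamma variables, of parameters `m`, `K - 1`, `m - 1` and `K - 2`. This gives the exact
moments: the mean interference is `(K - 1) (C₃ + 2q²a³)`, the normalized transmit power is `C₂ +
q²a²`, and the mean signal power is `C₁ + O(a²)`.

The limit `u = 2 - q - qκ` of the signal amplitude equals `q (2ω - 1 - κ)`, so that `|u| ≥ δ q`; as
`u + q (1 + κ) = 2`, the signal power is at least a constant times `1 + q²` (`signalGap_mul_le`).
All error bounds are relative to `1 + q²`, which makes them uniform in `ω`. The noise is at least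
of order `K / M`, and a logarithm is Lipschitz away from zero, so the moments give the bound of
order `1 / M²` for the rate at the mean powers.

For the ergodic rate, the signal power deviates from its limit by `O(1 / √m)` in mean and the
interference by `O(√K / m)`. Noise plus interference is at least of order `K / M`, so its logarithm
deviates by `O(1 / √K)`. The sum of signal, noise and interference has a limit of order one, but is
itself bounded below only by the noise; `abs_log_sub_le_mul` controls its logarithm at the price of
a factor `log M`, so it deviates by `O(log M / √M)`. This settles the case of many users. With few
users the interference need not concentrate, but the rate is at least `log₂ (1 + κ₂ M / K)` for a
constant `κ₂ > 0` (`Regime.limitRate_ge`), so a bounded error is relatively small. If `ω = 1 + κ`,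
then the interference vanishes to leading order: its mean is `O(κ²)`, which is negligible against
the noise as long as `K` is bounded, and the error is small in the absolute sense too.
-/

noncomputable section

namespace MassiveMIMO

/-! ### Complex Gaussian vectors -/

instance : IsProbabilityMeasure stdComplexGaussian :=
  Measure.isProbabilityMeasure_map (by
    apply Measurable.aemeasurable
    exact Complex.measurableEquivRealProd.symm.measurable)

instance (M : ℕ) : IsProbabilityMeasure (stdComplexGaussianVec M) := by
  unfold stdComplexGaussianVec; infer_instance

lemma measurable_mk : Measurable (fun p : ℝ × ℝ => (⟨p.1, p.2⟩ : ℂ)) :=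
  Complex.measurableEquivRealProd.symm.measurable

lemma charFun_stdComplexGaussian (t : ℂ) :
    charFun stdComplexGaussian t = Complex.exp (-(‖t‖ ^ 2 / 4 : ℝ)) := by
  rw [charFun_apply, stdComplexGaussian, integral_map measurable_mk.aemeasurable (by fun_prop)]
  have h : ∀ p : ℝ × ℝ, Complex.exp (inner ℝ (⟨p.1, p.2⟩ : ℂ) t * Complex.I)
      = Complex.exp (t.re * p.1 * Complex.I) * Complex.exp (t.im * p.2 * Complex.I) := by
    intro p
    rw [← Complex.exp_add, Complex.inner]
    congr 1
    simp
    ring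
  simp_rw [h]
  rw [integral_prod_mul (μ := gaussianReal 0 (1 / 2)) (ν := gaussianReal 0 (1 / 2))
    (fun x : ℝ => Complex.exp (t.re * x * Complex.I))
    (fun x : ℝ => Complex.exp (t.im * x * Complex.I)), ← charFun_apply_real, ← charFun_apply_real,
    charFun_gaussianReal, charFun_gaussianReal, ← Complex.exp_add]
  congr 1
  rw [← Complex.normSq_eq_norm_sq, Complex.normSq_apply]
  push_cast
  simp
  ring

/-- The law `CN(0, I)` is preserved by co-isometries: both sides have the same characteristic
function, since `Bᴴ` preserves norms. -/
theorem map_mulVec_stdComplexGaussianVec {m M : ℕ} (B : Matrix (Fin m) (Fin M) ℂ)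
    (hB : B * Bᴴ = 1) :
    (stdComplexGaussianVec M).map (fun z => B *ᵥ z) = stdComplexGaussianVec m := by
  have hmeas : Measurable (fun z : Fin M → ℂ => B *ᵥ z) :=
    (Continuous.matrix_mulVec continuous_const continuous_id).measurable
  have : IsProbabilityMeasure ((stdComplexGaussianVec M).map (fun z => B *ᵥ z)) :=
    Measure.isProbabilityMeasure_map hmeas.aemeasurable
  refine charFun_eq_pi_iff.1 fun t => ?_
  have key : charFun (((stdComplexGaussianVec M).map (fun z => B *ᵥ z)).map (WithLp.toLp 2)) t
      = charFun ((stdComplexGaussianVec M).map (WithLp.toLp 2))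
        (WithLp.toLp 2 (Bᴴ *ᵥ (WithLp.ofLp t))) := by
    rw [charFun_apply, charFun_apply, integral_map (by fun_prop) (by fun_prop),
      integral_map (by fun_prop) (by fun_prop), integral_map (by fun_prop) (by fun_prop)]
    congr 1 with z
    congr 3
    have h1 : ∀ (d : ℕ) (x y : Fin d → ℂ), inner ℝ (WithLp.toLp 2 x) (WithLp.toLp 2 y)
        = (y ⬝ᵥ star x).re := by
      intro d x y
      simp [PiLp.inner_apply, Complex.inner, dotProduct, mul_comm]
    rw [show t = WithLp.toLp 2 (WithLp.ofLp t) from rfl, h1, h1]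
    rw [Matrix.star_mulVec, dotProduct_comm, ← Matrix.dotProduct_mulVec, dotProduct_comm]
  rw [key]
  unfold stdComplexGaussianVec
  rw [charFun_pi]
  simp_rw [charFun_stdComplexGaussian, ← Complex.exp_sum]
  congr 1
  have h2 : ∀ (d : ℕ) (x : Fin d → ℂ), ((∑ i, ‖x i‖ ^ 2 : ℝ) : ℂ) = x ⬝ᵥ star x := by
    intro d x
    simp [dotProduct, Complex.mul_conj, Complex.normSq_eq_norm_sq]
  have h3 := h2 _ (Bᴴ *ᵥ (WithLp.ofLp t))
  rw [Matrix.star_mulVec, Matrix.conjTranspose_conjTranspose, dotProduct_comm,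
    ← Matrix.dotProduct_mulVec, Matrix.mulVec_mulVec, hB, Matrix.one_mulVec, dotProduct_comm,
    ← h2] at h3
  have h4 : (∑ i, ‖(Bᴴ *ᵥ (WithLp.ofLp t)) i‖ ^ 2 : ℝ) = ∑ i, ‖t i‖ ^ 2 := by exact_mod_cast h3
  rw [Finset.sum_neg_distrib, Finset.sum_neg_distrib, ← Complex.ofReal_sum, ← Complex.ofReal_sum,
    ← Finset.sum_div, ← Finset.sum_div, h4]

/-- The squared modulus of a `CN(0, 1)` variable has the moments of the exponential law. -/
lemma integral_norm_sq_pow (k : ℕ) :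
    ∫ z, (‖z‖ ^ 2) ^ k ∂stdComplexGaussian = k.factorial := by
  have hdens : (gaussianReal 0 (1 / 2)).prod (gaussianReal 0 (1 / 2)) =
      (volume : Measure (ℝ × ℝ)).withDensity
        (fun p => gaussianPDF 0 (1 / 2) p.1 * gaussianPDF 0 (1 / 2) p.2) := by
    rw [gaussianReal_of_var_ne_zero _ (by norm_num), prod_withDensity (by fun_prop) (by fun_prop)]
    rfl
  have hmul : ∀ p : ℝ × ℝ, gaussianPDF 0 (1 / 2) p.1 * gaussianPDF 0 (1 / 2) p.2
      = ENNReal.ofReal (gaussianPDFReal 0 (1 / 2) p.1 * gaussianPDFReal 0 (1 / 2) p.2) := by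
    intro p
    rw [ENNReal.ofReal_mul (gaussianPDFReal_nonneg _ _ _)]; rfl
  rw [stdComplexGaussian, integral_map measurable_mk.aemeasurable (by fun_prop), hdens]
  simp_rw [hmul]
  rw [integral_withDensity_eq_integral_toReal_smul (by fun_prop) (by simp)]
  have h1 : ∀ p : ℝ × ℝ, (ENNReal.ofReal (gaussianPDFReal 0 (1 / 2) p.1 *
      gaussianPDFReal 0 (1 / 2) p.2)).toReal • (‖(⟨p.1, p.2⟩ : ℂ)‖ ^ 2) ^ k =
      (fun z : ℂ => Real.pi⁻¹ * (‖z‖ ^ (2 * k : ℝ) * Real.exp (-‖z‖ ^ (2 : ℝ))))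
        (Complex.measurableEquivRealProd.symm p) := by
    intro p
    rw [ENNReal.toReal_ofReal
      (mul_nonneg (gaussianPDFReal_nonneg _ _ _) (gaussianPDFReal_nonneg _ _ _))]
    simp only [gaussianPDFReal, Complex.measurableEquivRealProd_symm_apply, smul_eq_mul]
    have h2 : ‖(⟨p.1, p.2⟩ : ℂ)‖ ^ (2 : ℝ) = p.1 ^ 2 + p.2 ^ 2 := by
      rw [Real.rpow_two, ← Complex.normSq_eq_norm_sq, Complex.normSq_apply]; ring
    have h3 : ‖(⟨p.1, p.2⟩ : ℂ)‖ ^ (2 * k : ℝ) = (‖(⟨p.1, p.2⟩ : ℂ)‖ ^ 2) ^ k := by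
      rw [Real.rpow_mul (norm_nonneg _), Real.rpow_natCast, Real.rpow_two]
    rw [h2, h3, neg_add, Real.exp_add]
    have h4 : (√(2 * Real.pi * ((1 / 2 : NNReal) : ℝ)))⁻¹ *
        (√(2 * Real.pi * ((1 / 2 : NNReal) : ℝ)))⁻¹ = Real.pi⁻¹ := by
      rw [← mul_inv, Real.mul_self_sqrt (by positivity)]
      congr 1
      push_cast
      ring
    rw [← h4]
    push_cast
    have h5 : ∀ x : ℝ, -(x - 0) ^ 2 / (2 * (1 / 2)) = - x ^ 2 := by intro x; ring
    rw [h5, h5]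
    ring
  simp_rw [h1]
  have := (Complex.volume_preserving_equiv_real_prod.symm).integral_comp
    Complex.measurableEquivRealProd.symm.measurableEmbedding
    (fun z : ℂ => Real.pi⁻¹ * (‖z‖ ^ (2 * k : ℝ) * Real.exp (-‖z‖ ^ (2 : ℝ))))
  have hk : (-2 : ℝ) < 2 * k := by
    have : (0 : ℝ) ≤ k := k.cast_nonneg
    linarith
  rw [this, integral_const_mul, Complex.integral_rpow_mul_exp_neg_rpow (by norm_num) hk]
  have : (2 * (k : ℝ) + 2) / 2 = k + 1 := by ring
  rw [this, Real.Gamma_nat_eq_factorial]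
  field_simp

/-! ### Squared norms of Gaussian vectors -/

/-- The squared Euclidean norm of a complex vector. -/
def nsq {d : ℕ} (v : Fin d → ℂ) : ℝ := ∑ i, ‖v i‖ ^ 2

lemma nsq_nonneg {d : ℕ} (v : Fin d → ℂ) : 0 ≤ nsq v := by unfold nsq; positivity

@[fun_prop]
lemma measurable_nsq {d : ℕ} : Measurable (nsq : (Fin d → ℂ) → ℝ) := by unfold nsq; fun_prop

lemma ofReal_nsq {d : ℕ} (v : Fin d → ℂ) : (nsq v : ℂ) = star v ⬝ᵥ v := by
  simp [nsq, dotProduct, Complex.conj_mul']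

lemma nsq_smul {d : ℕ} (a : ℂ) (v : Fin d → ℂ) : nsq (a • v) = ‖a‖ ^ 2 * nsq v := by
  simp [nsq, mul_pow, Finset.mul_sum]

lemma nsq_star {d : ℕ} (v : Fin d → ℂ) : nsq (star v) = nsq v := by
  simp [nsq]

lemma nsq_mulVec_of_isometry {d e : ℕ} (U : Matrix (Fin e) (Fin d) ℂ) (hU : Uᴴ * U = 1)
    (v : Fin d → ℂ) : nsq (U *ᵥ v) = nsq v := by
  have : (nsq (U *ᵥ v) : ℂ) = nsq v := by
    rw [ofReal_nsq, ofReal_nsq, Matrix.star_mulVec, ← Matrix.dotProduct_mulVec,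
      Matrix.mulVec_mulVec, hU, Matrix.one_mulVec]
  exact_mod_cast this

lemma nsq_fin_succ {d : ℕ} (v : Fin (d + 1) → ℂ) :
    nsq v = ‖v 0‖ ^ 2 + nsq (fun i => v i.succ) := by
  simp [nsq, Fin.sum_univ_succ]

/-- Every complex vector is rotated onto a multiple of the first basis vector. -/
lemma exists_unitary_mulVec_eq {d : ℕ} (v : Fin (d + 1) → ℂ) :
    ∃ U : Matrix (Fin (d + 1)) (Fin (d + 1)) ℂ, Uᴴ * U = 1 ∧ U * Uᴴ = 1 ∧
      U *ᵥ v = Pi.single 0 ((√(nsq v) : ℝ) : ℂ) := by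
  set r : ℝ := √(nsq v) with hr
  -- the first column of the adjoint of `U` is the normalized vector, or any unit vector if `v = 0`
  obtain ⟨w, hw, hwv⟩ : ∃ w : EuclideanSpace ℂ (Fin (d + 1)), ‖w‖ = 1 ∧ v = (r : ℂ) • w.ofLp := by
    by_cases h : r = 0
    · refine ⟨EuclideanSpace.single 0 1, by simp, ?_⟩
      have h0 : nsq v = 0 := by
        rwa [hr, Real.sqrt_eq_zero (nsq_nonneg v)] at h
      have : v = 0 := by
        funext i
        have := (Finset.sum_eq_zero_iff_of_nonneg (fun i _ => by positivity)).1 h0 i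
          (Finset.mem_univ i)
        simpa using this
      simp [this, h]
    · refine ⟨(r : ℂ)⁻¹ • WithLp.toLp 2 v, ?_, ?_⟩
      · rw [norm_smul, EuclideanSpace.norm_eq]
        change ‖(r : ℂ)⁻¹‖ * r = 1
        rw [norm_inv, Complex.norm_real, Real.norm_of_nonneg (Real.sqrt_nonneg _)]
        exact inv_mul_cancel₀ h
      · simp only [WithLp.ofLp_smul, smul_smul]
        rw [mul_inv_cancel₀ (by exact_mod_cast h), one_smul]
  obtain ⟨b, hb⟩ := Orthonormal.exists_orthonormalBasis_extension_of_card_eq (𝕜 := ℂ)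
    (E := EuclideanSpace ℂ (Fin (d + 1))) (ι := Fin (d + 1)) (by simp) (v := fun _ => w) (s := {0})
    (by
      rw [orthonormal_iff_ite]
      rintro ⟨i, rfl⟩ ⟨j, rfl⟩
      simp [hw])
  have hb0 : b 0 = w := hb 0 rfl
  refine ⟨Matrix.of fun i j => star ((b i).ofLp j), ?_, ?_, ?_⟩
  rotate_left
  · ext i j
    have := (orthonormal_iff_ite.1 b.orthonormal) i j
    rw [PiLp.inner_apply] at this
    simp only [Matrix.mul_apply, Matrix.conjTranspose_apply, Matrix.of_apply, star_star,
      Matrix.one_apply, ← this]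
    simp [mul_comm]
  · rw [hwv]
    ext i
    have := (orthonormal_iff_ite.1 b.orthonormal) i 0
    rw [PiLp.inner_apply, hb0] at this
    simp only [Matrix.mulVec, dotProduct, Matrix.of_apply, Pi.smul_apply, smul_eq_mul]
    simp only [RCLike.inner_apply] at this
    have h2 : ∀ j, star ((b i).ofLp j) * ((r : ℂ) * w.ofLp j)
      = r * (w.ofLp j * (starRingEnd ℂ) ((b i).ofLp j)) := by
      intro j
      rw [← starRingEnd_apply]; ring
    simp_rw [h2, ← Finset.mul_sum, this]
    by_cases hi : i = 0 <;> simp [hi]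
  · rw [mul_eq_one_comm]
    ext i j
    have := (orthonormal_iff_ite.1 b.orthonormal) i j
    rw [PiLp.inner_apply] at this
    simp only [Matrix.mul_apply, Matrix.conjTranspose_apply, Matrix.of_apply, star_star,
      Matrix.one_apply, ← this]
    simp [mul_comm]

/-- The law of an `n × m` matrix with independent `CN(0, 1)` entries, given by its rows. -/
def gaussianMatrix (n m : ℕ) : Measure (Fin n → Fin m → ℂ) :=
  Measure.pi fun _ => stdComplexGaussianVec m

instance (n m : ℕ) : IsProbabilityMeasure (gaussianMatrix n m) := by
  unfold gaussianMatrix; infer_instance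

/-- Rows and columns of a Gaussian matrix play the same role. -/
lemma map_swap_gaussianMatrix (n m : ℕ) :
    (gaussianMatrix n m).map (fun B j i => B i j) = gaussianMatrix m n := by
  have h : ∀ n m : ℕ, gaussianMatrix n m = (Measure.infinitePi fun _ : Fin n × Fin m =>
      stdComplexGaussian).map (MeasurableEquiv.curry (Fin n) (Fin m) ℂ) := by
    intro n m
    have := Measure.infinitePi_map_curry (ι := Fin n) (κ := Fin m)
      (fun (_ : Fin n) (_ : Fin m) => stdComplexGaussian)
    rw [this]
    simp_rw [Measure.infinitePi_eq_pi]
    rfl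
  have hs := Measure.infinitePi_map_piCongrLeft (fun _ : Fin m × Fin n => stdComplexGaussian)
    (Equiv.prodComm (Fin n) (Fin m))
  rw [h n m, h m n, ← hs, Measure.map_map (by fun_prop) (by fun_prop),
    Measure.map_map (by fun_prop) (by fun_prop)]
  congr 1

/-- Gaussian matrices are invariant under unitary transformations of the rows. -/
lemma map_mul_gaussianMatrix {n m : ℕ} (U : Matrix (Fin m) (Fin m) ℂ) (hU : U * Uᴴ = 1) :
    (gaussianMatrix n m).map (fun B i => U *ᵥ B i) = gaussianMatrix n m := by
  have hU' := map_mulVec_stdComplexGaussianVec U hU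
  have : ∀ i : Fin n, SigmaFinite ((stdComplexGaussianVec m).map (fun z => U *ᵥ z)) := by
    intro i; rw [hU']; infer_instance
  have h := Measure.pi_map_pi (μ := fun _ : Fin n => stdComplexGaussianVec m)
    (f := fun _ z => U *ᵥ z)
    (fun _ => ((Continuous.matrix_mulVec continuous_const continuous_id).measurable).aemeasurable)
  rw [hU'] at h
  exact h

/-- The law of the squared norm of a `CN(0, I_d)` vector, that is `Gamma(d, 1)`. -/
def sqNormLaw (d : ℕ) : Measure ℝ := (stdComplexGaussianVec d).map nsq

instance (d : ℕ) : IsProbabilityMeasure (sqNormLaw d) :=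
  Measure.isProbabilityMeasure_map measurable_nsq.aemeasurable

lemma sqNormLaw_nonneg (d : ℕ) : ∀ᵐ t ∂sqNormLaw d, 0 ≤ t := by
  rw [sqNormLaw, ae_map_iff (by fun_prop) measurableSet_Ici]
  exact ae_of_all _ nsq_nonneg

lemma sqNormLaw_zero : sqNormLaw 0 = Measure.dirac 0 := by
  have : (nsq : (Fin 0 → ℂ) → ℝ) = fun _ => 0 := by funext v; simp [nsq]
  rw [sqNormLaw, this, Measure.map_const]; simp

lemma sqNormLaw_succ (d : ℕ) :
    sqNormLaw (d + 1) = ((stdComplexGaussian.map fun z => ‖z‖ ^ 2).prod (sqNormLaw d)).map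
      (fun p => p.1 + p.2) := by
  have h := (measurePreserving_piFinSuccAbove (fun _ : Fin (d + 1) => stdComplexGaussian) 0)
  have h2 := h.map_eq
  rw [sqNormLaw, sqNormLaw, Measure.map_prod_map _ _ (by fun_prop) (by fun_prop),
    Measure.map_map (by fun_prop) (by fun_prop)]
  change _ = Measure.map _
    (stdComplexGaussian.prod (Measure.pi fun j : Fin d => stdComplexGaussian))
  rw [← h2, Measure.map_map (by fun_prop) (by fun_prop)]
  congr 1
  funext v
  simp only [nsq_fin_succ]
  rfl

lemma integrable_norm_sq_pow (k : ℕ) :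
    Integrable (fun z : ℂ => (‖z‖ ^ 2) ^ k) stdComplexGaussian := by
  -- a function with nonzero integral is integrable, as the integral is zero otherwise
  by_contra h
  have := integral_norm_sq_pow k
  rw [integral_undef h] at this
  exact (Nat.factorial_ne_zero k) (by exact_mod_cast this.symm)

lemma integrable_pow_sqNormLaw (d k : ℕ) : Integrable (fun t : ℝ => t ^ k) (sqNormLaw d) := by
  induction d generalizing k with
  | zero => rw [sqNormLaw_zero]; exact integrable_dirac (by simp)
  | succ d ih =>
    rw [sqNormLaw_succ, integrable_map_measure (by fun_prop) (by fun_prop)]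
    simp only [Function.comp_def, add_pow]
    refine integrable_finsetSum _ fun i _ => ?_
    refine Integrable.mul_const ?_ _
    refine Integrable.mul_prod (f := fun x : ℝ => x ^ i) (g := fun x : ℝ => x ^ (k - i)) ?_ (ih _)
    rw [integrable_map_measure (by fun_prop) (by fun_prop)]
    exact integrable_norm_sq_pow i

lemma integral_pow_sqNormLaw_succ (d k : ℕ) : ∫ t, t ^ k ∂sqNormLaw (d + 1) =
    ∑ i ∈ Finset.range (k + 1), i.factorial * (∫ t, t ^ (k - i) ∂sqNormLaw d) * k.choose i := by
  have h1 (i : ℕ) : Integrable (fun x : ℝ => x ^ i) (stdComplexGaussian.map fun z => ‖z‖ ^ 2) := by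
    rw [integrable_map_measure (by fun_prop) (by fun_prop)]
    exact integrable_norm_sq_pow i
  rw [sqNormLaw_succ, integral_map (by fun_prop) (by fun_prop)]
  simp only [add_pow]
  rw [integral_finsetSum]
  · refine Finset.sum_congr rfl fun i _ => ?_
    rw [integral_mul_const, integral_prod_mul (fun x : ℝ => x ^ i) (fun x : ℝ => x ^ (k - i)),
      integral_map (by fun_prop) (by fun_prop), integral_norm_sq_pow]
  · intro i _
    exact ((h1 i).mul_prod (integrable_pow_sqNormLaw d _)).mul_const _

/-- The moments of `Gamma(d, 1)` are rising factorials (also for `d = 0`, the Dirac mass at `0`). -/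
lemma integral_pow_sqNormLaw (d : ℕ) : (∫ t, t ∂sqNormLaw d = d) ∧
    (∫ t, t ^ 2 ∂sqNormLaw d = d * (d + 1)) ∧
    (∫ t, t ^ 3 ∂sqNormLaw d = d * (d + 1) * (d + 2)) ∧
    (∫ t, t ^ 4 ∂sqNormLaw d = d * (d + 1) * (d + 2) * (d + 3)) := by
  induction d with
  | zero => simp [sqNormLaw_zero]
  | succ d ih =>
    obtain ⟨h1, h2, h3, h4⟩ := ih
    have h := integral_pow_sqNormLaw_succ d
    have e1 := h 1
    have e2 := h 2
    have e3 := h 3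
    have e4 := h 4
    simp [Finset.sum_range_succ, h1, h2, h3, h4, Nat.factorial, Nat.choose] at e1 e2 e3 e4
    rw [e1, e2, e3, e4]
    push_cast
    refine ⟨?_, ?_, ?_, ?_⟩ <;> ring

/-- A crude bound on all moments of `Gamma(d, 1)`, by convexity of the power. -/
lemma integral_pow_sqNormLaw_le (d k : ℕ) :
    ∫ t, t ^ k ∂sqNormLaw d ≤ d ^ k * k.factorial := by
  rcases k with _ | k
  · simp
  have hi : ∀ i : Fin d, Integrable (fun v : Fin d → ℂ => (‖v i‖ ^ 2) ^ (k + 1))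
      (stdComplexGaussianVec d) := fun i => by
    exact integrable_comp_eval (μ := fun _ : Fin d => stdComplexGaussian)
      (integrable_norm_sq_pow (k + 1))
  have hI : Integrable (fun v : Fin d → ℂ => nsq v ^ (k + 1)) (stdComplexGaussianVec d) := by
    have := integrable_pow_sqNormLaw d (k + 1)
    rwa [sqNormLaw, integrable_map_measure (by fun_prop) (by fun_prop)] at this
  rw [sqNormLaw, integral_map (by fun_prop) (by fun_prop)]
  calc ∫ v, nsq v ^ (k + 1) ∂stdComplexGaussianVec d
      ≤ ∫ v, (d : ℝ) ^ k * ∑ i, (‖v i‖ ^ 2) ^ (k + 1) ∂stdComplexGaussianVec d := by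
        refine integral_mono hI ((integrable_finsetSum _ fun i _ => hi i).const_mul _) fun v => ?_
        have := pow_sum_le_card_mul_sum_pow (s := Finset.univ) (f := fun i => ‖v i‖ ^ 2)
          (fun i _ => by positivity) k
        simpa [nsq] using this
    _ = (d : ℝ) ^ (k + 1) * (k + 1).factorial := by
        rw [integral_const_mul, integral_finsetSum _ fun i _ => hi i]
        have : ∀ i : Fin d, ∫ v, (‖v i‖ ^ 2) ^ (k + 1) ∂stdComplexGaussianVec d
            = (k + 1).factorial := fun i => by
          rw [← integral_norm_sq_pow]
          exact integral_comp_eval (μ := fun _ : Fin d => stdComplexGaussian)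
            (f := fun z : ℂ => (‖z‖ ^ 2) ^ (k + 1)) (by fun_prop)
        simp only [this, Finset.sum_const, Finset.card_univ, Fintype.card_fin, nsmul_eq_mul]
        ring

/-! ### Bidiagonal form of a Gaussian matrix -/

lemma nsq_smul_add {d : ℕ} (t : ℝ) (x y : Fin d → ℂ) :
    nsq ((t : ℂ) • x + y) = t ^ 2 * nsq x + 2 * t * (star x ⬝ᵥ y).re + nsq y := by
  simp only [nsq, dotProduct, Complex.re_sum, Finset.mul_sum, ← Finset.sum_add_distrib]
  refine Finset.sum_congr rfl fun i _ => ?_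
  simp only [← Complex.normSq_eq_norm_sq, Complex.normSq_apply]
  simp
  ring

/-- The squared norms of `B v`, `Bᴴ B v` and `B Bᴴ B v`. -/
def krylovNorms {n m : ℕ} (B : Matrix (Fin n) (Fin m) ℂ) (v : Fin m → ℂ) : ℝ × ℝ × ℝ :=
  (nsq (B *ᵥ v), nsq (Bᴴ *ᵥ (B *ᵥ v)), nsq (B *ᵥ (Bᴴ *ᵥ (B *ᵥ v))))

@[fun_prop]
lemma measurable_krylovNorms {α : Type*} [MeasurableSpace α] {n m : ℕ}
    {f : α → Fin n → Fin m → ℂ} {g : α → Fin m → ℂ} (hf : Measurable f) (hg : Measurable g) :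
    Measurable fun a => krylovNorms (Matrix.of (f a)) (g a) := by
  have h0 : Continuous fun p : (Fin n → Fin m → ℂ) × (Fin m → ℂ) => Matrix.of p.1 :=
    continuous_fst
  have h1 : Continuous fun p : (Fin n → Fin m → ℂ) × (Fin m → ℂ) => Matrix.of p.1 *ᵥ p.2 :=
    Continuous.matrix_mulVec h0 continuous_snd
  have h2 : Continuous fun p : (Fin n → Fin m → ℂ) × (Fin m → ℂ) =>
      (Matrix.of p.1)ᴴ *ᵥ (Matrix.of p.1 *ᵥ p.2) :=
    Continuous.matrix_mulVec (Continuous.matrix_conjTranspose h0) h1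
  have h3 : Continuous fun p : (Fin n → Fin m → ℂ) × (Fin m → ℂ) =>
      Matrix.of p.1 *ᵥ ((Matrix.of p.1)ᴴ *ᵥ (Matrix.of p.1 *ᵥ p.2)) :=
    Continuous.matrix_mulVec h0 h2
  have h : Measurable fun p : (Fin n → Fin m → ℂ) × (Fin m → ℂ) =>
      krylovNorms (Matrix.of p.1) p.2 :=
    Measurable.prodMk (measurable_nsq.comp h1.measurable)
      (Measurable.prodMk (measurable_nsq.comp h2.measurable) (measurable_nsq.comp h3.measurable))
  have h' : Measurable fun a => (f a, g a) := hf.prodMk hg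
  have h4 := h.comp h'
  simp only [Function.comp_def] at h4
  exact h4

lemma krylovNorms_mul_unitary {n m : ℕ} (B : Matrix (Fin n) (Fin m) ℂ)
    (U : Matrix (Fin m) (Fin m) ℂ) (hU : U * Uᴴ = 1) (v : Fin m → ℂ) :
    krylovNorms (B * U) v = krylovNorms B (U *ᵥ v) := by
  have h1 : (B * U) *ᵥ v = B *ᵥ (U *ᵥ v) := by rw [Matrix.mulVec_mulVec]
  have h2 : ∀ x, (B * U)ᴴ *ᵥ x = Uᴴ *ᵥ (Bᴴ *ᵥ x) := fun x => by
    rw [Matrix.conjTranspose_mul, Matrix.mulVec_mulVec]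
  have h3 : ∀ x, (B * U) *ᵥ (Uᴴ *ᵥ x) = B *ᵥ x := fun x => by
    rw [Matrix.mulVec_mulVec, Matrix.mul_assoc, hU, Matrix.mul_one]
  unfold krylovNorms
  rw [h1, h2, h3, nsq_mulVec_of_isometry Uᴴ (by rwa [Matrix.conjTranspose_conjTranspose])]

/-- One step of the Golub–Kahan recursion: the Krylov norms with a multiple of the first basis
vector are expressed by the first column and the Krylov norms of the other columns. -/
lemma krylovNorms_single {n m : ℕ} (C : Fin (m + 1) → Fin n → ℂ) (r : ℝ) :
    krylovNorms (Matrix.of C)ᵀ (Pi.single 0 (r : ℂ)) =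
      let t := nsq (C 0)
      let k := krylovNorms (Matrix.of fun j i => C (Fin.succ j) i) (star (C 0))
      (r ^ 2 * t, r ^ 2 * (t ^ 2 + k.1), r ^ 2 * (t ^ 3 + 2 * t * k.1 + k.2.1)) := by
  set B := (Matrix.of C)ᵀ
  set D := (Matrix.of fun j i => C (Fin.succ j) i)
  set t := nsq (C 0) with ht
  have h1 : B *ᵥ (Pi.single 0 (r : ℂ)) = (r : ℂ) • C 0 := by
    ext i; simp [B]; ring
  set w : Fin (m + 1) → ℂ := Fin.cons (t : ℂ) (star (D *ᵥ star (C 0))) with hw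
  have h2 : Bᴴ *ᵥ C 0 = w := by
    ext j
    refine Fin.cases ?_ (fun j => ?_) j
    · rw [hw, Fin.cons_zero, ht, ofReal_nsq]
      simp [B, Matrix.mulVec, dotProduct]
    · rw [hw, Fin.cons_succ]
      simp [B, D, Matrix.mulVec, dotProduct]
  have h3 : B *ᵥ w = (t : ℂ) • C 0 + star (Dᴴ *ᵥ (D *ᵥ star (C 0))) := by
    ext i
    rw [Matrix.star_mulVec, Matrix.conjTranspose_conjTranspose]
    simp only [hw, B, D, Matrix.mulVec, Matrix.vecMul, dotProduct, Fin.sum_univ_succ,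
      Fin.cons_zero, Fin.cons_succ, Matrix.transpose_apply, Matrix.of_apply, Pi.add_apply,
      Pi.smul_apply, smul_eq_mul]
    rw [mul_comm (t : ℂ)]
    congr 1
    exact Finset.sum_congr rfl fun j _ => mul_comm _ _
  have h4 : star (C 0) ⬝ᵥ star (Dᴴ *ᵥ (D *ᵥ star (C 0))) = (nsq (D *ᵥ star (C 0)) : ℂ) := by
    rw [Matrix.star_mulVec, Matrix.conjTranspose_conjTranspose, dotProduct_comm,
      ← Matrix.dotProduct_mulVec, ofReal_nsq]
  have hr : ‖(r : ℂ)‖ ^ 2 = r ^ 2 := by simp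
  simp only [krylovNorms, h1, h2, h3, Matrix.mulVec_smul, nsq_smul, hr, Prod.mk.injEq]
  refine ⟨rfl, ?_, ?_⟩
  · rw [nsq_fin_succ]
    simp only [hw, Fin.cons_zero, Fin.cons_succ]
    change r ^ 2 * (_ + nsq (star (D *ᵥ star (C 0)))) = _
    rw [nsq_star]
    simp
  · rw [nsq_smul_add, h4, nsq_star, Complex.ofReal_re, ← ht]
    ring

lemma map_fst_gaussianMatrix_succ (n m : ℕ) :
    (gaussianMatrix (n + 1) m).map (MeasurableEquiv.piFinSuccAbove (fun _ => Fin m → ℂ) 0) =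
      (stdComplexGaussianVec m).prod (gaussianMatrix n m) :=
  (measurePreserving_piFinSuccAbove (fun _ : Fin (n + 1) => stdComplexGaussianVec m) 0).map_eq

/-- One step of the bidiagonalization of a Gaussian matrix `B`: after a rotation `v` is a multiple
of the first basis vector, and then the first column `c` of `B` and the matrix `D` of its other
columns, transposed, are independent and Gaussian. -/
lemma lintegral_krylovNorms_step {n m : ℕ} (v : Fin (m + 1) → ℂ) {F : ℝ × ℝ × ℝ → ENNReal}
    (hF : Measurable F) :
    ∫⁻ B, F (krylovNorms (Matrix.of B) v) ∂gaussianMatrix n (m + 1) =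
      ∫⁻ c, ∫⁻ D, F (nsq v * nsq c, nsq v * (nsq c ^ 2 + (krylovNorms (Matrix.of D) (star c)).1),
        nsq v * (nsq c ^ 3 + 2 * nsq c * (krylovNorms (Matrix.of D) (star c)).1
          + (krylovNorms (Matrix.of D) (star c)).2.1)) ∂gaussianMatrix m n
        ∂stdComplexGaussianVec n := by
  obtain ⟨U, hU1, hU2, hUv⟩ := exists_unitary_mulVec_eq v
  have hUt : Uᵀ * (Uᵀ)ᴴ = 1 := by
    rw [show (Uᵀ)ᴴ = (Uᴴ)ᵀ from rfl, ← Matrix.transpose_mul, hU1, Matrix.transpose_one]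
  have hUm : Measurable fun (B : Fin n → Fin (m + 1) → ℂ) i => Uᵀ *ᵥ B i :=
    measurable_pi_lambda _ fun i =>
      ((Continuous.matrix_mulVec continuous_const continuous_id).measurable).comp
        (measurable_pi_apply i)
  have hFk : Measurable fun B : Fin n → Fin (m + 1) → ℂ => F (krylovNorms (Matrix.of B) v) := by
    fun_prop
  have hFk' : Measurable fun B : Fin n → Fin (m + 1) → ℂ =>
      F (krylovNorms (Matrix.of fun i => Uᵀ *ᵥ B i) v) := by
    fun_prop
  rw [← map_mul_gaussianMatrix Uᵀ hUt, lintegral_map hFk hUm,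
    ← map_swap_gaussianMatrix (m + 1) n, lintegral_map hFk' (by fun_prop)]
  have h1 : ∀ C : Fin (m + 1) → Fin n → ℂ, krylovNorms
      (Matrix.of fun i => Uᵀ *ᵥ fun j => C j i) v =
      krylovNorms (Matrix.of C)ᵀ (Pi.single 0 ((√(nsq v) : ℝ) : ℂ)) := by
    intro C
    rw [← hUv, ← krylovNorms_mul_unitary _ U hU2]
    congr 1
    ext i j
    simp [Matrix.mul_apply, Matrix.mulVec, dotProduct, mul_comm]
  simp only [h1, krylovNorms_single, Real.sq_sqrt (nsq_nonneg v)]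
  have hk : Measurable fun p : (Fin n → ℂ) × (Fin m → Fin n → ℂ) =>
      krylovNorms (Matrix.of p.2) (star p.1) := by fun_prop
  have hk' : Measurable fun p : (Fin n → ℂ) × (Fin m → Fin n → ℂ) => (nsq v * nsq p.1,
      nsq v * (nsq p.1 ^ 2 + (krylovNorms (Matrix.of p.2) (star p.1)).1),
      nsq v * (nsq p.1 ^ 3 + 2 * nsq p.1 * (krylovNorms (Matrix.of p.2) (star p.1)).1
        + (krylovNorms (Matrix.of p.2) (star p.1)).2.1)) := by
    have h1 := hk.fst
    have h2 := hk.snd.fst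
    refine Measurable.prodMk (by fun_prop) (Measurable.prodMk ?_ ?_)
    · exact ((measurable_nsq.comp measurable_fst).pow_const 2 |>.add h1).const_mul _
    · exact (((measurable_nsq.comp measurable_fst).pow_const 3 |>.add
        (((measurable_nsq.comp measurable_fst).const_mul 2).mul h1)).add h2).const_mul _
  have h2 := map_fst_gaussianMatrix_succ m n
  rw [← lintegral_prod (f := fun p : (Fin n → ℂ) × (Fin m → Fin n → ℂ) => F (nsq v * nsq p.1,
    nsq v * (nsq p.1 ^ 2 + (krylovNorms (Matrix.of p.2) (star p.1)).1),
        nsq v * (nsq p.1 ^ 3 + 2 * nsq p.1 * (krylovNorms (Matrix.of p.2) (star p.1)).1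
          + (krylovNorms (Matrix.of p.2) (star p.1)).2.1))), ← h2, lintegral_map]
  · rfl
  · exact hF.comp hk'
  · fun_prop
  · exact (hF.comp hk').aemeasurable

/-- The Krylov norms `‖B v‖²`, `‖Bᴴ B v‖²` and `‖B Bᴴ B v‖²` in terms of `s = ‖v‖²` and of the
squares `t`, `w`, `x` of the first entries of the bidiagonal form of `B`. -/
def bidiagonalNorms (s t w x : ℝ) : ℝ × ℝ × ℝ :=
  (s * t, s * (t * (t + w)), s * (t * ((t + w) ^ 2 + w * x)))

/-- The squared entries of the bidiagonal form of a Gaussian `n × (m + 1)` matrix are independent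
with laws `Gamma(n)`, `Gamma(m)` and `Gamma(n - 1)`. For `n = 0` the truncated `n - 1` does no harm,
as then `t = 0` almost surely. -/
lemma lintegral_krylovNorms {n m : ℕ} (v : Fin (m + 1) → ℂ) {F : ℝ × ℝ × ℝ → ENNReal}
    (hF : Measurable F) :
    ∫⁻ B, F (krylovNorms (Matrix.of B) v) ∂gaussianMatrix n (m + 1) =
      ∫⁻ t, ∫⁻ w, ∫⁻ x, F (bidiagonalNorms (nsq v) t w x) ∂sqNormLaw (n - 1) ∂sqNormLaw m
        ∂sqNormLaw n := by
  have hx : ∀ {d : ℕ} {f : ℝ → ENNReal}, Measurable f →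
      ∫⁻ t, f t ∂sqNormLaw d = ∫⁻ c, f (nsq c) ∂stdComplexGaussianVec d := fun hf => by
    rw [sqNormLaw, lintegral_map hf (by fun_prop)]
  have hb : Measurable fun p : ℝ × ℝ × ℝ => F (bidiagonalNorms (nsq v) p.1 p.2.1 p.2.2) :=
    hF.comp (by unfold bidiagonalNorms; fun_prop)
  rw [lintegral_krylovNorms_step v hF]
  rw [hx]
  swap
  · refine Measurable.lintegral_prod_right' (f := fun p : ℝ × ℝ =>
      ∫⁻ x, F (bidiagonalNorms (nsq v) p.1 p.2 x) ∂sqNormLaw (n - 1)) ?_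
    refine Measurable.lintegral_prod_right' (f := fun p : (ℝ × ℝ) × ℝ =>
      F (bidiagonalNorms (nsq v) p.1.1 p.1.2 p.2)) ?_
    exact hF.comp (by unfold bidiagonalNorms; fun_prop)
  refine lintegral_congr fun c => ?_
  rcases n with _ | n
  · have h0 : ∀ {d} (v : Fin d → ℂ) (h : v = 0), nsq v = 0 := by
      rintro d v rfl; simp [nsq]
    have hc : nsq c = 0 := by simp [nsq]
    have hk : ∀ D : Fin m → Fin 0 → ℂ, krylovNorms (Matrix.of D) (star c) = (0, 0, 0) := by
      intro D
      have : star c = 0 := Subsingleton.elim _ _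
      simp [krylovNorms, this, h0]
    simp [hk, hc, bidiagonalNorms]
  rw [lintegral_krylovNorms_step (star c) (F := fun k => F (nsq v * nsq c,
    nsq v * (nsq c ^ 2 + k.1), nsq v * (nsq c ^ 3 + 2 * nsq c * k.1 + k.2.1)))
    (hF.comp (by fun_prop)), hx]
  swap
  · refine Measurable.lintegral_prod_right' (f := fun p : ℝ × ℝ =>
      F (bidiagonalNorms (nsq v) (nsq c) p.1 p.2)) ?_
    exact hF.comp (by unfold bidiagonalNorms; fun_prop)
  refine lintegral_congr fun d => ?_
  rw [nsq_star, Nat.add_sub_cancel]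
  rcases m with _ | m
  · have hc : nsq d = 0 := by simp [nsq]
    have hk : ∀ D : Fin n → Fin 0 → ℂ, krylovNorms (Matrix.of D) (star d) = (0, 0, 0) := by
      intro D
      have : star d = 0 := Subsingleton.elim _ _
      simp [krylovNorms, this, nsq]
    simp [hk, hc, bidiagonalNorms]
    congr 3 <;> ring
  rw [lintegral_krylovNorms_step (star d) (F := fun k => F (nsq v * nsq c,
    nsq v * (nsq c ^ 2 + nsq c * nsq d), nsq v * (nsq c ^ 3 + 2 * nsq c * (nsq c * nsq d)
      + nsq c * (nsq d ^ 2 + k.1))))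
    (hF.comp (by fun_prop)), hx]
  swap
  · exact hF.comp (by unfold bidiagonalNorms; fun_prop)
  refine lintegral_congr fun e => ?_
  rw [nsq_star]
  simp only [lintegral_const, measure_univ, mul_one, bidiagonalNorms]
  congr 3 <;> ring

/-! ### Statistics of one row of a Gaussian matrix -/

/-- The joint law of the squared norm of one row of a Gaussian matrix with `n + 1` rows of length
`m + 1` and of the first squared entries of the bidiagonal form of the other rows. -/
def bidiagonalLaw (n m : ℕ) : Measure (ℝ × ℝ × ℝ × ℝ) :=
  (sqNormLaw (m + 1)).prod ((sqNormLaw n).prod ((sqNormLaw m).prod (sqNormLaw (n - 1))))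

instance (n m : ℕ) : IsProbabilityMeasure (bidiagonalLaw n m) := by
  unfold bidiagonalLaw; infer_instance

/-- The squared norm of row `k` and the Krylov norms of the other rows with respect to it. -/
def rowStats {n m : ℕ} (k : Fin (n + 1)) (Y : Fin (n + 1) → Fin m → ℂ) : ℝ × ℝ × ℝ × ℝ :=
  (nsq (Y k), krylovNorms (Matrix.of fun j i => Y (k.succAbove j) i) (star (Y k)))

lemma measurable_rowStats {n m : ℕ} (k : Fin (n + 1)) :
    Measurable (rowStats (m := m) k) := by
  have h1 : Measurable fun Y : Fin (n + 1) → Fin m → ℂ =>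
      krylovNorms (Matrix.of fun j i => Y (k.succAbove j) i) (star (Y k)) := by fun_prop
  exact Measurable.prodMk (by fun_prop) h1

@[fun_prop]
lemma measurable_bidiagonalNorms :
    Measurable fun p : ℝ × ℝ × ℝ × ℝ => (p.1, bidiagonalNorms p.1 p.2.1 p.2.2.1 p.2.2.2) := by
  unfold bidiagonalNorms; fun_prop

/-- Row `k` is independent of the other rows, and the Krylov norms of these depend on it only
through its norm. -/
theorem map_rowStats_gaussianMatrix {n m : ℕ} (k : Fin (n + 1)) :
    (gaussianMatrix (n + 1) (m + 1)).map (rowStats k) =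
      (bidiagonalLaw n m).map fun p => (p.1, bidiagonalNorms p.1 p.2.1 p.2.2.1 p.2.2.2) := by
  refine Measure.ext_of_lintegral _ fun F hF => ?_
  rw [lintegral_map hF (measurable_rowStats k), lintegral_map hF (by fun_prop)]
  have hk : Measurable fun p : (Fin (m + 1) → ℂ) × (Fin n → Fin (m + 1) → ℂ) =>
      krylovNorms (Matrix.of p.2) (star p.1) := by fun_prop
  have hk' : Measurable fun p : (Fin (m + 1) → ℂ) × (Fin n → Fin (m + 1) → ℂ) =>
      (nsq p.1, krylovNorms (Matrix.of p.2) (star p.1)) :=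
    Measurable.prodMk (measurable_nsq.comp measurable_fst) hk
  have h1 := (measurePreserving_piFinSuccAbove
    (fun _ : Fin (n + 1) => stdComplexGaussianVec (m + 1)) k).lintegral_comp (hF.comp hk')
  have h2 : ∫⁻ Y, F (rowStats k Y) ∂gaussianMatrix (n + 1) (m + 1) =
      ∫⁻ p, F (nsq p.1, krylovNorms (Matrix.of p.2) (star p.1))
        ∂(stdComplexGaussianVec (m + 1)).prod (gaussianMatrix n (m + 1)) := h1
  rw [h2, lintegral_prod (fun p : (Fin (m + 1) → ℂ) × (Fin n → Fin (m + 1) → ℂ) =>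
      F (nsq p.1, krylovNorms (Matrix.of p.2) (star p.1))) (hF.comp hk').aemeasurable,
    bidiagonalLaw, lintegral_prod, sqNormLaw, lintegral_map]
  · refine lintegral_congr fun v => ?_
    rw [lintegral_krylovNorms (star v) (F := fun y => F (nsq v, y)) (by fun_prop), nsq_star,
      lintegral_prod]
    · refine lintegral_congr fun t => ?_
      rw [lintegral_prod]
      exact (hF.comp (by unfold bidiagonalNorms; fun_prop)).aemeasurable
    · exact (hF.comp (by unfold bidiagonalNorms; fun_prop)).aemeasurable
  · refine Measurable.lintegral_prod_right' (f := fun p : ℝ × ℝ × ℝ × ℝ =>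
      F (p.1, bidiagonalNorms p.1 p.2.1 p.2.2.1 p.2.2.2)) (by fun_prop)
  · fun_prop
  · fun_prop

/-- The Gram matrix `G = Yᴴ Y / m` of the vectors `Y k`. -/
def sampleGram {K m : ℕ} (Y : Fin K → Fin m → ℂ) : Matrix (Fin K) (Fin K) ℂ :=
  Matrix.of fun k j => ((m : ℝ)⁻¹ : ℂ) * (star (Y k) ⬝ᵥ Y j)

section Algebra

variable {n m : ℕ} (Y : Fin (n + 1) → Fin m → ℂ) (k : Fin (n + 1))

lemma sampleGram_self {K : ℕ} (Y : Fin K → Fin m → ℂ) (k : Fin K) :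
    sampleGram Y k k = ((nsq (Y k) / m : ℝ) : ℂ) := by
  simp [sampleGram, ← ofReal_nsq]; ring

lemma sampleGram_succAbove (j : Fin n) : sampleGram Y k (k.succAbove j) =
    ((m : ℝ)⁻¹ : ℂ) * ((Matrix.of fun j i => Y (k.succAbove j) i) *ᵥ star (Y k)) j := by
  simp only [sampleGram, Matrix.of_apply, Matrix.mulVec]
  rw [dotProduct_comm]

lemma sampleGram_star {K : ℕ} (Y : Fin K → Fin m → ℂ) (k j : Fin K) :
    sampleGram Y j k = star (sampleGram Y k j) := by
  simp [sampleGram, dotProduct, mul_comm]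

lemma sampleGram_sq_self : (sampleGram Y * sampleGram Y) k k =
    (((rowStats k Y).1 / m) ^ 2 + (rowStats k Y).2.1 / m ^ 2 : ℝ) := by
  rw [Matrix.mul_apply, Fin.sum_univ_succAbove _ k, sampleGram_self]
  have : ∀ j : Fin n, sampleGram Y k (k.succAbove j) * sampleGram Y (k.succAbove j) k =
      ((1 / m ^ 2 *
        ‖((Matrix.of fun j i => Y (k.succAbove j) i) *ᵥ star (Y k)) j‖ ^ 2 : ℝ) : ℂ) := by
    intro j
    rw [sampleGram_star Y k, Complex.star_def, Complex.mul_conj, sampleGram_succAbove,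
      Complex.normSq_eq_norm_sq]
    congr 1
    simp
    ring
  simp only [this]
  rw [← Complex.ofReal_sum, ← Finset.mul_sum]
  simp only [rowStats, krylovNorms, nsq]
  push_cast
  ring

lemma sampleGram_sq_succAbove (j : Fin n) :
    (sampleGram Y * sampleGram Y) k (k.succAbove j) =
      ((rowStats k Y).1 / m : ℝ) * sampleGram Y k (k.succAbove j) +
      ((m : ℝ)⁻¹ : ℂ) ^ 2 * ((Matrix.of fun j i => Y (k.succAbove j) i) *ᵥ
        ((Matrix.of fun j i => Y (k.succAbove j) i)ᴴ *ᵥ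
          ((Matrix.of fun j i => Y (k.succAbove j) i) *ᵥ star (Y k)))) j := by
  rw [Matrix.mul_apply, Fin.sum_univ_succAbove _ k, sampleGram_self]
  congr 1
  simp only [sampleGram_succAbove]
  set B : Matrix (Fin n) (Fin m) ℂ := Matrix.of fun j i => Y (k.succAbove j) i
  rw [Matrix.mulVec_mulVec _ B Bᴴ]
  have hmv : ∀ x : Fin n → ℂ, ((B * Bᴴ) *ᵥ x) j = ∑ l, (B * Bᴴ) j l * x l := fun _ => rfl
  rw [hmv, Finset.mul_sum]
  refine Finset.sum_congr rfl fun l _ => ?_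
  have : sampleGram Y (k.succAbove l) (k.succAbove j) = ((m : ℝ)⁻¹ : ℂ) * (B * Bᴴ) j l := by
    simp only [sampleGram, Matrix.of_apply, Matrix.mul_apply, B, Matrix.conjTranspose_apply,
      dotProduct, Pi.star_apply]
    congr 1
    exact Finset.sum_congr rfl fun i _ => mul_comm _ _
  rw [this]
  ring

end Algebra

/-- Signal amplitude of the effective channel `2G - q G²`, from the row statistics. -/
def signalAmp (q : ℝ) (m : ℕ) (p : ℝ × ℝ × ℝ × ℝ) : ℝ :=
  p.1 / m * (2 - q * (p.1 / m)) - q * (p.2.1 / m ^ 2)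

/-- Interference power of the effective channel `2G - q G²`, from the row statistics. -/
def interferencePower (q : ℝ) (m : ℕ) (p : ℝ × ℝ × ℝ × ℝ) : ℝ :=
  (2 - q * (p.1 / m)) ^ 2 * (p.2.1 / m ^ 2) - 2 * q * (2 - q * (p.1 / m)) * (p.2.2.1 / m ^ 3)
    + q ^ 2 * (p.2.2.2 / m ^ 4)

/-- Diagonal entry of `G (2 - q G)²`, from the row statistics. -/
def transmitPower (q : ℝ) (m : ℕ) (p : ℝ × ℝ × ℝ × ℝ) : ℝ :=
  4 * (p.1 / m) - 4 * q * ((p.1 / m) ^ 2 + p.2.1 / m ^ 2)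
    + q ^ 2 * ((p.1 / m) ^ 3 + 2 * (p.1 / m) * (p.2.1 / m ^ 2) + p.2.2.1 / m ^ 3)

/-- The effective channel `2G - q G²`, up to a scalar. -/
def effectiveChannel {K : ℕ} (q : ℝ) (G : Matrix (Fin K) (Fin K) ℂ) : Matrix (Fin K) (Fin K) ℂ :=
  (2 : ℂ) • G - (q : ℂ) • (G * G)

section Stats

variable {n m : ℕ} (q : ℝ) (Y : Fin (n + 1) → Fin m → ℂ) (k : Fin (n + 1))

lemma effectiveChannel_self :
    effectiveChannel q (sampleGram Y) k k = (signalAmp q m (rowStats k Y) : ℂ) := by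
  simp only [effectiveChannel, Matrix.sub_apply, Matrix.smul_apply, sampleGram_sq_self,
    sampleGram_self, signalAmp, smul_eq_mul, rowStats]
  push_cast
  ring

/-- Off the diagonal, row `k` of `2G - q G²` is a combination of `B v` and `B Bᴴ B v` for the
matrix `B` of the other rows and `v` the conjugate of row `k`, so that only the Krylov norms enter.
-/
lemma sum_effectiveChannel_succAbove :
    ∑ j, ‖effectiveChannel q (sampleGram Y) k (Fin.succAbove k j)‖ ^ 2 =
      interferencePower q m (rowStats k Y) := by
  set B : Matrix (Fin n) (Fin m) ℂ := Matrix.of fun j i => Y (k.succAbove j) i with hB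
  set a : ℝ := nsq (Y k) / m
  have h : ∀ j, effectiveChannel q (sampleGram Y) k (k.succAbove j) =
      ((((2 - q * a) * (m : ℝ)⁻¹ : ℝ) : ℂ) • (B *ᵥ star (Y k)) +
        ((-q * ((m : ℝ)⁻¹) ^ 2 : ℝ) : ℂ) • (B *ᵥ (Bᴴ *ᵥ (B *ᵥ star (Y k))))) j := by
    intro j
    simp only [effectiveChannel, Matrix.sub_apply, Matrix.smul_apply, sampleGram_sq_succAbove,
      sampleGram_succAbove, smul_eq_mul, Pi.add_apply, Pi.smul_apply, ← hB]
    change _ - (q : ℂ) * ((a : ℂ) * _ + _) = _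
    push_cast
    ring
  simp only [h]
  change nsq _ = _
  have h2 : star (B *ᵥ star (Y k)) ⬝ᵥ (B *ᵥ (Bᴴ *ᵥ (B *ᵥ star (Y k)))) =
      (nsq (Bᴴ *ᵥ (B *ᵥ star (Y k))) : ℂ) := by
    rw [Matrix.dotProduct_mulVec, ofReal_nsq]
    congr 1
    rw [Matrix.star_mulVec Bᴴ, Matrix.conjTranspose_conjTranspose]
  rw [nsq_smul_add, nsq_smul, dotProduct_smul, h2, smul_eq_mul, ← Complex.ofReal_mul,
    Complex.ofReal_re, Complex.norm_real, Real.norm_eq_abs, sq_abs]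
  simp only [interferencePower, rowStats, krylovNorms]
  change _ = (2 - q * a) ^ 2 * _ - 2 * q * (2 - q * a) * _ + _
  simp only [← hB]
  ring

/-- The diagonal of `G (2 - q G)²`, the matrix whose trace is the transmit power up to a scalar. -/
lemma transmitPower_self :
    ((4 : ℂ) • sampleGram Y - (4 * q : ℂ) • (sampleGram Y * sampleGram Y) +
      (q ^ 2 : ℂ) • (sampleGram Y * sampleGram Y * sampleGram Y)) k k =
      (transmitPower q m (rowStats k Y) : ℂ) := by
  set B : Matrix (Fin n) (Fin m) ℂ := Matrix.of fun j i => Y (k.succAbove j) i with hB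
  set a : ℝ := nsq (Y k) / m with ha
  have h2 : star (B *ᵥ star (Y k)) ⬝ᵥ (B *ᵥ (Bᴴ *ᵥ (B *ᵥ star (Y k)))) =
      (nsq (Bᴴ *ᵥ (B *ᵥ star (Y k))) : ℂ) := by
    rw [Matrix.dotProduct_mulVec, ofReal_nsq]
    congr 1
    rw [Matrix.star_mulVec Bᴴ, Matrix.conjTranspose_conjTranspose]
  have h3 : (sampleGram Y * sampleGram Y * sampleGram Y) k k =
      ((a ^ 3 + 2 * a * ((rowStats k Y).2.1 / m ^ 2) + (rowStats k Y).2.2.1 / m ^ 3 : ℝ) : ℂ) := by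
    rw [Matrix.mul_apply, Fin.sum_univ_succAbove _ k, sampleGram_sq_self, sampleGram_self]
    have : ∀ j : Fin n, (sampleGram Y * sampleGram Y) k (k.succAbove j) *
        sampleGram Y (k.succAbove j) k =
        (a * (((m : ℝ)⁻¹) ^ 2) : ℝ) * (star (B *ᵥ star (Y k)) j * (B *ᵥ star (Y k)) j) +
        ((((m : ℝ)⁻¹) ^ 3 : ℝ) : ℂ) * (star (B *ᵥ star (Y k)) j *
          (B *ᵥ (Bᴴ *ᵥ (B *ᵥ star (Y k)))) j) := by
      intro j
      rw [sampleGram_sq_succAbove, sampleGram_star Y k, sampleGram_succAbove, ← hB]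
      change ((a : ℂ) * _ + _) * _ = _
      rw [star_mul']
      simp only [Pi.star_apply, Complex.star_def, map_inv₀, Complex.conj_ofReal]
      push_cast
      ring
    simp only [this, Finset.sum_add_distrib, ← Finset.mul_sum]
    change _ + ((_ : ℂ) * (star (B *ᵥ star (Y k)) ⬝ᵥ (B *ᵥ star (Y k))) +
      _ * (star (B *ᵥ star (Y k)) ⬝ᵥ (B *ᵥ (Bᴴ *ᵥ (B *ᵥ star (Y k)))))) = _
    rw [h2, ← ofReal_nsq]
    simp only [rowStats, krylovNorms, ← hB, ← ha]
    push_cast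
    ring
  simp only [Matrix.sub_apply, Matrix.add_apply, Matrix.smul_apply, h3, sampleGram_sq_self,
    sampleGram_self, smul_eq_mul, transmitPower, ← ha]
  change _ = ((4 * a - 4 * q * (a ^ 2 + _) + _ * (a ^ 3 + 2 * a * _ + _) : ℝ) : ℂ)
  change _ - _ * (((a ^ 2 + _ : ℝ)) : ℂ) + _ = _
  push_cast
  ring

end Stats

/-! ### The precoder in terms of the Gram matrix -/

lemma channelCov_nonneg {M m : ℕ} {c : ℝ} (hc : 0 ≤ c) (A : Matrix (Fin M) (Fin m) ℂ) :
    0 ≤ channelCov c A := by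
  rw [Matrix.nonneg_iff_posSemidef, channelCov]
  exact (Matrix.posSemidef_self_mul_conjTranspose A).smul
    (by rw [Complex.zero_le_real]; positivity)

/-- The Gram matrix of a correlated channel with covariance `A Aᴴ / c` is the normalized Gram
matrix of an uncorrelated channel with `cM` antennas. -/
lemma IsCorrelatedChannel.exists_gaussianMatrix {Ω : Type*} [MeasurableSpace Ω] {P : Measure Ω}
    {M K : ℕ} {c : ℝ} {H : Ω → Matrix (Fin M) (Fin K) ℂ} (hc : 0 < c)
    (h : IsCorrelatedChannel P c H) :
    ∃ (m : ℕ) (Y : Ω → Fin K → Fin m → ℂ), (m : ℝ) = c * M ∧ HasLaw Y (gaussianMatrix K m) P ∧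
      ∀ x, gram (H x) = sampleGram (Y x) := by
  obtain ⟨m, A, z, hm, hA, hind, hlaw, hH⟩ := h
  have hiso := map_mulVec_stdComplexGaussianVec Aᴴ (by rwa [Matrix.conjTranspose_conjTranspose])
  have hAm : Measurable fun v : Fin M → ℂ => Aᴴ *ᵥ v :=
    (Continuous.matrix_mulVec continuous_const continuous_id).measurable
  refine ⟨m, fun x k => Aᴴ *ᵥ z k x, hm, ?_, ?_⟩
  · refine iIndepFun.hasLaw_pi (μ := fun _ : Fin K => stdComplexGaussianVec m)
      (X := fun k x => Aᴴ *ᵥ z k x) (fun k => ?_) (hind.comp (fun _ v => Aᴴ *ᵥ v) fun _ => hAm)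
    have h2 : HasLaw (fun v : Fin M → ℂ => Aᴴ *ᵥ v) (stdComplexGaussianVec m)
      (stdComplexGaussianVec M) := ⟨hAm.aemeasurable, hiso⟩
    exact h2.comp (hlaw k)
  · intro x
    have hR := channelCov_nonneg hc.le A
    set S := CFC.sqrt (channelCov c A) with hS
    have hSS : S * S = channelCov c A := CFC.sqrt_mul_sqrt_self _ hR
    have hSh : Sᴴ = S := by
      have := (Matrix.nonneg_iff_posSemidef.1 (CFC.sqrt_nonneg (channelCov c A))).isHermitian
      exact this
    ext k j
    have hcol : ∀ k, (fun i => H x i k) = S *ᵥ z k x := fun k => by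
      funext i; exact hH x i k
    have h1 : ((H x)ᴴ * H x) k j = star (S *ᵥ z k x) ⬝ᵥ (S *ᵥ z j x) := by
      rw [← hcol, ← hcol]; rfl
    have h2 : star (S *ᵥ z k x) ⬝ᵥ (S *ᵥ z j x) =
        ((1 / c : ℝ) : ℂ) * (star (Aᴴ *ᵥ z k x) ⬝ᵥ (Aᴴ *ᵥ z j x)) := by
      rw [Matrix.star_mulVec, ← Matrix.dotProduct_mulVec, Matrix.mulVec_mulVec, hSh, hSS,
        Matrix.star_mulVec, ← Matrix.dotProduct_mulVec, Matrix.mulVec_mulVec,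
        Matrix.conjTranspose_conjTranspose, channelCov, Matrix.smul_mulVec, dotProduct_smul,
        smul_eq_mul]
    simp only [gram, Matrix.smul_apply, h1, h2, sampleGram, Matrix.of_apply, smul_eq_mul]
    rw [← mul_assoc, hm]
    congr 1
    push_cast
    rw [mul_inv]
    ring

/-- The polynomial `D⁻¹ - D⁻¹ (G - D) D⁻¹` in `G` for `D = ω I`. -/
lemma ins_inverse {K : ℕ} {ω : ℝ} (hω : 0 < ω) (G : Matrix (Fin K) (Fin K) ℂ) :
    ((ω : ℂ) • (1 : Matrix (Fin K) (Fin K) ℂ))⁻¹ - ((ω : ℂ) • (1 : Matrix (Fin K) (Fin K) ℂ))⁻¹ *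
      (G - (ω : ℂ) • (1 : Matrix (Fin K) (Fin K) ℂ)) *
      ((ω : ℂ) • (1 : Matrix (Fin K) (Fin K) ℂ))⁻¹ =
    ((1 / ω : ℝ) : ℂ) • ((2 : ℂ) • (1 : Matrix (Fin K) (Fin K) ℂ) - ((1 / ω : ℝ) : ℂ) • G) := by
  have hω' : (ω : ℂ) ≠ 0 := by exact_mod_cast hω.ne'
  have hinv : ((ω : ℂ) • (1 : Matrix (Fin K) (Fin K) ℂ))⁻¹ =
      ((ω : ℂ)⁻¹) • (1 : Matrix (Fin K) (Fin K) ℂ) := by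
    apply Matrix.inv_eq_right_inv
    rw [Matrix.smul_mul, Matrix.mul_smul, smul_smul, mul_inv_cancel₀ hω', one_smul, Matrix.one_mul]
  rw [hinv]
  push_cast
  simp only [Matrix.smul_mul, Matrix.mul_smul, Matrix.one_mul, Matrix.mul_one, smul_sub, smul_smul]
  have e1 : (ω : ℂ)⁻¹ * ((ω : ℂ)⁻¹ * ω) = (ω : ℂ)⁻¹ := by field_simp
  simp only [one_div, e1]
  ext i j
  simp
  ring

variable {M K : ℕ} {β ω : ℝ}

lemma conjTranspose_mul_insPrecoder (hM : 0 < M) (hω : 0 < ω) (H : Matrix (Fin M) (Fin K) ℂ) :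
    Hᴴ * insPrecoder β ω H =
      ((β * (1 / ω) : ℝ) : ℂ) • effectiveChannel (1 / ω) (gram H) := by
  have hM' : (M : ℂ) ≠ 0 := by exact_mod_cast hM.ne'
  have hG : Hᴴ * H = (M : ℂ) • gram H := by
    rw [gram, smul_smul]
    push_cast
    rw [mul_one_div_cancel hM', one_smul]
  rw [insPrecoder, neumannPrecoder, ins_inverse hω, Matrix.mul_smul, ← Matrix.mul_assoc, hG,
    effectiveChannel]
  simp only [Matrix.smul_mul, Matrix.mul_smul, Matrix.mul_sub, Matrix.mul_one, smul_sub, smul_smul]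
  congr 2
  · push_cast; field_simp
  · push_cast; field_simp

lemma rxPower_insPrecoder (hM : 0 < M) (hω : 0 < ω) (H : Matrix (Fin M) (Fin K) ℂ) (k j : Fin K) :
    rxPower H (insPrecoder β ω H) k j =
      (β * (1 / ω)) ^ 2 * ‖effectiveChannel (1 / ω) (gram H) k j‖ ^ 2 := by
  rw [rxPower, conjTranspose_mul_insPrecoder hM hω, Matrix.smul_apply, smul_eq_mul, norm_mul,
    mul_pow, Complex.norm_real, Real.norm_eq_abs, sq_abs]

/-- The transmit power is the trace of `G (2 - q G)²` up to a scalar, where `q = 1 / ω`. -/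
lemma trace_insPrecoder (hM : 0 < M) (hω : 0 < ω) (H : Matrix (Fin M) (Fin K) ℂ) :
    (insPrecoder β ω H * (insPrecoder β ω H)ᴴ).trace =
      (((β * (1 / ω)) ^ 2 / M : ℝ) : ℂ) * ((4 : ℂ) • gram H - (4 * (1 / ω : ℝ) : ℂ) •
        (gram H * gram H) + ((1 / ω : ℝ) ^ 2 : ℂ) • (gram H * gram H * gram H)).trace := by
  have hM' : (M : ℂ) ≠ 0 := by exact_mod_cast hM.ne'
  have hG : Hᴴ * H = (M : ℂ) • gram H := by
    rw [gram, smul_smul]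
    push_cast
    rw [mul_one_div_cancel hM', one_smul]
  have hGh : (gram H)ᴴ = gram H := by
    rw [gram, Matrix.conjTranspose_smul, Matrix.conjTranspose_mul,
      Matrix.conjTranspose_conjTranspose, Complex.star_def, Complex.conj_ofReal]
  set q : ℂ := ((1 / ω : ℝ) : ℂ) with hq
  have hqs : star q = q := by rw [hq, Complex.star_def, Complex.conj_ofReal]
  have hbs : star ((β / M : ℝ) : ℂ) = ((β / M : ℝ) : ℂ) := by
    rw [Complex.star_def, Complex.conj_ofReal]
  have h2s : star (2 : ℂ) = 2 := by simp
  rw [Matrix.trace_mul_comm, insPrecoder, neumannPrecoder, ins_inverse hω, ← hq]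
  simp only [Matrix.conjTranspose_smul, Matrix.conjTranspose_mul, Matrix.conjTranspose_sub,
    Matrix.conjTranspose_one, hGh, hqs, hbs, h2s]
  have h : ∀ S T : Matrix (Fin K) (Fin K) ℂ, S * Hᴴ * (H * T) = (M : ℂ) • (S * gram H * T) := by
    intro S T
    rw [← Matrix.mul_assoc, Matrix.mul_assoc S, hG]
    simp
  have h1 : gram H * Hᴴ * H = (M : ℂ) • (gram H * gram H) := by
    rw [Matrix.mul_assoc, hG, Matrix.mul_smul]
  have h2 : Hᴴ * (H * gram H) = (M : ℂ) • (gram H * gram H) := by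
    rw [← Matrix.mul_assoc, hG, Matrix.smul_mul]
  simp only [Matrix.smul_mul, Matrix.mul_smul, h, h1, h2, hG, smul_smul, Matrix.sub_mul,
    Matrix.mul_sub, Matrix.one_mul, Matrix.mul_one, Matrix.trace_smul, Matrix.trace_sub,
    Matrix.trace_add, smul_eq_mul]
  have hq' : 1 / (ω : ℂ) = q := by rw [hq]; push_cast; rfl
  push_cast
  rw [hq']
  field_simp
  ring

/-! ### Exact moments -/

/-- The polynomial in four variables given by the list of its monomials, each by its coefficient and
its exponents. Its mean under `bidiagonalLaw` is read off from the list. -/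
def evalMonomials (l : List (ℝ × ℕ × ℕ × ℕ × ℕ)) (p : ℝ × ℝ × ℝ × ℝ) : ℝ :=
  (l.map fun c => c.1 * (p.1 ^ c.2.1 * (p.2.1 ^ c.2.2.1 *
    (p.2.2.1 ^ c.2.2.2.1 * p.2.2.2 ^ c.2.2.2.2)))).sum

lemma integrable_monomial (n m i j k l : ℕ) :
    Integrable (fun p : ℝ × ℝ × ℝ × ℝ => p.1 ^ i * (p.2.1 ^ j * (p.2.2.1 ^ k * p.2.2.2 ^ l)))
      (bidiagonalLaw n m) :=
  Integrable.mul_prod (f := fun t : ℝ => t ^ i)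
    (g := fun p : ℝ × ℝ × ℝ => p.1 ^ j * (p.2.1 ^ k * p.2.2 ^ l)) (integrable_pow_sqNormLaw _ _) <|
  Integrable.mul_prod (f := fun t : ℝ => t ^ j)
    (g := fun p : ℝ × ℝ => p.1 ^ k * p.2 ^ l) (integrable_pow_sqNormLaw _ _) <|
  Integrable.mul_prod (f := fun t : ℝ => t ^ k)
    (g := fun t : ℝ => t ^ l) (integrable_pow_sqNormLaw _ _) (integrable_pow_sqNormLaw _ _)

lemma integral_monomial (n m i j k l : ℕ) :
    ∫ p, p.1 ^ i * (p.2.1 ^ j * (p.2.2.1 ^ k * p.2.2.2 ^ l)) ∂bidiagonalLaw n m =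
      (∫ t, t ^ i ∂sqNormLaw (m + 1)) * ((∫ t, t ^ j ∂sqNormLaw n) *
        ((∫ t, t ^ k ∂sqNormLaw m) * ∫ t, t ^ l ∂sqNormLaw (n - 1))) := by
  rw [bidiagonalLaw, integral_prod_mul (fun t : ℝ => t ^ i)
    (fun p : ℝ × ℝ × ℝ => p.1 ^ j * (p.2.1 ^ k * p.2.2 ^ l)),
    integral_prod_mul (fun t : ℝ => t ^ j) (fun p : ℝ × ℝ => p.1 ^ k * p.2 ^ l),
    integral_prod_mul (fun t : ℝ => t ^ k) (fun t : ℝ => t ^ l)]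

lemma integrable_evalMonomials (n m : ℕ) (l : List (ℝ × ℕ × ℕ × ℕ × ℕ)) :
    Integrable (evalMonomials l) (bidiagonalLaw n m) := by
  induction l with
  | nil => exact integrable_const (0 : ℝ)
  | cons c l ih =>
    have : evalMonomials (c :: l) = fun p => c.1 * (p.1 ^ c.2.1 * (p.2.1 ^ c.2.2.1 *
        (p.2.2.1 ^ c.2.2.2.1 * p.2.2.2 ^ c.2.2.2.2))) + evalMonomials l p := by
      funext p; simp [evalMonomials]
    rw [this]
    exact ((integrable_monomial n m _ _ _ _).const_mul _).add ih

lemma integral_evalMonomials (n m : ℕ) (l : List (ℝ × ℕ × ℕ × ℕ × ℕ)) :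
    ∫ p, evalMonomials l p ∂bidiagonalLaw n m = (l.map fun c => c.1 *
      ((∫ t, t ^ c.2.1 ∂sqNormLaw (m + 1)) * ((∫ t, t ^ c.2.2.1 ∂sqNormLaw n) *
        ((∫ t, t ^ c.2.2.2.1 ∂sqNormLaw m) * ∫ t, t ^ c.2.2.2.2 ∂sqNormLaw (n - 1))))).sum := by
  induction l with
  | nil => simp [evalMonomials]
  | cons c l ih =>
    have : evalMonomials (c :: l) = fun p => c.1 * (p.1 ^ c.2.1 * (p.2.1 ^ c.2.2.1 *
        (p.2.2.1 ^ c.2.2.2.1 * p.2.2.2 ^ c.2.2.2.2))) + evalMonomials l p := by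
      funext p; simp [evalMonomials]
    rw [this, integral_add ((integrable_monomial n m _ _ _ _).const_mul _)
      (integrable_evalMonomials n m l), ih, integral_const_mul, integral_monomial]
    simp

/-- The row statistics as a function of the squared entries of the bidiagonal form. -/
def bidiagonalStats (p : ℝ × ℝ × ℝ × ℝ) : ℝ × ℝ × ℝ × ℝ :=
  (p.1, bidiagonalNorms p.1 p.2.1 p.2.2.1 p.2.2.2)

section Moments

variable (n m : ℕ) (q : ℝ) (p : ℝ × ℝ × ℝ × ℝ)

lemma signalAmp_bidiagonalStats : signalAmp q (m + 1) (bidiagonalStats p) =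
    p.1 / (m + 1) * (2 - q * (p.1 / (m + 1) + p.2.1 / (m + 1))) := by
  simp only [signalAmp, bidiagonalStats, bidiagonalNorms]
  push_cast
  field_simp
  ring

lemma interferencePower_bidiagonalStats : interferencePower q (m + 1) (bidiagonalStats p) =
    p.1 / (m + 1) * (p.2.1 / (m + 1)) *
      ((2 - q * (p.1 / (m + 1) + p.2.1 / (m + 1) + p.2.2.1 / (m + 1))) ^ 2
        + q ^ 2 * (p.2.2.1 / (m + 1)) * (p.2.2.2 / (m + 1))) := by
  simp only [interferencePower, bidiagonalStats, bidiagonalNorms]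
  push_cast
  field_simp
  ring

lemma transmitPower_bidiagonalStats : transmitPower q (m + 1) (bidiagonalStats p) =
    p.1 / (m + 1) * ((2 - q * (p.1 / (m + 1) + p.2.1 / (m + 1))) ^ 2
        + q ^ 2 * (p.2.1 / (m + 1)) * (p.2.2.1 / (m + 1))) := by
  simp only [transmitPower, bidiagonalStats, bidiagonalNorms]
  push_cast
  field_simp
  ring

lemma signalAmp_eq_evalMonomials : (fun p => signalAmp q (m + 1) (bidiagonalStats p)) =
    evalMonomials [(2 / (m + 1), 1, 0, 0, 0), (-q / (m + 1) ^ 2, 2, 0, 0, 0),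
      (-q / (m + 1) ^ 2, 1, 1, 0, 0)] := by
  funext p
  rw [signalAmp_bidiagonalStats]
  simp [evalMonomials]
  field_simp
  ring

lemma signalAmp_sq_eq_evalMonomials : (fun p => signalAmp q (m + 1) (bidiagonalStats p) ^ 2) =
    evalMonomials [(4 / (m + 1) ^ 2, 2, 0, 0, 0), (-4 * q / (m + 1) ^ 3, 3, 0, 0, 0),
      (-4 * q / (m + 1) ^ 3, 2, 1, 0, 0), (q ^ 2 / (m + 1) ^ 4, 4, 0, 0, 0),
      (2 * q ^ 2 / (m + 1) ^ 4, 3, 1, 0, 0), (q ^ 2 / (m + 1) ^ 4, 2, 2, 0, 0)] := by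
  funext p
  rw [signalAmp_bidiagonalStats]
  simp [evalMonomials]
  field_simp
  ring

lemma interferencePower_eq_evalMonomials :
    (fun p => interferencePower q (m + 1) (bidiagonalStats p)) =
    evalMonomials [(4 / (m + 1) ^ 2, 1, 1, 0, 0), (-4 * q / (m + 1) ^ 3, 2, 1, 0, 0),
      (-4 * q / (m + 1) ^ 3, 1, 2, 0, 0), (-4 * q / (m + 1) ^ 3, 1, 1, 1, 0),
      (q ^ 2 / (m + 1) ^ 4, 3, 1, 0, 0), (q ^ 2 / (m + 1) ^ 4, 1, 3, 0, 0),
      (q ^ 2 / (m + 1) ^ 4, 1, 1, 2, 0), (2 * q ^ 2 / (m + 1) ^ 4, 2, 2, 0, 0),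
      (2 * q ^ 2 / (m + 1) ^ 4, 2, 1, 1, 0), (2 * q ^ 2 / (m + 1) ^ 4, 1, 2, 1, 0),
      (q ^ 2 / (m + 1) ^ 4, 1, 1, 1, 1)] := by
  funext p
  rw [interferencePower_bidiagonalStats]
  simp [evalMonomials]
  field_simp
  ring

lemma transmitPower_eq_evalMonomials :
    (fun p => transmitPower q (m + 1) (bidiagonalStats p)) =
    evalMonomials [(4 / (m + 1), 1, 0, 0, 0), (-4 * q / (m + 1) ^ 2, 2, 0, 0, 0),
      (-4 * q / (m + 1) ^ 2, 1, 1, 0, 0), (q ^ 2 / (m + 1) ^ 3, 3, 0, 0, 0),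
      (2 * q ^ 2 / (m + 1) ^ 3, 2, 1, 0, 0), (q ^ 2 / (m + 1) ^ 3, 1, 2, 0, 0),
      (q ^ 2 / (m + 1) ^ 3, 1, 1, 1, 0)] := by
  funext p
  rw [transmitPower_bidiagonalStats]
  simp [evalMonomials]
  field_simp
  ring

lemma integrable_signalAmp :
    Integrable (fun p => signalAmp q (m + 1) (bidiagonalStats p)) (bidiagonalLaw n m) := by
  rw [signalAmp_eq_evalMonomials]; exact integrable_evalMonomials _ _ _

lemma integrable_signalAmp_sq :
    Integrable (fun p => signalAmp q (m + 1) (bidiagonalStats p) ^ 2) (bidiagonalLaw n m) := by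
  rw [signalAmp_sq_eq_evalMonomials]; exact integrable_evalMonomials _ _ _

lemma integrable_interferencePower :
    Integrable (fun p => interferencePower q (m + 1) (bidiagonalStats p)) (bidiagonalLaw n m) := by
  rw [interferencePower_eq_evalMonomials]; exact integrable_evalMonomials _ _ _

lemma integrable_transmitPower :
    Integrable (fun p => transmitPower q (m + 1) (bidiagonalStats p)) (bidiagonalLaw n m) := by
  rw [transmitPower_eq_evalMonomials]; exact integrable_evalMonomials _ _ _

lemma integral_signalAmp :
    ∫ p, signalAmp q (m + 1) (bidiagonalStats p) ∂bidiagonalLaw n m =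
      2 - q - q * ((n + 1) / (m + 1)) := by
  rw [signalAmp_eq_evalMonomials, integral_evalMonomials]
  simp [integral_pow_sqNormLaw]
  field_simp
  ring

lemma integral_signalAmp_sq {K a : ℝ} (hK : K = n + 1) (ha : a = 1 / (m + 1)) :
    ∫ p, signalAmp q (m + 1) (bidiagonalStats p) ^ 2 ∂bidiagonalLaw n m =
      (2 - q - q * (K * a)) ^ 2 + ((2 - 2 * q - K * a * q) ^ 2 + K * a * q ^ 2) * a
        + a ^ 2 * (-4 * q + 5 * q ^ 2) + a ^ 3 * (2 + 3 * K) * q ^ 2 := by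
  rw [signalAmp_sq_eq_evalMonomials, integral_evalMonomials, hK, ha]
  simp [integral_pow_sqNormLaw]
  field_simp
  ring

lemma integral_interferencePower {K a : ℝ} (hK : K = n + 1) (ha : a = 1 / (m + 1)) :
    ∫ p, interferencePower q (m + 1) (bidiagonalStats p) ∂bidiagonalLaw n m =
      (K - 1) * (((2 - 2 * q - K * a * q) ^ 2 + K * a * q ^ 2) * a + 2 * q ^ 2 * a ^ 3) := by
  rw [interferencePower_eq_evalMonomials, integral_evalMonomials, hK, ha]
  -- the truncated subtraction in the last parameter of `bidiagonalLaw` comes with a factor `n`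
  have hn : (n : ℝ) * ((n - 1 : ℕ) : ℝ) = n * (n - 1) := by
    rcases n with _ | n <;> simp
  simp [integral_pow_sqNormLaw]
  field_simp
  linear_combination q ^ 2 * m * hn

lemma integral_transmitPower {K a : ℝ} (hK : K = n + 1) (ha : a = 1 / (m + 1)) :
    ∫ p, transmitPower q (m + 1) (bidiagonalStats p) ∂bidiagonalLaw n m =
      (2 - q - q * (K * a)) ^ 2 + K * a * q ^ 2 + q ^ 2 * a ^ 2 := by
  rw [transmitPower_eq_evalMonomials, integral_evalMonomials, hK, ha]
  simp [integral_pow_sqNormLaw]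
  field_simp
  ring

end Moments

/-! ### Pointwise deviation of signal and interference power -/

lemma bidiagonalLaw_nonneg (n m : ℕ) :
    ∀ᵐ p ∂bidiagonalLaw n m, 0 ≤ p.1 ∧ 0 ≤ p.2.1 ∧ 0 ≤ p.2.2.1 ∧ 0 ≤ p.2.2.2 := by
  have h1 : ∀ᵐ p ∂bidiagonalLaw n m, 0 ≤ p.1 :=
    Measure.quasiMeasurePreserving_fst.ae (sqNormLaw_nonneg _)
  have h2 : ∀ᵐ p ∂bidiagonalLaw n m, 0 ≤ p.2.1 :=
    Measure.quasiMeasurePreserving_snd.ae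
      (Measure.quasiMeasurePreserving_fst.ae (sqNormLaw_nonneg _))
  have h3 : ∀ᵐ p ∂bidiagonalLaw n m, 0 ≤ p.2.2.1 :=
    Measure.quasiMeasurePreserving_snd.ae (Measure.quasiMeasurePreserving_snd.ae
      (Measure.quasiMeasurePreserving_fst.ae (sqNormLaw_nonneg _)))
  have h4 : ∀ᵐ p ∂bidiagonalLaw n m, 0 ≤ p.2.2.2 :=
    Measure.quasiMeasurePreserving_snd.ae (Measure.quasiMeasurePreserving_snd.ae
      (Measure.quasiMeasurePreserving_snd.ae (sqNormLaw_nonneg _)))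
  filter_upwards [h1, h2, h3, h4] with p h1 h2 h3 h4 using ⟨h1, h2, h3, h4⟩

section Pointwise

variable {q L κ a p w x r : ℝ}

/-- The factor `1 + q ^ 2`, here as in all later estimates, makes the bounds uniform in `q`. -/
lemma sq_two_sub_le (q s : ℝ) : (2 - q * s) ^ 2 ≤ (1 + q ^ 2) * (4 + s ^ 2) := by
  nlinarith [sq_nonneg (2 * q + s)]

lemma abs_sq_sub_sq_le (q s t : ℝ) (hs : 0 ≤ s) (ht : 0 ≤ t) :
    |(2 - q * s) ^ 2 - (2 - q * t) ^ 2| ≤ (1 + q ^ 2) * (|s - t| * (2 + s + t)) := by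
  have h : (2 - q * s) ^ 2 - (2 - q * t) ^ 2 = (s - t) * (-q * (4 - q * (s + t))) := by ring
  rw [h, abs_mul, mul_left_comm]
  refine mul_le_mul_of_nonneg_left ?_ (abs_nonneg _)
  rw [abs_le]
  constructor <;> nlinarith [sq_nonneg (1 - q), sq_nonneg (1 + q), sq_nonneg q, add_nonneg hs ht,
    mul_nonneg (sq_nonneg q) (add_nonneg hs ht)]

/-- Convexity of the sixth power, for five summands: the constant is `5 ^ 5`. -/
lemma pow_six_sum_le (ha : 0 ≤ a) (hp : 0 ≤ p) (hw : 0 ≤ w) (hx : 0 ≤ x) :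
    (1 + a + p + w + x) ^ 6 ≤ 3125 * (1 + a ^ 6 + p ^ 6 + w ^ 6 + x ^ 6) := by
  have := pow_sum_le_card_mul_sum_pow (s := Finset.univ) (f := ![1, a, p, w, x])
    (by intro i _; fin_cases i <;> simp [*]) 5
  simp [Fin.sum_univ_succ] at this
  norm_num at this
  have e1 : 1 + a + p + w + x = 1 + (a + (p + (w + x))) := by ring
  rw [e1]
  linarith

/-- Weighted inequality between the geometric and the arithmetic mean. -/
lemma mul_le_of_weights {U V u : ℝ} (hr : 0 < r) (hU : U ^ 2 ≤ u) :
    U * V ≤ (1 / 2) * (u / r + r * V ^ 2) := by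
  have h : U ^ 2 / r ≤ u / r := by gcongr
  have h2 : 0 ≤ (U - r * V) ^ 2 / r := by positivity
  have h3 : (U - r * V) ^ 2 / r = U ^ 2 / r - 2 * (U * V) + r * V ^ 2 := by
    field_simp
    ring
  linarith

lemma abs_quadratic_sub_le (hκ : 0 ≤ κ) (hκL : κ ≤ L) (ha : 0 ≤ a) (hp : 0 ≤ p) (hw : 0 ≤ w)
    (hx : 0 ≤ x) :
    |((2 - q * (a + p + w)) ^ 2 + q ^ 2 * w * x) - ((2 - q * (2 + κ)) ^ 2 + q ^ 2 * κ)| ≤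
      (1 + q ^ 2) * (6 + L) * (1 + a + p + w + x) *
        (|a - 1| + |p - κ| + |w - 1| + |x - κ|) := by
  have hL : 0 ≤ L := hκ.trans hκL
  have h1 := abs_sq_sub_sq_le q (a + p + w) (2 + κ) (by positivity) (by positivity)
  have hqN : q ^ 2 ≤ 1 + q ^ 2 := by linarith
  have hN0 : 0 ≤ 1 + q ^ 2 := by positivity
  generalize hN : 1 + q ^ 2 = N at *
  generalize hR : 1 + a + p + w + x = R
  have hR1 : 1 ≤ R := by linarith
  have hR0 : 0 ≤ R := by linarith
  have hda := abs_nonneg (a - 1)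
  have hdp := abs_nonneg (p - κ)
  have hdw := abs_nonneg (w - 1)
  have hdx := abs_nonneg (x - κ)
  have h2 : |a + p + w - (2 + κ)| ≤ |a - 1| + |p - κ| + |w - 1| := by
    have : a + p + w - (2 + κ) = (a - 1) + (p - κ) + (w - 1) := by ring
    rw [this]
    exact abs_add_three _ _ _
  have h3 : |w * x - κ| ≤ R * (|w - 1| + |x - κ|) := by
    have : w * x - κ = (w - 1) * x + (x - κ) := by ring
    rw [this]
    refine (abs_add_le _ _).trans ?_
    rw [abs_mul, abs_of_nonneg hx]
    nlinarith
  have h4 : ((2 - q * (a + p + w)) ^ 2 + q ^ 2 * w * x) - ((2 - q * (2 + κ)) ^ 2 + q ^ 2 * κ) =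
      ((2 - q * (a + p + w)) ^ 2 - (2 - q * (2 + κ)) ^ 2) + q ^ 2 * (w * x - κ) := by ring
  rw [h4]
  refine (abs_add_le _ _).trans ?_
  have h5 : |q ^ 2 * (w * x - κ)| ≤ N * (R * (|w - 1| + |x - κ|)) := by
    rw [abs_mul, abs_of_nonneg (sq_nonneg q)]
    exact mul_le_mul hqN h3 (abs_nonneg _) hN0
  have h6 : |a + p + w - (2 + κ)| * (2 + (a + p + w) + (2 + κ)) ≤
      (|a - 1| + |p - κ| + |w - 1|) * ((5 + L) * R) := by
    refine mul_le_mul h2 ?_ (by positivity) (by positivity)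
    nlinarith
  have h7 : N * (|a + p + w - (2 + κ)| * (2 + (a + p + w) + (2 + κ))) ≤
      N * ((|a - 1| + |p - κ| + |w - 1|) * ((5 + L) * R)) :=
    mul_le_mul_of_nonneg_left h6 hN0
  have h8 : 0 ≤ N * R * (|a - 1| + |p - κ| + (5 + L) * |x - κ|) := by positivity
  linarith

lemma abs_quadratic_le (ha : 0 ≤ a) (hp : 0 ≤ p) (hw : 0 ≤ w) (hx : 0 ≤ x) :
    |(2 - q * (a + p + w)) ^ 2 + q ^ 2 * w * x| ≤
      6 * (1 + q ^ 2) * (1 + a + p + w + x) ^ 2 := by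
  have h1 := sq_two_sub_le q (a + p + w)
  have hqN : q ^ 2 ≤ 1 + q ^ 2 := by linarith
  have hN0 : 0 ≤ 1 + q ^ 2 := by positivity
  generalize hN : 1 + q ^ 2 = N at *
  generalize hR : 1 + a + p + w + x = R
  have hR1 : 1 ≤ R := by linarith
  have h0 : q ^ 2 * w * x ≤ N * R ^ 2 := by
    have h1 : w * x ≤ R ^ 2 := by nlinarith
    have h2 : q ^ 2 * (w * x) ≤ N * R ^ 2 := mul_le_mul hqN h1 (by positivity) hN0
    linarith
  rw [abs_of_nonneg (by positivity)]
  have h2 : N * (4 + (a + p + w) ^ 2) ≤ N * (5 * R ^ 2) := by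
    refine mul_le_mul_of_nonneg_left ?_ hN0
    have : (a + p + w) ^ 2 ≤ R ^ 2 := by gcongr; linarith
    nlinarith
  linarith

lemma abs_interference_sub_le_mul (hκ : 0 ≤ κ) (hκL : κ ≤ L) (ha : 0 ≤ a) (hp : 0 ≤ p)
    (hw : 0 ≤ w) (hx : 0 ≤ x) :
    |a * p * ((2 - q * (a + p + w)) ^ 2 + q ^ 2 * w * x) -
        κ * ((2 - 2 * q - κ * q) ^ 2 + κ * q ^ 2)| ≤
      (1 + q ^ 2) * (6 + L) * (((1 + L) * |p - κ| + 2 * κ * |a - 1| + 2 * κ * |w - 1| +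
        κ * |x - κ|) * (1 + a + p + w + x) ^ 3) := by
  have hL : 0 ≤ L := hκ.trans hκL
  have hdf := abs_quadratic_sub_le (q := q) hκ hκL ha hp hw hx
  have hfb := abs_quadratic_le (q := q) ha hp hw hx
  have e : a * p * ((2 - q * (a + p + w)) ^ 2 + q ^ 2 * w * x) -
      κ * ((2 - 2 * q - κ * q) ^ 2 + κ * q ^ 2) =
      (a * (p - κ) + κ * (a - 1)) * ((2 - q * (a + p + w)) ^ 2 + q ^ 2 * w * x) +
      κ * (((2 - q * (a + p + w)) ^ 2 + q ^ 2 * w * x) -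
        ((2 - q * (2 + κ)) ^ 2 + q ^ 2 * κ)) := by ring
  rw [e]
  generalize (2 - q * (a + p + w)) ^ 2 + q ^ 2 * w * x = f at *
  generalize (2 - q * (2 + κ)) ^ 2 + q ^ 2 * κ = f₀ at *
  have hN0 : 0 ≤ 1 + q ^ 2 := by positivity
  generalize hN : 1 + q ^ 2 = N at *
  generalize hR : 1 + a + p + w + x = R at *
  have hR1 : 1 ≤ R := by linarith
  have hR0 : 0 ≤ R := by linarith
  have hRa : a ≤ R := by linarith
  have hap : |a * (p - κ) + κ * (a - 1)| ≤ R * (|p - κ| + κ * |a - 1|) := by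
    refine (abs_add_le _ _).trans ?_
    rw [abs_mul, abs_mul, abs_of_nonneg ha, abs_of_nonneg hκ]
    have h1 : a * |p - κ| ≤ R * |p - κ| := by gcongr
    have h2 : κ * |a - 1| ≤ R * (κ * |a - 1|) := le_mul_of_one_le_left (by positivity) hR1
    linarith
  refine (abs_add_le _ _).trans ?_
  rw [abs_mul, abs_mul, abs_of_nonneg hκ]
  generalize |a * (p - κ) + κ * (a - 1)| = g at *
  clear hN hR ha hp hw hx hRa e
  have hda := abs_nonneg (a - 1)
  have hdp := abs_nonneg (p - κ)
  have hdw := abs_nonneg (w - 1)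
  have hdx := abs_nonneg (x - κ)
  have hdf0 := abs_nonneg f
  generalize |a - 1| = da at *
  generalize |p - κ| = dp at *
  generalize |w - 1| = dw at *
  generalize |x - κ| = dx at *
  have h1 : g * |f| ≤ R * (dp + κ * da) * (6 * N * R ^ 2) :=
    mul_le_mul hap hfb hdf0 (by positivity)
  have h2 : κ * |f - f₀| ≤ κ * (N * (6 + L) * R * (da + dp + dw + dx)) :=
    mul_le_mul_of_nonneg_left hdf hκ
  have h3 : κ * (N * (6 + L) * R * (da + dp + dw + dx)) ≤
      N * (6 + L) * R ^ 3 * (κ * (da + dp + dw + dx)) := by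
    have : R ≤ R ^ 3 := le_self_pow₀ hR1 (by norm_num)
    calc _ = N * (6 + L) * R * (κ * (da + dp + dw + dx)) := by ring
      _ ≤ _ := by gcongr
  have h4 : R * (dp + κ * da) * (6 * N * R ^ 2) ≤ N * (6 + L) * R ^ 3 * (dp + κ * da) := by
    have : 0 ≤ N * R ^ 3 * L * (dp + κ * da) := by positivity
    linarith
  have h5 : (dp + κ * da) + κ * (da + dp + dw + dx) ≤
      (1 + L) * dp + 2 * κ * da + 2 * κ * dw + κ * dx := by
    have : κ * dp ≤ L * dp := by gcongr
    have : 0 ≤ κ * dw := by positivity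
    linarith
  have h6 := mul_le_mul_of_nonneg_left h5 (by positivity : 0 ≤ N * (6 + L) * R ^ 3)
  linarith

/-- Deviation of the interference power from its limit. The product of the fluctuations of the
arguments, which are of some small order `r`, and of a crude polynomial growth is split by
`mul_le_of_weights` into squares of fluctuations over `r` and `r` times sixth moments. -/
lemma abs_interference_sub_le (hκ : 0 ≤ κ) (hκL : κ ≤ L) (ha : 0 ≤ a) (hp : 0 ≤ p) (hw : 0 ≤ w)
    (hx : 0 ≤ x) (hr : 0 < r) :
    |a * p * ((2 - q * (a + p + w)) ^ 2 + q ^ 2 * w * x) -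
        κ * ((2 - 2 * q - κ * q) ^ 2 + κ * q ^ 2)| ≤
      (1 + q ^ 2) * (6 + L) * ((1 / 2) * ((4 * ((1 + L) ^ 2 * (p - κ) ^ 2 +
        4 * κ ^ 2 * (a - 1) ^ 2 + 4 * κ ^ 2 * (w - 1) ^ 2 + κ ^ 2 * (x - κ) ^ 2)) / r +
        r * (3125 * (1 + a ^ 6 + p ^ 6 + w ^ 6 + x ^ 6)))) := by
  have hL : 0 ≤ L := hκ.trans hκL
  have hN0 : 0 ≤ 1 + q ^ 2 := by positivity
  have key := abs_interference_sub_le_mul (q := q) hκ hκL ha hp hw hx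
  refine key.trans (mul_le_mul_of_nonneg_left ?_ (by positivity))
  have hU2 : ((1 + L) * |p - κ| + 2 * κ * |a - 1| + 2 * κ * |w - 1| + κ * |x - κ|) ^ 2 ≤
      4 * ((1 + L) ^ 2 * (p - κ) ^ 2 + 4 * κ ^ 2 * (a - 1) ^ 2 + 4 * κ ^ 2 * (w - 1) ^ 2 +
        κ ^ 2 * (x - κ) ^ 2) := by
    have h := sq_sum_le_card_mul_sum_sq (s := Finset.univ)
      (f := ![(1 + L) * |p - κ|, 2 * κ * |a - 1|, 2 * κ * |w - 1|, κ * |x - κ|])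
    simp [Fin.sum_univ_succ, mul_pow] at h
    have e1 : (1 + L) * |p - κ| + 2 * κ * |a - 1| + 2 * κ * |w - 1| + κ * |x - κ| =
      (1 + L) * |p - κ| + (2 * κ * |a - 1| + (2 * κ * |w - 1| + κ * |x - κ|)) := by ring
    rw [e1]
    linarith
  refine (mul_le_of_weights (V := (1 + a + p + w + x) ^ 3) hr hU2).trans ?_
  have h6 := pow_six_sum_le ha hp hw hx
  rw [← pow_mul]
  have := mul_le_mul_of_nonneg_left h6 hr.le
  linarith

/-- Deviation of the signal power from its limit, split as in `abs_interference_sub_le`. -/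
lemma abs_signal_sub_le (hκ : 0 ≤ κ) (hκL : κ ≤ L) (ha : 0 ≤ a) (hp : 0 ≤ p) (hw : 0 ≤ w)
    (hx : 0 ≤ x) (hr : 0 < r) :
    |(a * (2 - q * (a + p))) ^ 2 - (2 - q - q * κ) ^ 2| ≤
      (1 + q ^ 2) * (9 + L) * ((1 / 2) * ((2 * ((a - 1) ^ 2 + (p - κ) ^ 2)) / r +
        r * (3125 * (1 + a ^ 6 + p ^ 6 + w ^ 6 + x ^ 6)))) := by
  have hL : 0 ≤ L := hκ.trans hκL
  set N := 1 + q ^ 2 with hN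
  have hN0 : 0 ≤ N := by positivity
  clear_value N
  set R := 1 + a + p + w + x with hR
  have hR1 : 1 ≤ R := by linarith
  have hR0 : 0 ≤ R := by linarith
  clear_value R
  have hda := abs_nonneg (a - 1)
  have hdp := abs_nonneg (p - κ)
  have key : |(a * (2 - q * (a + p))) ^ 2 - (2 - q - q * κ) ^ 2| ≤
      N * (9 + L) * ((|a - 1| + |p - κ|) * R ^ 3) := by
    have e : (a * (2 - q * (a + p))) ^ 2 - (2 - q - q * κ) ^ 2 =
        (a - 1) * (a + 1) * (2 - q * (a + p)) ^ 2 +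
          ((2 - q * (a + p)) ^ 2 - (2 - q * (1 + κ)) ^ 2) := by ring
    have h1 : |(a - 1) * (a + 1) * (2 - q * (a + p)) ^ 2| ≤ |a - 1| * R * (N * (5 * R ^ 2)) := by
      rw [abs_mul, abs_mul, abs_of_nonneg (by positivity : 0 ≤ a + 1),
        abs_of_nonneg (sq_nonneg (2 - q * (a + p)))]
      refine mul_le_mul ?_ ?_ (by positivity) (by positivity)
      · gcongr; linarith
      · refine (sq_two_sub_le q (a + p)).trans (hN ▸ mul_le_mul_of_nonneg_left ?_ hN0)
        have : (a + p) ^ 2 ≤ R ^ 2 := by gcongr; linarith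
        nlinarith
    have h2 := abs_sq_sub_sq_le q (a + p) (1 + κ) (by positivity) (by positivity)
    rw [← hN] at h2
    have h3 : |a + p - (1 + κ)| * (2 + (a + p) + (1 + κ)) ≤
        (|a - 1| + |p - κ|) * ((4 + L) * R) := by
      refine mul_le_mul ?_ ?_ (by positivity) (by positivity)
      · have : a + p - (1 + κ) = (a - 1) + (p - κ) := by ring
        rw [this]
        exact abs_add_le _ _
      · nlinarith
    have h4 : N * (|a + p - (1 + κ)| * (2 + (a + p) + (1 + κ))) ≤
        N * ((|a - 1| + |p - κ|) * ((4 + L) * R)) := mul_le_mul_of_nonneg_left h3 hN0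
    have h5 : N * ((|a - 1| + |p - κ|) * ((4 + L) * R)) ≤
        N * ((|a - 1| + |p - κ|) * ((4 + L) * R ^ 3)) := by
      have : R ≤ R ^ 3 := le_self_pow₀ hR1 (by norm_num)
      gcongr
    rw [e]
    refine (abs_add_le _ _).trans ?_
    have h6 : 0 ≤ N * R ^ 3 * |p - κ| := by positivity
    linarith
  refine key.trans (mul_le_mul_of_nonneg_left ?_ (by positivity))
  have hU2 : (|a - 1| + |p - κ|) ^ 2 ≤ 2 * ((a - 1) ^ 2 + (p - κ) ^ 2) := by
    rw [← sq_abs (a - 1), ← sq_abs (p - κ)]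
    nlinarith [sq_nonneg (|a - 1| - |p - κ|)]
  refine (mul_le_of_weights (V := R ^ 3) hr hU2).trans ?_
  have h6 := pow_six_sum_le ha hp hw hx
  have : (R ^ 3) ^ 2 ≤ 3125 * (1 + a ^ 6 + p ^ 6 + w ^ 6 + x ^ 6) := by
    rw [hR, ← pow_mul]; exact h6
  have : r * (R ^ 3) ^ 2 ≤ r * (3125 * (1 + a ^ 6 + p ^ 6 + w ^ 6 + x ^ 6)) := by gcongr
  linarith

end Pointwise

/-! ### Mean deviation of signal and interference power -/

section Deviation

variable (n m : ℕ)

lemma integrable_sq_sub_first (c : ℝ) :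
    Integrable (fun p => (p.1 / (m + 1) - c) ^ 2) (bidiagonalLaw n m) := by
  have : (fun p : ℝ × ℝ × ℝ × ℝ => (p.1 / (m + 1) - c) ^ 2) = evalMonomials
      [(1 / (m + 1) ^ 2, 2, 0, 0, 0), (-2 * c / (m + 1), 1, 0, 0, 0), (c ^ 2, 0, 0, 0, 0)] := by
    funext p; simp [evalMonomials]; field_simp; ring
  rw [this]; exact integrable_evalMonomials _ _ _

lemma integral_sq_sub_first :
    ∫ p, (p.1 / (m + 1) - 1) ^ 2 ∂bidiagonalLaw n m = 1 / ((m : ℝ) + 1) := by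
  have : (fun p : ℝ × ℝ × ℝ × ℝ => (p.1 / (m + 1) - 1) ^ 2) = evalMonomials
      [(1 / (m + 1) ^ 2, 2, 0, 0, 0), (-2 / (m + 1), 1, 0, 0, 0), (1, 0, 0, 0, 0)] := by
    funext p; simp [evalMonomials]; field_simp; ring
  rw [this, integral_evalMonomials]
  simp [integral_pow_sqNormLaw]
  field_simp
  ring

lemma integrable_sq_sub_second (c : ℝ) :
    Integrable (fun p => (p.2.1 / (m + 1) - c) ^ 2) (bidiagonalLaw n m) := by
  have : (fun p : ℝ × ℝ × ℝ × ℝ => (p.2.1 / (m + 1) - c) ^ 2) = evalMonomials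
      [(1 / (m + 1) ^ 2, 0, 2, 0, 0), (-2 * c / (m + 1), 0, 1, 0, 0), (c ^ 2, 0, 0, 0, 0)] := by
    funext p; simp [evalMonomials]; field_simp; ring
  rw [this]; exact integrable_evalMonomials _ _ _

lemma integral_sq_sub_second :
    ∫ p, (p.2.1 / (m + 1) - (n + 1) / (m + 1)) ^ 2 ∂bidiagonalLaw n m =
      ((n : ℝ) + 1) / ((m : ℝ) + 1) ^ 2 := by
  have : (fun p : ℝ × ℝ × ℝ × ℝ => (p.2.1 / (m + 1) - (n + 1) / (m + 1)) ^ 2) = evalMonomials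
      [(1 / (m + 1) ^ 2, 0, 2, 0, 0), (-2 * ((n + 1) / (m + 1)) / (m + 1), 0, 1, 0, 0),
        (((n + 1) / (m + 1)) ^ 2, 0, 0, 0, 0)] := by
    funext p; simp [evalMonomials]; field_simp; ring
  rw [this, integral_evalMonomials]
  simp [integral_pow_sqNormLaw]
  field_simp
  ring

lemma integrable_sq_sub_third (c : ℝ) :
    Integrable (fun p => (p.2.2.1 / (m + 1) - c) ^ 2) (bidiagonalLaw n m) := by
  have : (fun p : ℝ × ℝ × ℝ × ℝ => (p.2.2.1 / (m + 1) - c) ^ 2) = evalMonomials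
      [(1 / (m + 1) ^ 2, 0, 0, 2, 0), (-2 * c / (m + 1), 0, 0, 1, 0), (c ^ 2, 0, 0, 0, 0)] := by
    funext p; simp [evalMonomials]; field_simp; ring
  rw [this]; exact integrable_evalMonomials _ _ _

lemma integral_sq_sub_third :
    ∫ p, (p.2.2.1 / (m + 1) - 1) ^ 2 ∂bidiagonalLaw n m = 1 / ((m : ℝ) + 1) := by
  have : (fun p : ℝ × ℝ × ℝ × ℝ => (p.2.2.1 / (m + 1) - 1) ^ 2) = evalMonomials
      [(1 / (m + 1) ^ 2, 0, 0, 2, 0), (-2 / (m + 1), 0, 0, 1, 0), (1, 0, 0, 0, 0)] := by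
    funext p; simp [evalMonomials]; field_simp; ring
  rw [this, integral_evalMonomials]
  simp [integral_pow_sqNormLaw]
  field_simp
  ring

lemma integrable_sq_sub_fourth (c : ℝ) :
    Integrable (fun p => (p.2.2.2 / (m + 1) - c) ^ 2) (bidiagonalLaw n m) := by
  have : (fun p : ℝ × ℝ × ℝ × ℝ => (p.2.2.2 / (m + 1) - c) ^ 2) = evalMonomials
      [(1 / (m + 1) ^ 2, 0, 0, 0, 2), (-2 * c / (m + 1), 0, 0, 0, 1), (c ^ 2, 0, 0, 0, 0)] := by
    funext p; simp [evalMonomials]; field_simp; ring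
  rw [this]; exact integrable_evalMonomials _ _ _

lemma integral_sq_sub_fourth_le :
    ∫ p, (p.2.2.2 / (m + 1) - (n + 1) / (m + 1)) ^ 2 ∂bidiagonalLaw n m ≤
      3 * (((n : ℝ) + 1) / ((m : ℝ) + 1) ^ 2) := by
  have : (fun p : ℝ × ℝ × ℝ × ℝ => (p.2.2.2 / (m + 1) - (n + 1) / (m + 1)) ^ 2) = evalMonomials
      [(1 / (m + 1) ^ 2, 0, 0, 0, 2), (-2 * ((n + 1) / (m + 1)) / (m + 1), 0, 0, 0, 1),
        (((n + 1) / (m + 1)) ^ 2, 0, 0, 0, 0)] := by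
    funext p; simp [evalMonomials]; field_simp; ring
  rw [this, integral_evalMonomials]
  rcases n with _ | n
  · simp [integral_pow_sqNormLaw]
    have : (0 : ℝ) ≤ ((m + 1 : ℝ) ^ 2)⁻¹ := by positivity
    linarith
  · simp [integral_pow_sqNormLaw]
    field_simp
    linarith

/-- The bound of `pow_six_sum_le` for the normalized coordinates. -/
def sixthMajorant (m : ℕ) (p : ℝ × ℝ × ℝ × ℝ) : ℝ :=
  3125 * (1 + (p.1 / (m + 1)) ^ 6 + (p.2.1 / (m + 1)) ^ 6 + (p.2.2.1 / (m + 1)) ^ 6 +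
    (p.2.2.2 / (m + 1)) ^ 6)

lemma sixthMajorant_eq : sixthMajorant m = evalMonomials
      [(3125, 0, 0, 0, 0), (3125 / (m + 1) ^ 6, 6, 0, 0, 0), (3125 / (m + 1) ^ 6, 0, 6, 0, 0),
      (3125 / (m + 1) ^ 6, 0, 0, 6, 0), (3125 / (m + 1) ^ 6, 0, 0, 0, 6)] := by
  funext p; simp [evalMonomials, sixthMajorant]; field_simp; ring

lemma integrable_sixthMajorant : Integrable (sixthMajorant m) (bidiagonalLaw n m) := by
  rw [sixthMajorant_eq]; exact integrable_evalMonomials _ _ _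

lemma integral_sixthMajorant_le {L : ℝ} (hL : ((n : ℝ) + 1) / (m + 1) ≤ L) :
    ∫ p, sixthMajorant m p ∂bidiagonalLaw n m ≤ 3125 * (1441 + 1440 * L ^ 6) := by
  have hm : (0 : ℝ) < (m : ℝ) + 1 := by positivity
  have key : ∀ (d : ℕ) (l : ℝ), (d : ℝ) ≤ l * (m + 1) →
      3125 / ((m : ℝ) + 1) ^ 6 * ∫ t, t ^ 6 ∂sqNormLaw d ≤ 3125 * (720 * l ^ 6) := by
    intro d l hd
    have h1 := integral_pow_sqNormLaw_le d 6
    have h2 : (d : ℝ) ^ 6 ≤ (l * (m + 1)) ^ 6 := by gcongr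
    have h3 : ∫ t, t ^ 6 ∂sqNormLaw d ≤ (l * (m + 1)) ^ 6 * 720 := by
      refine h1.trans ?_
      norm_num [Nat.factorial]
      exact h2
    calc _ ≤ 3125 / ((m : ℝ) + 1) ^ 6 * ((l * (m + 1)) ^ 6 * 720) := by gcongr
      _ = _ := by field_simp
  have hL' : ((n : ℝ) + 1) ≤ L * (m + 1) := by rwa [div_le_iff₀ hm] at hL
  have k1 := key (m + 1) 1 (by push_cast; linarith)
  have k2 := key n L (by linarith)
  have k3 := key m 1 (by linarith)
  have k4 := key (n - 1) L (by
    have : ((n - 1 : ℕ) : ℝ) ≤ n := by exact_mod_cast Nat.sub_le n 1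
    linarith)
  rw [sixthMajorant_eq, integral_evalMonomials]
  simp
  linarith

/-- The interference power deviates from its limit by `O(√K / m)` in mean; its limit is of order
`K / m`. -/
lemma integral_interferencePower_sub_le {L : ℝ} (hL : ((n : ℝ) + 1) / (m + 1) ≤ L) (q : ℝ)
    {K a : ℝ} (hK : K = n + 1) (ha : a = 1 / (m + 1)) :
    ∫ p, |interferencePower q (m + 1) (bidiagonalStats p) -
        K * a * ((2 - 2 * q - K * a * q) ^ 2 + K * a * q ^ 2)| ∂bidiagonalLaw n m ≤
      (1 + q ^ 2) * ((6 + L) * (1 / 2) * (4 * ((1 + L) ^ 2 + 8 * L + 3 * L ^ 2) +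
        3125 * (1441 + 1440 * L ^ 6))) * (√K * a) := by
  set κ := K * a with hκ
  have hκ' : κ = (n + 1) / (m + 1) := by rw [hκ, hK, ha]; ring
  have hKa : K * a ^ 2 = ((n : ℝ) + 1) / ((m : ℝ) + 1) ^ 2 := by rw [hK, ha]; field_simp
  have hκ0 : 0 ≤ κ := by rw [hκ']; positivity
  have hκL : κ ≤ L := hκ' ▸ hL
  have hL0 : 0 ≤ L := hκ0.trans hκL
  have hK0 : 0 < K := by rw [hK]; positivity
  have ha0 : 0 < a := by rw [ha]; positivity
  set r := √K * a with hr
  have hr0 : 0 < r := by positivity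
  have hr2 : r ^ 2 = K * a ^ 2 := by rw [hr, mul_pow, Real.sq_sqrt hK0.le]
  set D : ℝ × ℝ × ℝ × ℝ → ℝ := fun p => (1 + q ^ 2) * (6 + L) * ((1 / 2) * ((4 * ((1 + L) ^ 2 *
    (p.2.1 / (m + 1) - κ) ^ 2 + 4 * κ ^ 2 * (p.1 / (m + 1) - 1) ^ 2 +
    4 * κ ^ 2 * (p.2.2.1 / (m + 1) - 1) ^ 2 + κ ^ 2 * (p.2.2.2 / (m + 1) - κ) ^ 2)) / r +
    r * sixthMajorant m p)) with hD
  have i1 := (integrable_sq_sub_second n m κ).const_mul ((1 + L) ^ 2)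
  have i2 := (integrable_sq_sub_first n m 1).const_mul (4 * κ ^ 2)
  have i3 := (integrable_sq_sub_third n m 1).const_mul (4 * κ ^ 2)
  have i4 := (integrable_sq_sub_fourth n m κ).const_mul (κ ^ 2)
  have i5 := (integrable_sixthMajorant n m).const_mul r
  have i12 : Integrable (fun p => (1 + L) ^ 2 * (p.2.1 / (m + 1) - κ) ^ 2 +
    4 * κ ^ 2 * (p.1 / (m + 1) - 1) ^ 2) (bidiagonalLaw n m) := i1.add i2
  have i123 : Integrable (fun p => (1 + L) ^ 2 * (p.2.1 / (m + 1) - κ) ^ 2 +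
    4 * κ ^ 2 * (p.1 / (m + 1) - 1) ^ 2 + 4 * κ ^ 2 * (p.2.2.1 / (m + 1) - 1) ^ 2)
    (bidiagonalLaw n m) := i12.add i3
  have i1234 : Integrable (fun p => (4 * ((1 + L) ^ 2 * (p.2.1 / (m + 1) - κ) ^ 2 +
    4 * κ ^ 2 * (p.1 / (m + 1) - 1) ^ 2 + 4 * κ ^ 2 * (p.2.2.1 / (m + 1) - 1) ^ 2 +
    κ ^ 2 * (p.2.2.2 / (m + 1) - κ) ^ 2)) / r) (bidiagonalLaw n m) :=
    ((i123.add i4).const_mul 4).div_const r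
  have hDi : Integrable D (bidiagonalLaw n m) := ((i1234.add i5).const_mul (1 / 2)).const_mul _
  have hle : ∫ p, |interferencePower q (m + 1) (bidiagonalStats p) -
      κ * ((2 - 2 * q - κ * q) ^ 2 + κ * q ^ 2)| ∂bidiagonalLaw n m ≤
      ∫ p, D p ∂bidiagonalLaw n m := by
    refine integral_mono_ae ((integrable_interferencePower n m q).sub
      (integrable_const _)).abs hDi ?_
    filter_upwards [bidiagonalLaw_nonneg n m] with p hp
    rw [interferencePower_bidiagonalStats]
    have := abs_interference_sub_le (q := q) (L := L) (κ := κ) (a := p.1 / (m + 1))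
      (p := p.2.1 / (m + 1)) (w := p.2.2.1 / (m + 1)) (x := p.2.2.2 / (m + 1)) (r := r) hκ0 hκL
      (div_nonneg hp.1 (by positivity)) (div_nonneg hp.2.1 (by positivity))
      (div_nonneg hp.2.2.1 (by positivity)) (div_nonneg hp.2.2.2 (by positivity)) hr0
    exact this
  have hDint : ∫ p, D p ∂bidiagonalLaw n m = (1 + q ^ 2) * (6 + L) * ((1 / 2) * ((4 * ((1 + L) ^ 2 *
    (K * a ^ 2) + 4 * κ ^ 2 * a + 4 * κ ^ 2 * a +
      κ ^ 2 * ∫ p, (p.2.2.2 / (m + 1) - κ) ^ 2 ∂bidiagonalLaw n m)) / r +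
    r * ∫ p, sixthMajorant m p ∂bidiagonalLaw n m)) := by
    rw [hD, integral_const_mul, integral_const_mul, integral_add i1234 i5, integral_div,
      integral_const_mul, integral_add i123 i4, integral_add i12 i3,
      integral_add i1 i2, integral_const_mul, integral_const_mul, integral_const_mul,
      integral_const_mul, integral_const_mul, integral_sq_sub_first, integral_sq_sub_third]
    have h2 := integral_sq_sub_second n m
    rw [← hκ', ← hKa] at h2
    rw [h2, ← ha]
  rw [hDint] at hle
  refine hle.trans ?_
  have h4 := integral_sq_sub_fourth_le n m
  rw [← hκ'] at h4
  have h4' : (n + 1 : ℝ) / (m + 1) ^ 2 = r ^ 2 := by rw [hr2, hKa]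
  rw [h4'] at h4
  have h6 := integral_sixthMajorant_le n m hL
  have e1 : κ ^ 2 * a ≤ L * r ^ 2 := by
    have : κ ^ 2 * a = κ * r ^ 2 := by rw [hr2, hκ]; ring
    rw [this]; gcongr
  have e2 : κ ^ 2 * ∫ p, (p.2.2.2 / (m + 1) - κ) ^ 2 ∂bidiagonalLaw n m ≤ L ^ 2 * (3 * r ^ 2) := by
    gcongr
  have e3 : 4 * ((1 + L) ^ 2 * (K * a ^ 2) + 4 * κ ^ 2 * a + 4 * κ ^ 2 * a +
      κ ^ 2 * ∫ p, (p.2.2.2 / (m + 1) - κ) ^ 2 ∂bidiagonalLaw n m) ≤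
      (4 * ((1 + L) ^ 2 + 8 * L + 3 * L ^ 2) * r) * r := by
    rw [← hr2]; linarith
  have e4 : (4 * ((1 + L) ^ 2 * (K * a ^ 2) + 4 * κ ^ 2 * a + 4 * κ ^ 2 * a +
      κ ^ 2 * ∫ p, (p.2.2.2 / (m + 1) - κ) ^ 2 ∂bidiagonalLaw n m)) / r ≤
      4 * ((1 + L) ^ 2 + 8 * L + 3 * L ^ 2) * r := by rwa [div_le_iff₀ hr0]
  have e5 : r * ∫ p, sixthMajorant m p ∂bidiagonalLaw n m ≤
      r * (3125 * (1441 + 1440 * L ^ 6)) := by gcongr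
  calc _ ≤ (1 + q ^ 2) * (6 + L) * ((1 / 2) * (4 * ((1 + L) ^ 2 + 8 * L + 3 * L ^ 2) * r +
      r * (3125 * (1441 + 1440 * L ^ 6)))) := by gcongr
    _ = _ := by ring

/-- The signal power deviates from its limit by `O(1 / √m)` in mean. -/
lemma integral_signalAmp_sq_sub_le {L : ℝ} (hL : ((n : ℝ) + 1) / (m + 1) ≤ L) (q : ℝ) {K a : ℝ}
    (hK : K = n + 1) (ha : a = 1 / (m + 1)) :
    ∫ p, |signalAmp q (m + 1) (bidiagonalStats p) ^ 2 -
        (2 - q - q * (K * a)) ^ 2| ∂bidiagonalLaw n m ≤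
      (1 + q ^ 2) * ((9 + L) * (1 / 2) * (2 * (1 + L) + 3125 * (1441 + 1440 * L ^ 6))) * √a := by
  set κ := K * a with hκ
  have hκ' : κ = (n + 1) / (m + 1) := by rw [hκ, hK, ha]; ring
  have hKa : K * a ^ 2 = ((n : ℝ) + 1) / ((m : ℝ) + 1) ^ 2 := by rw [hK, ha]; field_simp
  have hκ0 : 0 ≤ κ := by rw [hκ']; positivity
  have hκL : κ ≤ L := hκ' ▸ hL
  have hL0 : 0 ≤ L := hκ0.trans hκL
  have ha0 : 0 < a := by rw [ha]; positivity
  set r := √a with hr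
  have hr0 : 0 < r := by positivity
  have hr2 : r ^ 2 = a := by rw [hr, Real.sq_sqrt ha0.le]
  set D : ℝ × ℝ × ℝ × ℝ → ℝ := fun p => (1 + q ^ 2) * (9 + L) * ((1 / 2) * ((2 *
    ((p.1 / (m + 1) - 1) ^ 2 + (p.2.1 / (m + 1) - κ) ^ 2)) / r + r * sixthMajorant m p)) with hD
  have i1 := integrable_sq_sub_second n m κ
  have i2 := integrable_sq_sub_first n m 1
  have i5 := (integrable_sixthMajorant n m).const_mul r
  have i12 : Integrable (fun p => (2 * ((p.1 / (m + 1) - 1) ^ 2 +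
    (p.2.1 / (m + 1) - κ) ^ 2)) / r) (bidiagonalLaw n m) :=
    ((i2.add i1).const_mul 2).div_const r
  have hDi : Integrable D (bidiagonalLaw n m) := ((i12.add i5).const_mul (1 / 2)).const_mul _
  have hle : ∫ p, |signalAmp q (m + 1) (bidiagonalStats p) ^ 2 -
        (2 - q - q * κ) ^ 2| ∂bidiagonalLaw n m ≤
      ∫ p, D p ∂bidiagonalLaw n m := by
    refine integral_mono_ae ((integrable_signalAmp_sq n m q).sub
      (integrable_const _)).abs hDi ?_
    filter_upwards [bidiagonalLaw_nonneg n m] with p hp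
    rw [signalAmp_bidiagonalStats]
    exact abs_signal_sub_le (q := q) (L := L) (κ := κ) (a := p.1 / (m + 1))
      (p := p.2.1 / (m + 1)) (w := p.2.2.1 / (m + 1)) (x := p.2.2.2 / (m + 1)) (r := r) hκ0 hκL
      (div_nonneg hp.1 (by positivity)) (div_nonneg hp.2.1 (by positivity))
      (div_nonneg hp.2.2.1 (by positivity)) (div_nonneg hp.2.2.2 (by positivity)) hr0
  have hDint : ∫ p, D p ∂bidiagonalLaw n m = (1 + q ^ 2) * (9 + L) * ((1 / 2) * ((2 *
      (a + K * a ^ 2)) / r + r * ∫ p, sixthMajorant m p ∂bidiagonalLaw n m)) := by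
    rw [hD, integral_const_mul, integral_const_mul, integral_add i12 i5, integral_div,
      integral_const_mul, integral_add i2 i1, integral_const_mul, integral_sq_sub_first]
    have h2 := integral_sq_sub_second n m
    rw [← hκ', ← hKa] at h2
    rw [h2, ← ha]
  rw [hDint] at hle
  refine hle.trans ?_
  have h6 := integral_sixthMajorant_le n m hL
  have e3 : 2 * (a + K * a ^ 2) ≤ 2 * (1 + L) * r * r := by
    have : K * a ^ 2 = κ * r ^ 2 := by rw [hr2, hκ]; ring
    have h7 : κ * r ^ 2 ≤ L * r ^ 2 := by gcongr
    rw [this, ← hr2]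
    linarith
  have e4 : (2 * (a + K * a ^ 2)) / r ≤ 2 * (1 + L) * r := by rwa [div_le_iff₀ hr0]
  have e5 : r * ∫ p, sixthMajorant m p ∂bidiagonalLaw n m ≤
      r * (3125 * (1441 + 1440 * L ^ 6)) := by gcongr
  calc _ ≤ (1 + q ^ 2) * (9 + L) * ((1 / 2) * (2 * (1 + L) * r +
      r * (3125 * (1441 + 1440 * L ^ 6)))) := by gcongr
    _ = _ := by ring

end Deviation

/-! ### Logarithms, closed forms and the range of parameters -/

section Log

lemma abs_log_sub_le_div {l x y : ℝ} (hl : 0 < l) (hx : l ≤ x) (hy : l ≤ y) :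
    |Real.log x - Real.log y| ≤ |x - y| / l := by
  have key : ∀ {x y : ℝ}, l ≤ x → l ≤ y → Real.log x - Real.log y ≤ |x - y| / l := by
    intro x y hx hy
    have hx0 : 0 < x := hl.trans_le hx
    have hy0 : 0 < y := hl.trans_le hy
    rw [← Real.log_div hx0.ne' hy0.ne']
    have h1 := Real.log_le_sub_one_of_pos (div_pos hx0 hy0)
    have h2 : x / y - 1 = (x - y) / y := by field_simp
    calc _ ≤ (x - y) / y := by rw [← h2]; exact h1
      _ ≤ |x - y| / y := by gcongr; exact le_abs_self _
      _ ≤ |x - y| / l := by gcongr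
  rw [abs_le]
  constructor
  · have := key hy hx
    rw [abs_sub_comm] at this
    linarith
  · exact key hx hy

/-- A logarithm deviates little from its value at `y` in terms of the absolute deviation of its
argument: below `y / 2` the deviation is at most `log (y / l)`, and there `|x - y|` is at least
`y / 2`. -/
lemma abs_log_sub_le_mul {l x y : ℝ} (hl : 0 < l) (hx : l ≤ x) (hy : l ≤ y) :
    |Real.log x - Real.log y| ≤ 2 / y * (1 + Real.log (y / l)) * |x - y| := by
  have hx0 : 0 < x := hl.trans_le hx
  have hy0 : 0 < y := hl.trans_le hy
  have hlog : 0 ≤ Real.log (y / l) := Real.log_nonneg (by rwa [le_div_iff₀ hl, one_mul])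
  have habs := abs_nonneg (x - y)
  by_cases h : y / 2 ≤ x
  · have h1 := abs_log_sub_le_div (by linarith : 0 < y / 2) h (by linarith : y / 2 ≤ y)
    have h2 : |x - y| / (y / 2) = 2 / y * 1 * |x - y| := by field_simp
    rw [h2] at h1
    refine h1.trans ?_
    gcongr
    linarith
  · push Not at h
    have h1 : Real.log x ≤ Real.log y := Real.log_le_log hx0 (by linarith)
    have h2 : Real.log l ≤ Real.log x := Real.log_le_log hl hx
    have h3 : |Real.log x - Real.log y| ≤ Real.log (y / l) := by
      rw [abs_of_nonpos (by linarith), Real.log_div hy0.ne' hl.ne']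
      linarith
    have h4 : 1 ≤ 2 / y * |x - y| := by
      rw [abs_of_nonpos (by linarith), div_mul_eq_mul_div, le_div_iff₀ hy0]
      linarith
    calc _ ≤ Real.log (y / l) := h3
      _ ≤ (1 + Real.log (y / l)) * 1 := by linarith
      _ ≤ (1 + Real.log (y / l)) * (2 / y * |x - y|) := by gcongr
      _ = _ := by ring

lemma logb_one_add_div {x y : ℝ} (hx : 0 ≤ x) (hy : 0 < y) :
    Real.logb 2 (1 + x / y) = (Real.log (x + y) - Real.log y) / Real.log 2 := by
  have : 1 + x / y = (x + y) / y := by field_simp; ring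
  rw [Real.logb, this, Real.log_div (by positivity) hy.ne']

lemma abs_logb_sub_le {x y x' y' : ℝ} (hx : 0 ≤ x) (hy : 0 < y) (hx' : 0 ≤ x') (hy' : 0 < y') :
    |Real.logb 2 (1 + x / y) - Real.logb 2 (1 + x' / y')| ≤
      (|Real.log (x + y) - Real.log (x' + y')| + |Real.log y - Real.log y'|) / Real.log 2 := by
  rw [logb_one_add_div hx hy, logb_one_add_div hx' hy', ← sub_div, abs_div,
    abs_of_pos (Real.log_pos one_lt_two)]
  refine div_le_div_of_nonneg_right ?_ (Real.log_pos one_lt_two).le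
  · have : Real.log (x + y) - Real.log y - (Real.log (x' + y') - Real.log y') =
        (Real.log (x + y) - Real.log (x' + y')) - (Real.log y - Real.log y') := by ring
    rw [this]
    exact abs_sub _ _

end Log

/-- The limit of the signal amplitude when `K / m` is kept at `κ`. -/
def ampLimit (q κ : ℝ) : ℝ := 2 - q - q * κ

/-- The limit of `m` times the power of one interferer when `K / m` is kept at `κ`. -/
def leakLimit (q κ : ℝ) : ℝ := (2 - 2 * q - κ * q) ^ 2 + κ * q ^ 2

section ClosedForm

variable {ω c M K a : ℝ}

lemma C₃_eq (hω : 0 < ω) (hc : 0 < c) (hM : 0 < M) (ha : a = 1 / (c * M)) :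
    C₃ ω c M K = leakLimit (1 / ω) (K * a) * a := by
  rw [C₃, leakLimit, ha]; field_simp; ring

lemma C₂_eq (hω : 0 < ω) (hc : 0 < c) (hM : 0 < M) (ha : a = 1 / (c * M)) :
    C₂ ω c M K = ampLimit (1 / ω) (K * a) ^ 2 + K * a * (1 / ω) ^ 2 := by
  rw [C₂, ampLimit, ha]; field_simp; ring

lemma C₁_eq (hω : 0 < ω) (hc : 0 < c) (hM : 0 < M) (ha : a = 1 / (c * M)) :
    C₁ ω c M K = ampLimit (1 / ω) (K * a) ^ 2 + leakLimit (1 / ω) (K * a) * a := by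
  rw [C₁, ampLimit, leakLimit, ha]; field_simp; ring

end ClosedForm

/-- The range of parameters in the proof: `n + 1` users, `m + 1` effective antennas, `M` antennas,
`q` the inverse relaxation parameter. The limit of the signal power is at least `κ₁ (1 + q²)`. -/
structure Regime (L κ₁ : ℝ) (n m : ℕ) (M q : ℝ) : Prop where
  κ₁_pos : 0 < κ₁
  one_le : 1 ≤ L
  users_le : (n : ℝ) + 1 ≤ M
  antennas_le : M ≤ L * (m + 1)
  amp_ge : κ₁ * (1 + q ^ 2) ≤ ampLimit q ((n + 1) * (1 / (m + 1))) ^ 2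

/-- The normalized noise power with the approximate power normalization. -/
def noiseLimit (ρ M q K a : ℝ) : ℝ :=
  1 / ρ * (K / M) * (ampLimit q (K * a) ^ 2 + K * a * q ^ 2)

/-- The normalized noise power with the exact power normalization. -/
def noiseExact (ρ M q K a : ℝ) : ℝ :=
  1 / ρ * (K / M) * (ampLimit q (K * a) ^ 2 + K * a * q ^ 2 + q ^ 2 * a ^ 2)

/-- The closed form of the rate, by the limits of the signal and interference powers. -/
def limitRate (ρ M q K a : ℝ) : ℝ :=
  Real.logb 2 (1 + (ampLimit q (K * a) ^ 2 + leakLimit q (K * a) * a) /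
    (noiseLimit ρ M q K a + (K - 1) * (leakLimit q (K * a) * a)))

lemma insUserRate_eq {ρ ω c M K a : ℝ} (hω : 0 < ω) (hc : 0 < c) (hM : 0 < M)
    (ha : a = 1 / (c * M)) : insUserRate ρ ω c M K = limitRate ρ M (1 / ω) K a := by
  rw [insUserRate, C₁_eq hω hc hM ha, C₂_eq hω hc hM ha, C₃_eq hω hc hM ha, limitRate, noiseLimit]

namespace Regime

variable {L κ₁ ρ M q K a : ℝ} {n m : ℕ}

section Bounds

lemma pos_M (h : Regime L κ₁ n m M q) : 0 < M :=
  lt_of_lt_of_le (by positivity) h.users_le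

lemma antennas_mul_le (h : Regime L κ₁ n m M q) (ha : a = 1 / (m + 1)) : M * a ≤ L := by
  rw [ha, mul_one_div, div_le_iff₀ (by positivity)]
  exact h.antennas_le

lemma users_mul_le (h : Regime L κ₁ n m M q) (hK : K = n + 1) (ha : a = 1 / (m + 1)) :
    K * a ≤ L := by
  refine le_trans ?_ (h.antennas_mul_le ha)
  have : 0 < a := by rw [ha]; positivity
  have := h.users_le
  rw [hK]
  gcongr

lemma leakLimit_nonneg (hκ : 0 ≤ K * a) : 0 ≤ leakLimit q (K * a) := by
  unfold leakLimit; positivity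

lemma leakLimit_le (h : Regime L κ₁ n m M q) (hK : K = n + 1) (ha : a = 1 / (m + 1)) :
    leakLimit q (K * a) ≤ (4 + (2 + L) ^ 2 + L) * (1 + q ^ 2) := by
  have hκL := h.users_mul_le hK ha
  have hκ : 0 ≤ K * a := by rw [hK, ha]; positivity
  have hL0 : 0 ≤ L := hκ.trans hκL
  generalize K * a = κ at *
  have h1 := sq_two_sub_le q (2 + κ)
  have h2 : (2 + κ) ^ 2 ≤ (2 + L) ^ 2 := by gcongr
  have h3 : (1 + q ^ 2) * (4 + (2 + κ) ^ 2) ≤ (1 + q ^ 2) * (4 + (2 + L) ^ 2) := by gcongr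
  have h4 : κ * q ^ 2 ≤ L * (1 + q ^ 2) := by
    have : q ^ 2 ≤ 1 + q ^ 2 := by linarith
    gcongr
  have h5 : (2 - 2 * q - κ * q) = 2 - q * (2 + κ) := by ring
  rw [leakLimit, h5]
  linarith

lemma ampLimit_sq_le (h : Regime L κ₁ n m M q) (hK : K = n + 1) (ha : a = 1 / (m + 1)) :
    ampLimit q (K * a) ^ 2 ≤ (4 + (1 + L) ^ 2) * (1 + q ^ 2) := by
  have hκL := h.users_mul_le hK ha
  have hκ : 0 ≤ K * a := by rw [hK, ha]; positivity
  generalize K * a = κ at *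
  have h1 := sq_two_sub_le q (1 + κ)
  have h2 : (1 + κ) ^ 2 ≤ (1 + L) ^ 2 := by gcongr
  have h3 : (1 + q ^ 2) * (4 + (1 + κ) ^ 2) ≤ (1 + q ^ 2) * (4 + (1 + L) ^ 2) := by gcongr
  have h5 : ampLimit q κ = 2 - q * (1 + κ) := by unfold ampLimit; ring
  rw [h5]
  linarith

lemma amp_ge' (h : Regime L κ₁ n m M q) (hK : K = n + 1) (ha : a = 1 / (m + 1)) :
    κ₁ * (1 + q ^ 2) ≤ ampLimit q (K * a) ^ 2 := by
  rw [hK, ha]; exact h.amp_ge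

lemma noise_ge (h : Regime L κ₁ n m M q) (hρ : 0 < ρ) (hK : K = n + 1) (ha : a = 1 / (m + 1)) :
    1 / ρ * (K / M) * (κ₁ * (1 + q ^ 2)) ≤ noiseLimit ρ M q K a ∧
      noiseLimit ρ M q K a ≤ noiseExact ρ M q K a := by
  have hM := h.pos_M
  have h1 := h.amp_ge' hK ha
  have hK0 : 0 < K := by rw [hK]; positivity
  have ha0 : 0 < a := by rw [ha]; positivity
  constructor
  · unfold noiseLimit
    gcongr
    have : 0 ≤ K * a * q ^ 2 := by positivity
    linarith
  · unfold noiseLimit noiseExact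
    have h2 : ampLimit q (K * a) ^ 2 + K * a * q ^ 2 ≤
        ampLimit q (K * a) ^ 2 + K * a * q ^ 2 + q ^ 2 * a ^ 2 := by
      have : 0 ≤ q ^ 2 * a ^ 2 := by positivity
      linarith
    exact mul_le_mul_of_nonneg_left h2 (by positivity)

lemma noise_sub_le (h : Regime L κ₁ n m M q) (hρ : 0 < ρ) (hK : K = n + 1) :
    |noiseExact ρ M q K a - noiseLimit ρ M q K a| ≤ 1 / ρ * (K / M) * a ^ 2 * (1 + q ^ 2) := by
  have hM := h.pos_M
  have hK0 : 0 < K := by rw [hK]; positivity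
  have : noiseExact ρ M q K a - noiseLimit ρ M q K a = 1 / ρ * (K / M) * a ^ 2 * q ^ 2 := by
    unfold noiseExact noiseLimit; ring
  rw [this, abs_of_nonneg (by positivity)]
  gcongr
  linarith

/-- In the closed form the signal power is at least of order `M / K` times noise and interference.
-/
lemma limitRate_ge (h : Regime L κ₁ n m M q) (hρ : 0 < ρ) (hK : K = n + 1)
    (ha : a = 1 / (m + 1)) :
    Real.logb 2 (1 + κ₁ / (1 / ρ * (4 + (1 + L) ^ 2 + L) + L * (4 + (2 + L) ^ 2 + L)) * (M / K)) ≤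
      limitRate ρ M q K a := by
  have hM := h.pos_M
  have hL : 0 < L := lt_of_lt_of_le one_pos h.one_le
  have hK0 : 0 < K := by rw [hK]; positivity
  have ha0 : 0 < a := by rw [ha]; positivity
  have hκ₁ := h.κ₁_pos
  have hV := h.leakLimit_le hK ha
  have hV0 : 0 ≤ leakLimit q (K * a) := leakLimit_nonneg (by positivity)
  have hu := h.amp_ge' hK ha
  have hu2 := h.ampLimit_sq_le hK ha
  have hMa := h.antennas_mul_le ha
  have hKa := h.users_mul_le hK ha
  have hn := (h.noise_ge hρ hK ha).1
  have hK1 : 0 ≤ K - 1 := by rw [hK]; simp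
  set CV := 4 + (2 + L) ^ 2 + L
  set N := 1 + q ^ 2 with hN
  have hN0 : 0 < N := by positivity
  have hCV : 0 < CV := by positivity
  have hB0 : 0 < noiseLimit ρ M q K a + (K - 1) * (leakLimit q (K * a) * a) := by
    have : 0 < 1 / ρ * (K / M) * (κ₁ * N) := by positivity
    have : 0 ≤ (K - 1) * (leakLimit q (K * a) * a) := by positivity
    linarith
  have hB : noiseLimit ρ M q K a + (K - 1) * (leakLimit q (K * a) * a) ≤
      (1 / ρ * (4 + (1 + L) ^ 2 + L) + L * CV) * (K / M) * N := by
    have h1 : noiseLimit ρ M q K a ≤ 1 / ρ * (K / M) * ((4 + (1 + L) ^ 2 + L) * N) := by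
      unfold noiseLimit
      gcongr
      have : K * a * q ^ 2 ≤ L * N := by
        have : q ^ 2 ≤ N := by linarith
        gcongr
      linarith
    have h2 : (K - 1) * (leakLimit q (K * a) * a) ≤ K * (CV * N * (L / M)) := by
      gcongr
      · linarith
      · rwa [le_div_iff₀ hM, mul_comm]
    have h3 : K * (CV * N * (L / M)) = L * CV * (K / M) * N := by ring
    linarith
  unfold limitRate
  refine Real.logb_le_logb_of_le one_lt_two (by positivity) ?_
  gcongr 1 + ?_
  rw [le_div_iff₀ hB0]
  calc _ ≤ κ₁ / (1 / ρ * (4 + (1 + L) ^ 2 + L) + L * CV) * (M / K) *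
        ((1 / ρ * (4 + (1 + L) ^ 2 + L) + L * CV) * (K / M) * N) := by gcongr
    _ = κ₁ * N := by field_simp
    _ ≤ _ := by
      have : 0 ≤ leakLimit q (K * a) * a := by positivity
      linarith

end Bounds

end Regime

/-! ### The rate at the mean powers -/

lemma interferencePower_nonneg (n m : ℕ) (q : ℝ) :
    ∀ᵐ p ∂bidiagonalLaw n m, 0 ≤ interferencePower q (m + 1) (bidiagonalStats p) := by
  filter_upwards [bidiagonalLaw_nonneg n m] with p ⟨h1, h2, h3, h4⟩
  rw [interferencePower_bidiagonalStats]
  positivity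

namespace Regime

variable {L κ₁ ρ M q K a : ℝ} {n m : ℕ}

/-- The closed form approximates the rate computed with the mean powers up to `O(1 / m²)`. -/
theorem abs_meanPower_sub_limitRate_le (h : Regime L κ₁ n m M q) (hρ : 0 < ρ) (hK : K = n + 1)
    (ha : a = 1 / (m + 1)) :
    |Real.logb 2 (1 + (∫ p, signalAmp q (m + 1) (bidiagonalStats p) ^ 2 ∂bidiagonalLaw n m) /
        (noiseExact ρ M q K a +
          ∫ p, interferencePower q (m + 1) (bidiagonalStats p) ∂bidiagonalLaw n m)) -
      limitRate ρ M q K a| ≤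
      ((9 + 3 * L + 1 / ρ + 2 * L) / κ₁ + (1 + 2 * ρ * L) / κ₁) / Real.log 2 * a ^ 2 := by
  have hM := h.pos_M
  have hL : 0 < L := lt_of_lt_of_le one_pos h.one_le
  have hK0 : 0 < K := by rw [hK]; positivity
  have ha0 : 0 < a := by rw [ha]; positivity
  have ha1 : a ≤ 1 := by
    rw [ha, div_le_one (by positivity)]; simp
  have hκ₁ := h.κ₁_pos
  have hV0 : 0 ≤ leakLimit q (K * a) := leakLimit_nonneg (by positivity)
  have hu := h.amp_ge' hK ha
  have hMa := h.antennas_mul_le ha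
  have hKa := h.users_mul_le hK ha
  have hn := (h.noise_ge hρ hK ha).1
  have hn' := (h.noise_ge hρ hK ha).2
  have hK1 : 0 ≤ K - 1 := by rw [hK]; simp
  have hKM : K / M ≤ 1 := by rw [div_le_one hM, hK]; exact h.users_le
  have hns := h.noise_sub_le (a := a) hρ hK
  -- the mean of a square is at least the square of the mean
  have hES : ampLimit q (K * a) ^ 2 ≤
      ∫ p, signalAmp q (m + 1) (bidiagonalStats p) ^ 2 ∂bidiagonalLaw n m := by
    have h1 : 0 ≤ ∫ p, (signalAmp q (m + 1) (bidiagonalStats p) - ampLimit q (K * a)) ^ 2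
        ∂bidiagonalLaw n m := integral_nonneg fun _ => sq_nonneg _
    have h2 : ∀ p, (signalAmp q (m + 1) (bidiagonalStats p) - ampLimit q (K * a)) ^ 2 =
        signalAmp q (m + 1) (bidiagonalStats p) ^ 2 -
          2 * ampLimit q (K * a) * signalAmp q (m + 1) (bidiagonalStats p) +
          ampLimit q (K * a) ^ 2 := fun p => by ring
    have i1 := integrable_signalAmp_sq n m q
    have i2 := (integrable_signalAmp n m q).const_mul (2 * ampLimit q (K * a))
    have i3 : Integrable (fun p => signalAmp q (m + 1) (bidiagonalStats p) ^ 2 -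
      2 * ampLimit q (K * a) * signalAmp q (m + 1) (bidiagonalStats p)) (bidiagonalLaw n m) :=
      i1.sub i2
    simp only [h2] at h1
    rw [integral_add i3 (integrable_const _), integral_sub i1 i2,
      integral_const_mul, integral_signalAmp] at h1
    have h3 : 2 - q - q * ((n + 1) / (m + 1)) = ampLimit q (K * a) := by
      rw [ampLimit, hK, ha]; ring
    rw [h3] at h1
    simp at h1
    nlinarith
  have eS := integral_signalAmp_sq n m q hK ha
  have eI := integral_interferencePower n m q hK ha
  change _ = _ + leakLimit q (K * a) * a + _ + _ at eS
  change _ = (K - 1) * (leakLimit q (K * a) * a + _) at eI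
  change _ = ampLimit q (K * a) ^ 2 + _ + _ + _ at eS
  have hI0 : 0 ≤ ∫ p, interferencePower q (m + 1) (bidiagonalStats p) ∂bidiagonalLaw n m :=
    integral_nonneg_of_ae (interferencePower_nonneg n m q)
  generalize ∫ p, signalAmp q (m + 1) (bidiagonalStats p) ^ 2 ∂bidiagonalLaw n m = ES at *
  generalize ∫ p, interferencePower q (m + 1) (bidiagonalStats p) ∂bidiagonalLaw n m = EI at *
  unfold limitRate
  have hV0' : 0 ≤ (K - 1) * (leakLimit q (K * a) * a) := by positivity
  have hS0 : 0 ≤ ampLimit q (K * a) ^ 2 + leakLimit q (K * a) * a := by positivity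
  have hSu : ampLimit q (K * a) ^ 2 ≤ ampLimit q (K * a) ^ 2 + leakLimit q (K * a) * a := by
    have : 0 ≤ leakLimit q (K * a) * a := by positivity
    linarith
  generalize ampLimit q (K * a) ^ 2 = u2 at *
  generalize leakLimit q (K * a) * a = V at *
  generalize noiseExact ρ M q K a = n₀ at *
  generalize noiseLimit ρ M q K a = n₁ at *
  have hN0 : 0 < 1 + q ^ 2 := by positivity
  have hqN : q ^ 2 ≤ 1 + q ^ 2 := by linarith
  have hqN' : |-4 * q + 5 * q ^ 2| ≤ 7 * (1 + q ^ 2) := by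
    rw [abs_le]; constructor <;> nlinarith [sq_nonneg (1 - q), sq_nonneg (1 + q)]
  generalize 1 + q ^ 2 = N at *
  have hl : 0 < 1 / ρ * (K / M) * (κ₁ * N) := by positivity
  have hu0 : 0 < κ₁ * N := by positivity
  refine (abs_logb_sub_le (by linarith) (by linarith) hS0 (by linarith)).trans ?_
  rw [div_mul_eq_mul_div]
  refine div_le_div_of_nonneg_right ?_ (Real.log_pos one_lt_two).le
  have hdI : |EI - (K - 1) * V| ≤ 2 * K * a ^ 3 * N := by
    have : EI - (K - 1) * V = 2 * (K - 1) * a ^ 3 * q ^ 2 := by rw [eI]; ring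
    rw [this, abs_of_nonneg (by positivity)]
    gcongr
    linarith
  have hdB : |n₀ + EI - (n₁ + (K - 1) * V)| ≤
      1 / ρ * (K / M) * a ^ 2 * N + 2 * K * a ^ 3 * N := by
    have : n₀ + EI - (n₁ + (K - 1) * V) = (n₀ - n₁) + (EI - (K - 1) * V) := by ring
    rw [this]
    exact (abs_add_le _ _).trans (add_le_add hns hdI)
  have hdS : |ES - (u2 + V)| ≤ (9 + 3 * L) * a ^ 2 * N := by
    have : ES - (u2 + V) =
        a ^ 2 * (-4 * q + 5 * q ^ 2) + a ^ 2 * (2 * a + 3 * (K * a)) * q ^ 2 := by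
      rw [eS]; ring
    rw [this]
    refine (abs_add_le _ _).trans ?_
    have h1 : |a ^ 2 * (2 * a + 3 * (K * a)) * q ^ 2| ≤ a ^ 2 * (2 * 1 + 3 * L) * N := by
      rw [abs_of_nonneg (by positivity)]
      gcongr
    have h2 : |a ^ 2 * (-4 * q + 5 * q ^ 2)| ≤ a ^ 2 * (7 * N) := by
      rw [abs_mul, abs_of_nonneg (by positivity)]
      gcongr
    linarith
  have h1 : |Real.log (ES + (n₀ + EI)) - Real.log (u2 + V + (n₁ + (K - 1) * V))| ≤
      (9 + 3 * L + 1 / ρ + 2 * L) / κ₁ * a ^ 2 := by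
    refine (abs_log_sub_le_div hu0 (by linarith) (by linarith)).trans ?_
    rw [div_le_iff₀ hu0]
    have e1 : ES + (n₀ + EI) - (u2 + V + (n₁ + (K - 1) * V)) =
      (ES - (u2 + V)) + (n₀ + EI - (n₁ + (K - 1) * V)) := by ring
    have e2 : 1 / ρ * (K / M) * a ^ 2 * N ≤ 1 / ρ * 1 * a ^ 2 * N := by gcongr
    have e3 : 2 * K * a ^ 3 * N ≤ 2 * L * a ^ 2 * N := by
      have : 2 * K * a ^ 3 * N = 2 * (K * a) * a ^ 2 * N := by ring
      rw [this]; gcongr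
    rw [e1]
    refine (abs_add_le _ _).trans ?_
    have e4 : (9 + 3 * L + 1 / ρ + 2 * L) / κ₁ * a ^ 2 * (κ₁ * N) =
      (9 + 3 * L + 1 / ρ + 2 * L) * a ^ 2 * N := by field_simp
    rw [e4]
    linarith
  have h2 : |Real.log (n₀ + EI) - Real.log (n₁ + (K - 1) * V)| ≤
      (1 + 2 * ρ * L) / κ₁ * a ^ 2 := by
    refine (abs_log_sub_le_div hl (by linarith) (by linarith)).trans ?_
    rw [div_le_iff₀ hl]
    refine hdB.trans ?_
    have e3 : 2 * K * a ^ 3 * N ≤ 2 * (K / M) * L * a ^ 2 * N := by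
      have : 2 * K * a ^ 3 * N = 2 * (K / M) * (M * a) * a ^ 2 * N := by field_simp
      rw [this]; gcongr
    have e4 : (1 + 2 * ρ * L) / κ₁ * a ^ 2 * (1 / ρ * (K / M) * (κ₁ * N)) =
      1 / ρ * (K / M) * a ^ 2 * N + 2 * (K / M) * L * a ^ 2 * N := by field_simp
    rw [e4]
    linarith
  linarith

end Regime

/-! ### The mean rate -/

section RandomRate

variable {Ω : Type*} [MeasurableSpace Ω] {μ : Measure Ω} {X Y : Ω → ℝ} {l n₀ x y : ℝ}

lemma integrable_logb_one_add_div (hX : Integrable X μ) (hX0 : ∀ᵐ p ∂μ, 0 ≤ X p)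
    (hY : Integrable Y μ) (hY0 : ∀ᵐ p ∂μ, 0 ≤ Y p) (hn : 0 < n₀) :
    Integrable (fun p => Real.logb 2 (1 + X p / (n₀ + Y p))) μ := by
  refine (hX.const_mul (1 / n₀ / Real.log 2)).mono' ?_ ?_
  · have h1 : AEMeasurable (fun p => 1 + X p / (n₀ + Y p)) μ :=
      (hX.aemeasurable.div (hY.aemeasurable.const_add _)).const_add _
    exact ((Real.measurable_log.comp_aemeasurable h1).div_const _).aestronglyMeasurable
  · filter_upwards [hX0, hY0] with p h1 h2
    have hl := Real.log_pos one_lt_two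
    have h3 : 0 ≤ X p / (n₀ + Y p) := by positivity
    have h4 : Real.log (1 + X p / (n₀ + Y p)) ≤ X p / n₀ := by
      have := Real.log_le_sub_one_of_pos (by linarith : 0 < 1 + X p / (n₀ + Y p))
      have h5 : X p / (n₀ + Y p) ≤ X p / n₀ := by gcongr; linarith
      linarith
    have h5 : 0 ≤ Real.log (1 + X p / (n₀ + Y p)) := Real.log_nonneg (by linarith)
    rw [Real.norm_eq_abs, Real.logb, abs_of_nonneg (by positivity)]
    calc _ ≤ X p / n₀ / Real.log 2 := by gcongr
      _ = _ := by ring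

/-- The mean rate is close to the rate at deterministic powers `x` and `y` if signal power and
noise plus interference are close to these in mean. -/
lemma abs_integral_logb_sub_le [IsProbabilityMeasure μ] (hX : Integrable X μ)
    (hX0 : ∀ᵐ p ∂μ, 0 ≤ X p) (hY : Integrable Y μ) (hY0 : ∀ᵐ p ∂μ, 0 ≤ Y p)
    (hl : 0 < l) (hn : l ≤ n₀) (hx : 0 ≤ x) (hy : l ≤ y) :
    |(∫ p, Real.logb 2 (1 + X p / (n₀ + Y p)) ∂μ) - Real.logb 2 (1 + x / y)| ≤
      (2 / (x + y) * (1 + Real.log ((x + y) / l)) *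
        ((∫ p, |X p - x| ∂μ) + ∫ p, |n₀ + Y p - y| ∂μ) +
        1 / l * ∫ p, |n₀ + Y p - y| ∂μ) / Real.log 2 := by
  have hf := integrable_logb_one_add_div hX hX0 hY hY0 (hl.trans_le hn)
  have i1 : Integrable (fun p => |X p - x|) μ := (hX.sub (integrable_const _)).abs
  have i2 : Integrable (fun p => |n₀ + Y p - y|) μ :=
    (((integrable_const n₀).add hY).sub (integrable_const _)).abs
  have hlog : 0 ≤ Real.log ((x + y) / l) := Real.log_nonneg (by rw [le_div_iff₀ hl]; linarith)
  have h1 : (∫ p, Real.logb 2 (1 + X p / (n₀ + Y p)) ∂μ) - Real.logb 2 (1 + x / y) =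
      ∫ p, (Real.logb 2 (1 + X p / (n₀ + Y p)) - Real.logb 2 (1 + x / y)) ∂μ := by
    rw [integral_sub hf (integrable_const _)]; simp
  have i12 : Integrable (fun p => |X p - x| + |n₀ + Y p - y|) μ := i1.add i2
  have i3 : Integrable (fun p => (2 / (x + y) * (1 + Real.log ((x + y) / l)) *
      (|X p - x| + |n₀ + Y p - y|) + 1 / l * |n₀ + Y p - y|) / Real.log 2) μ :=
    ((i12.const_mul _).add (i2.const_mul _)).div_const _
  rw [h1]
  refine (abs_integral_le_integral_abs).trans ?_
  have h2 : ∫ p, (2 / (x + y) * (1 + Real.log ((x + y) / l)) *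
      (|X p - x| + |n₀ + Y p - y|) + 1 / l * |n₀ + Y p - y|) / Real.log 2 ∂μ =
      (2 / (x + y) * (1 + Real.log ((x + y) / l)) *
        ((∫ p, |X p - x| ∂μ) + ∫ p, |n₀ + Y p - y| ∂μ) +
        1 / l * ∫ p, |n₀ + Y p - y| ∂μ) / Real.log 2 := by
    rw [integral_div, integral_add (i12.const_mul _) (i2.const_mul _), integral_const_mul,
      integral_const_mul, integral_add i1 i2]
  rw [← h2]
  refine integral_mono_ae (hf.sub (integrable_const _)).abs i3 ?_
  filter_upwards [hX0, hY0] with p hp1 hp2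
  have hB : l ≤ n₀ + Y p := by linarith
  refine (abs_logb_sub_le hp1 (hl.trans_le hB) hx (hl.trans_le hy)).trans ?_
  refine div_le_div_of_nonneg_right ?_ (Real.log_pos one_lt_two).le
  refine add_le_add ?_ ?_
  · refine (abs_log_sub_le_mul hl (by linarith) (by linarith)).trans ?_
    have : |X p + (n₀ + Y p) - (x + y)| ≤ |X p - x| + |n₀ + Y p - y| := by
      have e : X p + (n₀ + Y p) - (x + y) = (X p - x) + (n₀ + Y p - y) := by ring
      rw [e]; exact abs_add_le _ _
    have : 0 ≤ 2 / (x + y) := div_nonneg two_pos.le (by linarith)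
    gcongr
  · refine (abs_log_sub_le_div hl hB hy).trans (le_of_eq (by ring))

end RandomRate

/-- The mean rate of one user, as a mean over the squared entries of the bidiagonal form. -/
def userRate (n m : ℕ) (q n₀ : ℝ) : ℝ :=
  ∫ p, Real.logb 2 (1 + signalAmp q (m + 1) (bidiagonalStats p) ^ 2 /
    (n₀ + interferencePower q (m + 1) (bidiagonalStats p))) ∂bidiagonalLaw n m

namespace Regime

variable {L κ₁ ρ M q K a : ℝ} {n m : ℕ}

/-- An upper bound for the total power in the closed form, relative to `1 + q²`. -/
def powerBound (L ρ : ℝ) : ℝ :=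
  (4 + (1 + L) ^ 2) + (4 + (2 + L) ^ 2 + L) +
    (1 / ρ * (4 + (1 + L) ^ 2 + L) + L * (4 + (2 + L) ^ 2 + L))

/-- Deviations `EA` and `EB` in mean of signal power and of noise plus interference from their
limits make the mean rate deviate by `O(log M) (EA + EB) + O(M / K) EB`. The two bounds `EB` and
`EB'` on the same deviation serve the two terms. -/
lemma abs_userRate_sub_limitRate_le (h : Regime L κ₁ n m M q) (hρ : 0 < ρ) (hK : K = n + 1)
    (ha : a = 1 / (m + 1)) {EA EB EB' : ℝ}
    (hA : ∫ p, |signalAmp q (m + 1) (bidiagonalStats p) ^ 2 -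
      (ampLimit q (K * a) ^ 2 + leakLimit q (K * a) * a)| ∂bidiagonalLaw n m ≤ EA * (1 + q ^ 2))
    (hB : ∫ p, |noiseExact ρ M q K a + interferencePower q (m + 1) (bidiagonalStats p) -
      (noiseLimit ρ M q K a + (K - 1) * (leakLimit q (K * a) * a))| ∂bidiagonalLaw n m ≤
        EB * (1 + q ^ 2))
    (hB' : ∫ p, |noiseExact ρ M q K a + interferencePower q (m + 1) (bidiagonalStats p) -
      (noiseLimit ρ M q K a + (K - 1) * (leakLimit q (K * a) * a))| ∂bidiagonalLaw n m ≤
        EB' * (1 + q ^ 2)) :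
    |userRate n m q (noiseExact ρ M q K a) - limitRate ρ M q K a| ≤
      (2 / κ₁ * (1 + Real.log (powerBound L ρ * ρ / κ₁ * M)) * (EA + EB) +
        ρ / κ₁ * (M / K) * EB') / Real.log 2 := by
  have hM := h.pos_M
  have hL : 0 < L := lt_of_lt_of_le one_pos h.one_le
  have hK0 : 0 < K := by rw [hK]; positivity
  have hK1 : 1 ≤ K := by rw [hK]; simp
  have ha0 : 0 < a := by rw [ha]; positivity
  have ha1 : a ≤ 1 := by rw [ha, div_le_one (by positivity)]; simp
  have hκ₁ := h.κ₁_pos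
  have hV := h.leakLimit_le hK ha
  have hV0 : 0 ≤ leakLimit q (K * a) := leakLimit_nonneg (by positivity)
  have hu := h.amp_ge' hK ha
  have hu2 := h.ampLimit_sq_le hK ha
  have hKa := h.users_mul_le hK ha
  have hn := (h.noise_ge hρ hK ha).1
  have hn' := (h.noise_ge hρ hK ha).2
  have hKM : K / M ≤ 1 := by rw [div_le_one hM, hK]; exact h.users_le
  have hnu : noiseLimit ρ M q K a ≤ 1 / ρ * (4 + (1 + L) ^ 2 + L) * (1 + q ^ 2) := by
    have h1 : ampLimit q (K * a) ^ 2 + K * a * q ^ 2 ≤ (4 + (1 + L) ^ 2 + L) * (1 + q ^ 2) := by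
      have : K * a * q ^ 2 ≤ L * (1 + q ^ 2) := by
        have : q ^ 2 ≤ 1 + q ^ 2 := by linarith
        gcongr
      linarith
    unfold noiseLimit
    calc _ ≤ 1 / ρ * 1 * ((4 + (1 + L) ^ 2 + L) * (1 + q ^ 2)) := by gcongr
      _ = _ := by ring
  have hVa : leakLimit q (K * a) * a ≤ (4 + (2 + L) ^ 2 + L) * (1 + q ^ 2) := by
    calc _ ≤ leakLimit q (K * a) * 1 := by gcongr
      _ ≤ _ := by rwa [mul_one]
  have hKV : (K - 1) * (leakLimit q (K * a) * a) ≤ L * ((4 + (2 + L) ^ 2 + L) * (1 + q ^ 2)) := by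
    calc _ ≤ K * (leakLimit q (K * a) * a) := by gcongr; linarith
      _ = K * a * leakLimit q (K * a) := by ring
      _ ≤ _ := by gcongr
  have hVa0 : 0 ≤ leakLimit q (K * a) * a := by positivity
  have hKV0 : 0 ≤ (K - 1) * (leakLimit q (K * a) * a) :=
    mul_nonneg (by linarith) hVa0
  have hl : 0 < 1 / ρ * (K / M) * (κ₁ * (1 + q ^ 2)) := by positivity
  have key := abs_integral_logb_sub_le (μ := bidiagonalLaw n m) (integrable_signalAmp_sq n m q)
    (.of_forall fun _ => sq_nonneg _) (integrable_interferencePower n m q)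
    (interferencePower_nonneg n m q) hl (hn.trans hn')
    (add_nonneg (sq_nonneg _) hVa0 : 0 ≤ ampLimit q (K * a) ^ 2 + leakLimit q (K * a) * a)
    (by linarith : _ ≤ noiseLimit ρ M q K a + (K - 1) * (leakLimit q (K * a) * a))
  unfold userRate limitRate
  refine key.trans ?_
  refine div_le_div_of_nonneg_right ?_ (Real.log_pos one_lt_two).le
  have hA0 := integral_nonneg (μ := bidiagonalLaw n m)
    (f := fun p => |signalAmp q (m + 1) (bidiagonalStats p) ^ 2 -
      (ampLimit q (K * a) ^ 2 + leakLimit q (K * a) * a)|) fun _ => abs_nonneg _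
  have hB0 := integral_nonneg (μ := bidiagonalLaw n m)
    (f := fun p => |noiseExact ρ M q K a + interferencePower q (m + 1) (bidiagonalStats p) -
      (noiseLimit ρ M q K a + (K - 1) * (leakLimit q (K * a) * a))|) fun _ => abs_nonneg _
  set IA := ∫ p, |signalAmp q (m + 1) (bidiagonalStats p) ^ 2 -
      (ampLimit q (K * a) ^ 2 + leakLimit q (K * a) * a)| ∂bidiagonalLaw n m
  set IB := ∫ p, |noiseExact ρ M q K a + interferencePower q (m + 1) (bidiagonalStats p) -
      (noiseLimit ρ M q K a + (K - 1) * (leakLimit q (K * a) * a))| ∂bidiagonalLaw n m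
  set T := ampLimit q (K * a) ^ 2 + leakLimit q (K * a) * a +
    (noiseLimit ρ M q K a + (K - 1) * (leakLimit q (K * a) * a)) with hT
  have hTl : κ₁ * (1 + q ^ 2) ≤ T := by linarith
  have hTu : T ≤ powerBound L ρ * (1 + q ^ 2) := by
    have : powerBound L ρ * (1 + q ^ 2) = (4 + (1 + L) ^ 2) * (1 + q ^ 2) +
      (4 + (2 + L) ^ 2 + L) * (1 + q ^ 2) + (1 / ρ * (4 + (1 + L) ^ 2 + L) * (1 + q ^ 2) +
      L * ((4 + (2 + L) ^ 2 + L) * (1 + q ^ 2))) := by unfold powerBound; ring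
    rw [this]
    linarith
  have hT0 : 0 < T := lt_of_lt_of_le (by positivity) hTl
  have hr1 : 1 ≤ T / (1 / ρ * (K / M) * (κ₁ * (1 + q ^ 2))) := by
    rw [le_div_iff₀ hl]
    linarith [sq_nonneg (ampLimit q (K * a))]
  have hr : T / (1 / ρ * (K / M) * (κ₁ * (1 + q ^ 2))) ≤ powerBound L ρ * ρ / κ₁ * M := by
    rw [div_le_iff₀ hl]
    have : powerBound L ρ * ρ / κ₁ * M * (1 / ρ * (K / M) * (κ₁ * (1 + q ^ 2))) =
      K * (powerBound L ρ * (1 + q ^ 2)) := by field_simp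
    rw [this]
    nlinarith
  have hlog : Real.log (T / (1 / ρ * (K / M) * (κ₁ * (1 + q ^ 2)))) ≤
    Real.log (powerBound L ρ * ρ / κ₁ * M) := Real.log_le_log (by linarith) hr
  have hlog0 := Real.log_nonneg hr1
  refine add_le_add ?_ ?_
  · calc _ ≤ 2 / (κ₁ * (1 + q ^ 2)) * (1 + Real.log (powerBound L ρ * ρ / κ₁ * M)) *
          (EA * (1 + q ^ 2) + EB * (1 + q ^ 2)) := by
          have := hlog0.trans hlog
          gcongr
      _ = _ := by field_simp
  · calc _ ≤ 1 / (1 / ρ * (K / M) * (κ₁ * (1 + q ^ 2))) * (EB' * (1 + q ^ 2)) := by gcongr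
      _ = _ := by field_simp

end Regime

/-! ### Mean deviation of signal and noise, uniformly in the parameters -/

namespace Regime

variable {L κ₁ ρ M q K a : ℝ} {n m : ℕ}

/-- The bound on the mean deviation of the signal power, relative to `(1 + q²) √a`. -/
def signalConst (L : ℝ) : ℝ :=
  (9 + L) * (1 / 2) * (2 * (1 + L) + 3125 * (1441 + 1440 * L ^ 6)) + (4 + (2 + L) ^ 2 + L)

/-- The bound on the mean deviation of noise plus interference, relative to `(1 + q²) √K a`. -/
def noiseConst (L ρ : ℝ) : ℝ :=
  1 / ρ + (6 + L) * (1 / 2) * (4 * ((1 + L) ^ 2 + 8 * L + 3 * L ^ 2) +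
    3125 * (1441 + 1440 * L ^ 6)) + (4 + (2 + L) ^ 2 + L)

lemma integral_signal_deviation_le (h : Regime L κ₁ n m M q) (hK : K = n + 1)
    (ha : a = 1 / (m + 1)) :
    ∫ p, |signalAmp q (m + 1) (bidiagonalStats p) ^ 2 -
      (ampLimit q (K * a) ^ 2 + leakLimit q (K * a) * a)| ∂bidiagonalLaw n m ≤
      signalConst L * √a * (1 + q ^ 2) := by
  have hKa := h.users_mul_le hK ha
  have hKa' : ((n : ℝ) + 1) / (m + 1) = K * a := by rw [hK, ha]; ring
  have ha0 : 0 < a := by rw [ha]; positivity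
  have hK0 : 0 < K := by rw [hK]; positivity
  have ha1 : a ≤ 1 := by rw [ha, div_le_one (by positivity)]; simp
  have hV := h.leakLimit_le hK ha
  have hV0 : 0 ≤ leakLimit q (K * a) := leakLimit_nonneg (by positivity)
  have hsq : a ≤ √a := by
    rw [Real.le_sqrt ha0.le ha0.le]; nlinarith
  have h1 := integral_signalAmp_sq_sub_le n m (hKa' ▸ hKa) q hK ha
  rw [← ampLimit] at h1
  have i1 : Integrable (fun p => |signalAmp q (m + 1) (bidiagonalStats p) ^ 2 -
      ampLimit q (K * a) ^ 2|) (bidiagonalLaw n m) :=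
    ((integrable_signalAmp_sq n m q).sub (integrable_const _)).abs
  have i2 : Integrable (fun p => |signalAmp q (m + 1) (bidiagonalStats p) ^ 2 -
      (ampLimit q (K * a) ^ 2 + leakLimit q (K * a) * a)|) (bidiagonalLaw n m) :=
    ((integrable_signalAmp_sq n m q).sub (integrable_const _)).abs
  have h2 : ∫ p, |signalAmp q (m + 1) (bidiagonalStats p) ^ 2 -
      (ampLimit q (K * a) ^ 2 + leakLimit q (K * a) * a)| ∂bidiagonalLaw n m ≤
      ∫ p, (|signalAmp q (m + 1) (bidiagonalStats p) ^ 2 - ampLimit q (K * a) ^ 2| +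
        leakLimit q (K * a) * a) ∂bidiagonalLaw n m := by
    refine integral_mono i2 (i1.add (integrable_const _)) fun p => ?_
    have := abs_sub (signalAmp q (m + 1) (bidiagonalStats p) ^ 2 - ampLimit q (K * a) ^ 2)
      (leakLimit q (K * a) * a)
    rw [abs_of_nonneg (by positivity : 0 ≤ leakLimit q (K * a) * a)] at this
    simp only
    rwa [← sub_sub]
  rw [integral_add i1 (integrable_const _)] at h2
  simp only [integral_const, probReal_univ, one_smul] at h2
  have h3 : leakLimit q (K * a) * a ≤ (4 + (2 + L) ^ 2 + L) * (1 + q ^ 2) * √a := by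
    have : 0 ≤ (4 + (2 + L) ^ 2 + L) * (1 + q ^ 2) := hV0.trans hV
    gcongr
  refine (h2.trans (add_le_add h1 h3)).trans (le_of_eq ?_)
  unfold signalConst; ring

lemma integrable_noise_deviation (n m : ℕ) (q x y : ℝ) :
    Integrable (fun p => |x + interferencePower q (m + 1) (bidiagonalStats p) - y|)
      (bidiagonalLaw n m) :=
  (((integrable_const x).add (integrable_interferencePower n m q)).sub (integrable_const y)).abs

lemma integral_noise_deviation_le (h : Regime L κ₁ n m M q) (hρ : 0 < ρ) (hK : K = n + 1)
    (ha : a = 1 / (m + 1)) :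
    ∫ p, |noiseExact ρ M q K a + interferencePower q (m + 1) (bidiagonalStats p) -
      (noiseLimit ρ M q K a + (K - 1) * (leakLimit q (K * a) * a))| ∂bidiagonalLaw n m ≤
      noiseConst L ρ * (√K * a) * (1 + q ^ 2) := by
  have hM := h.pos_M
  have hKa := h.users_mul_le hK ha
  have hKa' : ((n : ℝ) + 1) / (m + 1) = K * a := by rw [hK, ha]; ring
  have ha0 : 0 < a := by rw [ha]; positivity
  have hK1 : 1 ≤ K := by rw [hK]; simp
  have hK0 : 0 < K := by linarith
  have ha1 : a ≤ 1 := by rw [ha, div_le_one (by positivity)]; simp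
  have hKM : K / M ≤ 1 := by rw [div_le_one hM, hK]; exact h.users_le
  have hV := h.leakLimit_le hK ha
  have hV0 : 0 ≤ leakLimit q (K * a) := leakLimit_nonneg (by positivity)
  have hsq : a ≤ √K * a := by
    have : 1 ≤ √K := Real.one_le_sqrt.2 hK1
    nlinarith
  have h1 := integral_interferencePower_sub_le n m (hKa' ▸ hKa) q hK ha
  rw [← leakLimit] at h1
  have hn := h.noise_sub_le (a := a) hρ hK
  have i1 : Integrable (fun p => |interferencePower q (m + 1) (bidiagonalStats p) -
      K * a * leakLimit q (K * a)|) (bidiagonalLaw n m) :=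
    ((integrable_interferencePower n m q).sub (integrable_const _)).abs
  have h2 : ∫ p, |noiseExact ρ M q K a + interferencePower q (m + 1) (bidiagonalStats p) -
      (noiseLimit ρ M q K a + (K - 1) * (leakLimit q (K * a) * a))| ∂bidiagonalLaw n m ≤
      ∫ p, (|interferencePower q (m + 1) (bidiagonalStats p) - K * a * leakLimit q (K * a)| +
        (1 / ρ * (K / M) * a ^ 2 * (1 + q ^ 2) + leakLimit q (K * a) * a)) ∂bidiagonalLaw n m := by
    refine integral_mono (integrable_noise_deviation n m q _ _) (i1.add (integrable_const _))
      fun p => ?_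
    simp only
    have e : noiseExact ρ M q K a + interferencePower q (m + 1) (bidiagonalStats p) -
      (noiseLimit ρ M q K a + (K - 1) * (leakLimit q (K * a) * a)) =
      (interferencePower q (m + 1) (bidiagonalStats p) - K * a * leakLimit q (K * a)) +
      ((noiseExact ρ M q K a - noiseLimit ρ M q K a) + leakLimit q (K * a) * a) := by ring
    rw [e]
    refine (abs_add_le _ _).trans (add_le_add le_rfl ((abs_add_le _ _).trans (add_le_add hn ?_)))
    rw [abs_of_nonneg (by positivity)]
  rw [integral_add i1 (integrable_const _)] at h2
  simp only [integral_const, probReal_univ, one_smul] at h2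
  have h3 : leakLimit q (K * a) * a ≤ (4 + (2 + L) ^ 2 + L) * (1 + q ^ 2) * (√K * a) := by
    have : 0 ≤ (4 + (2 + L) ^ 2 + L) * (1 + q ^ 2) := hV0.trans hV
    gcongr
  have h4 : 1 / ρ * (K / M) * a ^ 2 * (1 + q ^ 2) ≤ 1 / ρ * 1 * (√K * a) * (1 + q ^ 2) := by
    have : a ^ 2 ≤ √K * a := by nlinarith
    gcongr
  refine (h2.trans (add_le_add h1 (add_le_add h4 h3))).trans (le_of_eq ?_)
  unfold noiseConst; ring

/-- With the relaxation parameter `1 / q = 1 + K / m` the interference vanishes to leading order,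
so that even with few users noise plus interference is dominated by the noise. -/
lemma integral_noise_deviation_le_of_eq (h : Regime L κ₁ n m M q) (hρ : 0 < ρ) (hK : K = n + 1)
    (ha : a = 1 / (m + 1)) (hq0 : 0 < q) (hq : q * (1 + K * a) = 1) :
    ∫ p, |noiseExact ρ M q K a + interferencePower q (m + 1) (bidiagonalStats p) -
      (noiseLimit ρ M q K a + (K - 1) * (leakLimit q (K * a) * a))| ∂bidiagonalLaw n m ≤
      (4 + 1 / ρ) * (K * a) ^ 2 * (1 + q ^ 2) := by
  have hM := h.pos_M
  have ha0 : 0 < a := by rw [ha]; positivity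
  have hK1 : 1 ≤ K := by rw [hK]; simp
  have hK0 : 0 < K := by linarith
  have ha1 : a ≤ 1 := by rw [ha, div_le_one (by positivity)]; simp
  have hM1 : 1 / M ≤ 1 := by
    rw [div_le_one hM]
    have := h.users_le
    rw [← hK] at this
    linarith
  have hV0 : 0 ≤ leakLimit q (K * a) := leakLimit_nonneg (by positivity)
  have hV : leakLimit q (K * a) ≤ K * a := by
    have e1 : 2 - 2 * q - K * a * q = q * (K * a) := by linarith
    have e2 : leakLimit q (K * a) = q * (1 + K * a) * (q * (K * a)) := by
      rw [leakLimit, e1]; ring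
    rw [e2, hq, one_mul]
    have : q ≤ 1 := by nlinarith [mul_pos hq0 (mul_pos hK0 ha0)]
    exact mul_le_of_le_one_left (by positivity) this
  have hn := h.noise_sub_le (a := a) hρ hK
  have eI := integral_interferencePower n m q hK ha
  change _ = (K - 1) * (leakLimit q (K * a) * a + _) at eI
  have hI := integrable_interferencePower n m q
  have h2 : ∫ p, |noiseExact ρ M q K a + interferencePower q (m + 1) (bidiagonalStats p) -
      (noiseLimit ρ M q K a + (K - 1) * (leakLimit q (K * a) * a))| ∂bidiagonalLaw n m ≤
      ∫ p, (interferencePower q (m + 1) (bidiagonalStats p) +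
        (1 / ρ * (K / M) * a ^ 2 * (1 + q ^ 2) + (K - 1) * (leakLimit q (K * a) * a)))
        ∂bidiagonalLaw n m := by
    refine integral_mono_ae (integrable_noise_deviation n m q _ _)
      (hI.add (integrable_const _)) ?_
    filter_upwards [interferencePower_nonneg n m q] with p hp
    have e : noiseExact ρ M q K a + interferencePower q (m + 1) (bidiagonalStats p) -
      (noiseLimit ρ M q K a + (K - 1) * (leakLimit q (K * a) * a)) =
      interferencePower q (m + 1) (bidiagonalStats p) +
      ((noiseExact ρ M q K a - noiseLimit ρ M q K a) - (K - 1) * (leakLimit q (K * a) * a)) := by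
      ring
    rw [e]
    refine (abs_add_le _ _).trans (add_le_add ?_ ((abs_sub _ _).trans (add_le_add hn ?_)))
    · rw [abs_of_nonneg hp]
    · rw [abs_of_nonneg (mul_nonneg (by linarith) (by positivity))]
  rw [integral_add hI (integrable_const _), eI] at h2
  simp only [integral_const, probReal_univ, one_smul] at h2
  have hN : 1 ≤ 1 + q ^ 2 := by nlinarith
  have h3 : (K - 1) * (leakLimit q (K * a) * a) ≤ (K * a) ^ 2 * (1 + q ^ 2) := by
    calc _ ≤ K * (K * a * a) := by gcongr; linarith
      _ = (K * a) ^ 2 * 1 := by ring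
      _ ≤ _ := by gcongr
  have h4 : 1 / ρ * (K / M) * a ^ 2 * (1 + q ^ 2) ≤ 1 / ρ * (K * a) ^ 2 * (1 + q ^ 2) := by
    have : K / M * a ^ 2 ≤ (K * a) ^ 2 := by
      calc K / M * a ^ 2 = K * (1 / M) * a ^ 2 := by ring
        _ ≤ K * K * a ^ 2 := by gcongr; linarith
        _ = _ := by ring
    rw [mul_assoc (1 / ρ)]
    gcongr
  have h5 : (K - 1) * (2 * q ^ 2 * a ^ 3) ≤ 2 * (K * a) ^ 2 * (1 + q ^ 2) := by
    calc _ ≤ K * (2 * (1 + q ^ 2) * a ^ 3) := by gcongr <;> linarith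
      _ = 2 * (K * a ^ 2 * a) * (1 + q ^ 2) := by ring
      _ ≤ 2 * (K * a ^ 2 * K) * (1 + q ^ 2) := by gcongr; linarith
      _ = _ := by ring
  rw [mul_add] at h2
  linarith

/-- The closed form approximates the mean rate. The first error is small for many antennas. The
second is small for many users, as the interference then concentrates; for the relaxation parameter
`1 + K / m` it can be replaced by one that is small for few users. -/
theorem exists_abs_userRate_sub_limitRate_le {L κ₁ ρ : ℝ} (hL : 1 ≤ L) (hκ₁ : 0 < κ₁)
    (hρ : 0 < ρ) : ∃ C : ℝ, 0 ≤ C ∧ ∀ (n m : ℕ) (M q K a : ℝ), Regime L κ₁ n m M q →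
      K = n + 1 → a = 1 / (m + 1) →
      |userRate n m q (noiseExact ρ M q K a) - limitRate ρ M q K a| ≤
        C * ((1 + Real.log M) / √M) + C / √K ∧
      (0 < q → q * (1 + K * a) = 1 →
        |userRate n m q (noiseExact ρ M q K a) - limitRate ρ M q K a| ≤
          C * ((1 + Real.log M) / √M) + C * (K / M)) := by
  have hL0 : 0 < L := by linarith
  have hl2 := Real.log_pos one_lt_two
  set D := powerBound L ρ * ρ / κ₁ with hD
  have hD0 : 0 < D := by rw [hD, powerBound]; positivity
  have hA0 : 0 < signalConst L := by unfold signalConst; positivity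
  have hB0 : 0 < noiseConst L ρ := by unfold noiseConst; positivity
  set C1 := 2 / κ₁ * (1 + |Real.log D|) * ((signalConst L + noiseConst L ρ * L) * L) /
    Real.log 2 with hC1
  set C2 := ρ / κ₁ * (noiseConst L ρ * L) / Real.log 2 with hC2
  set C3 := ρ / κ₁ * ((4 + 1 / ρ) * L ^ 2) / Real.log 2 with hC3
  have hC10 : 0 ≤ C1 := by positivity
  have hC20 : 0 ≤ C2 := by positivity
  have hC30 : 0 ≤ C3 := by positivity
  refine ⟨C1 + C2 + C3, by positivity, fun n m M q K a h hK ha => ?_⟩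
  have hM := h.pos_M
  have hMa := h.antennas_mul_le ha
  have hKa := h.users_mul_le hK ha
  have ha0 : 0 < a := by rw [ha]; positivity
  have hK1 : 1 ≤ K := by rw [hK]; simp
  have hK0 : 0 < K := by linarith
  have hM1 : 1 ≤ M := by have := h.users_le; rw [← hK] at this; linarith
  have hlogM := Real.log_nonneg hM1
  have haM : a ≤ L / M := by rwa [le_div_iff₀ hM, mul_comm]
  have hLsq : √L ≤ L := by
    rw [Real.sqrt_le_left hL0.le]; nlinarith
  have hsa : √a ≤ L / √M := by
    calc √a ≤ √(L / M) := Real.sqrt_le_sqrt haM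
      _ = √L / √M := Real.sqrt_div hL0.le _
      _ ≤ L / √M := by gcongr
  have hKsa : √K * a ≤ L * √a := by
    calc √K * a = √(K * a) * √a := by
          rw [Real.sqrt_mul hK0.le, mul_assoc, Real.mul_self_sqrt ha0.le]
      _ ≤ √L * √a := by gcongr
      _ ≤ L * √a := by gcongr
  have hlog : 1 + Real.log (D * M) ≤ (1 + |Real.log D|) * (1 + Real.log M) := by
    rw [Real.log_mul hD0.ne' hM.ne']
    nlinarith [le_abs_self (Real.log D), mul_nonneg (abs_nonneg (Real.log D)) hlogM]
  -- the common first term of both bounds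
  have first : 2 / κ₁ * (1 + Real.log (D * M)) *
      (signalConst L * √a + noiseConst L ρ * (√K * a)) / Real.log 2 ≤
      C1 * ((1 + Real.log M) / √M) := by
    have h1 : signalConst L * √a + noiseConst L ρ * (√K * a) ≤
        (signalConst L + noiseConst L ρ * L) * (L / √M) := by
      calc _ ≤ signalConst L * √a + noiseConst L ρ * (L * √a) := by gcongr
        _ = (signalConst L + noiseConst L ρ * L) * √a := by ring
        _ ≤ _ := by gcongr
    calc _ ≤ 2 / κ₁ * ((1 + |Real.log D|) * (1 + Real.log M)) *
          ((signalConst L + noiseConst L ρ * L) * (L / √M)) / Real.log 2 := by gcongr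
      _ = _ := by rw [hC1]; ring
  have hfac : 0 ≤ (1 + Real.log M) / √M := by positivity
  have hA := h.integral_signal_deviation_le hK ha
  have hB := h.integral_noise_deviation_le hρ hK ha
  constructor
  · have key := h.abs_userRate_sub_limitRate_le hρ hK ha hA hB hB
    rw [← hD, add_div] at key
    have second : ρ / κ₁ * (M / K) * (noiseConst L ρ * (√K * a)) / Real.log 2 ≤ C2 / √K := by
      have e : M / K * (√K * a) = M * a / √K := by
        have : √K ≠ 0 := (Real.sqrt_pos.2 hK0).ne'
        field_simp
        rw [Real.sq_sqrt hK0.le]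
      calc _ = ρ / κ₁ * (noiseConst L ρ * (M / K * (√K * a))) / Real.log 2 := by ring
        _ ≤ ρ / κ₁ * (noiseConst L ρ * (L / √K)) / Real.log 2 := by rw [e]; gcongr
        _ = _ := by rw [hC2]; ring
    have h1 : C1 * ((1 + Real.log M) / √M) ≤ (C1 + C2 + C3) * ((1 + Real.log M) / √M) := by
      gcongr; linarith
    have h2 : C2 / √K ≤ (C1 + C2 + C3) / √K := by gcongr; linarith
    linarith
  · intro hq0 hq
    have hB' := h.integral_noise_deviation_le_of_eq hρ hK ha hq0 hq
    have key := h.abs_userRate_sub_limitRate_le hρ hK ha hA hB hB'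
    rw [← hD, add_div] at key
    have second : ρ / κ₁ * (M / K) * ((4 + 1 / ρ) * (K * a) ^ 2) / Real.log 2 ≤ C3 * (K / M) := by
      calc _ = ρ / κ₁ * ((4 + 1 / ρ) * ((M * a) ^ 2 * (K / M))) / Real.log 2 := by
            field_simp
        _ ≤ ρ / κ₁ * ((4 + 1 / ρ) * (L ^ 2 * (K / M))) / Real.log 2 := by gcongr
        _ = _ := by rw [hC3]; ring
    have h1 : C1 * ((1 + Real.log M) / √M) ≤ (C1 + C2 + C3) * ((1 + Real.log M) / √M) := by
      gcongr; linarith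
    have h2 : C3 * (K / M) ≤ (C1 + C2 + C3) * (K / M) := by gcongr; linarith
    linarith

end Regime

/-! ### From the channel to independent Gamma variables -/

section RowStats

variable {Ω : Type*} [MeasurableSpace Ω] {P : Measure Ω} {n m : ℕ}
  {Y : Ω → Fin (n + 1) → Fin (m + 1) → ℂ} {g : ℝ × ℝ × ℝ × ℝ → ℝ}

lemma measurable_bidiagonalStats : Measurable bidiagonalStats := measurable_bidiagonalNorms

lemma map_rowStats (hY : HasLaw Y (gaussianMatrix (n + 1) (m + 1)) P) (k : Fin (n + 1)) :
    P.map (fun x => rowStats k (Y x)) = (bidiagonalLaw n m).map bidiagonalStats := by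
  have h1 : P.map (fun x => rowStats k (Y x)) = (P.map Y).map (rowStats k) :=
    (AEMeasurable.map_map_of_aemeasurable (measurable_rowStats k).aemeasurable
      hY.aemeasurable).symm
  rw [h1, hY.map_eq, map_rowStats_gaussianMatrix]
  rfl

lemma integral_rowStats (hY : HasLaw Y (gaussianMatrix (n + 1) (m + 1)) P) (k : Fin (n + 1))
    (hg : Measurable g) :
    ∫ x, g (rowStats k (Y x)) ∂P = ∫ p, g (bidiagonalStats p) ∂bidiagonalLaw n m := by
  rw [← integral_map (φ := fun x => rowStats k (Y x))
      ((measurable_rowStats k).comp_aemeasurable hY.aemeasurable) hg.aestronglyMeasurable,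
    map_rowStats hY k,
    integral_map measurable_bidiagonalStats.aemeasurable hg.aestronglyMeasurable]

lemma integrable_rowStats (hY : HasLaw Y (gaussianMatrix (n + 1) (m + 1)) P) (k : Fin (n + 1))
    (hg : Measurable g) (hi : Integrable (fun p => g (bidiagonalStats p)) (bidiagonalLaw n m)) :
    Integrable (fun x => g (rowStats k (Y x))) P := by
  have h1 : Integrable g ((bidiagonalLaw n m).map bidiagonalStats) :=
    (integrable_map_measure hg.aestronglyMeasurable
      measurable_bidiagonalStats.aemeasurable).2 hi
  rw [← map_rowStats hY k] at h1
  exact h1.comp_aemeasurable ((measurable_rowStats k).comp_aemeasurable hY.aemeasurable)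

lemma measurable_signalAmp (q : ℝ) (m : ℕ) : Measurable (signalAmp q m) := by
  unfold signalAmp; fun_prop

lemma measurable_interferencePower (q : ℝ) (m : ℕ) : Measurable (interferencePower q m) := by
  unfold interferencePower; fun_prop

lemma measurable_transmitPower (q : ℝ) (m : ℕ) : Measurable (transmitPower q m) := by
  unfold transmitPower; fun_prop

lemma measurable_rate (q n₀ : ℝ) (m : ℕ) : Measurable fun s =>
    Real.logb 2 (1 + signalAmp q m s ^ 2 / (n₀ + interferencePower q m s)) :=
  (Real.measurable_log.comp ((((measurable_signalAmp q m).pow_const 2).div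
    ((measurable_interferencePower q m).const_add n₀)).const_add 1)).div_const _

lemma continuous_effectiveChannel_sampleGram {K m : ℕ} (q : ℝ) (k j : Fin K) :
    Continuous fun Y : Fin K → Fin m → ℂ => effectiveChannel q (sampleGram Y) k j := by
  simp only [effectiveChannel, Matrix.sub_apply, Matrix.smul_apply, Matrix.mul_apply, sampleGram,
    Matrix.of_apply, dotProduct, Pi.star_apply, smul_eq_mul]
  fun_prop

end RowStats

lemma sum_erase_eq_sum_succAbove {n : ℕ} (k : Fin (n + 1)) (f : Fin (n + 1) → ℝ) :
    ∑ j ∈ Finset.univ.erase k, f j = ∑ j : Fin n, f (k.succAbove j) := by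
  have h1 := Finset.add_sum_erase Finset.univ f (Finset.mem_univ k)
  rw [Fin.sum_univ_succAbove f k] at h1
  exact add_left_cancel h1

/-- The lower bound for the useful signal power, relative to `1 + q²`, when the relaxation parameter
keeps the distance `δ / 2` from the value at which the signal cancels. -/
def signalGap (L δ : ℝ) : ℝ := 1 / (1 / 2 + ((1 + L) ^ 2 / 2 + 1) / δ ^ 2)

lemma signalGap_mul_le {L δ ω κ : ℝ} (hδ : 0 < δ) (hω : 0 < ω) (hκ : 0 ≤ κ) (hκL : κ ≤ L)
    (h : δ ≤ |2 * ω - 1 - κ|) :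
    signalGap L δ * (1 + (1 / ω) ^ 2) ≤ ampLimit (1 / ω) κ ^ 2 := by
  set q := 1 / ω with hq
  have hq0 : 0 < q := by positivity
  have hu : ampLimit q κ = q * (2 * ω - 1 - κ) := by rw [ampLimit, hq]; field_simp
  have h1 : q ^ 2 * δ ^ 2 ≤ ampLimit q κ ^ 2 := by
    rw [hu, mul_pow, ← sq_abs (2 * ω - 1 - κ)]
    gcongr
  have h2 : (q * (1 + κ)) ^ 2 ≤ q ^ 2 * (1 + L) ^ 2 := by rw [mul_pow]; gcongr
  have h3 : 1 ≤ (ampLimit q κ ^ 2 + (q * (1 + κ)) ^ 2) / 2 := by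
    have : ampLimit q κ = 2 - q * (1 + κ) := by rw [ampLimit]; ring
    rw [this]
    nlinarith [sq_nonneg (1 - q * (1 + κ))]
  have h4 : q ^ 2 ≤ ampLimit q κ ^ 2 / δ ^ 2 := by rwa [le_div_iff₀ (by positivity)]
  have h5 : q ^ 2 * ((1 + L) ^ 2 / 2 + 1) ≤
    ampLimit q κ ^ 2 / δ ^ 2 * ((1 + L) ^ 2 / 2 + 1) := by gcongr
  rw [signalGap, one_div_mul_eq_div, div_le_iff₀ (by positivity)]
  calc 1 + q ^ 2 ≤ ampLimit q κ ^ 2 / 2 + q ^ 2 * ((1 + L) ^ 2 / 2 + 1) := by linarith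
    _ ≤ ampLimit q κ ^ 2 / 2 + ampLimit q κ ^ 2 / δ ^ 2 * ((1 + L) ^ 2 / 2 + 1) := by linarith
    _ = _ := by ring

section PowerEq

variable {Ω : Type*} {M n m : ℕ} {β ω : ℝ} {H : Ω → Matrix (Fin M) (Fin (n + 1)) ℂ}
  {Y : Ω → Fin (n + 1) → Fin (m + 1) → ℂ}

lemma rxPower_self_eq (hM : 0 < M) (hω : 0 < ω) (hG : ∀ x, gram (H x) = sampleGram (Y x))
    (x : Ω) (k : Fin (n + 1)) :
    rxPower (H x) (insPrecoder β ω (H x)) k k =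
      (β * (1 / ω)) ^ 2 * signalAmp (1 / ω) (m + 1) (rowStats k (Y x)) ^ 2 := by
  rw [rxPower_insPrecoder hM hω, hG, effectiveChannel_self, Complex.norm_real, Real.norm_eq_abs,
    sq_abs]

lemma sum_rxPower_eq (hM : 0 < M) (hω : 0 < ω) (hG : ∀ x, gram (H x) = sampleGram (Y x))
    (x : Ω) (k : Fin (n + 1)) :
    ∑ j ∈ Finset.univ.erase k, rxPower (H x) (insPrecoder β ω (H x)) k j =
      (β * (1 / ω)) ^ 2 * interferencePower (1 / ω) (m + 1) (rowStats k (Y x)) := by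
  simp only [sum_erase_eq_sum_succAbove, rxPower_insPrecoder hM hω, hG, ← Finset.mul_sum,
    sum_effectiveChannel_succAbove]

end PowerEq

section Transfer

variable {Ω : Type*} [MeasurableSpace Ω] {P : Measure Ω}
  {M n m : ℕ} {β ω ρ : ℝ} {H : Ω → Matrix (Fin M) (Fin (n + 1)) ℂ}
  {Y : Ω → Fin (n + 1) → Fin (m + 1) → ℂ}

lemma integrable_rxPower (hM : 0 < M) (hω : 0 < ω) (hG : ∀ x, gram (H x) = sampleGram (Y x))
    (hY : HasLaw Y (gaussianMatrix (n + 1) (m + 1)) P) (k j : Fin (n + 1)) :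
    Integrable (fun x => rxPower (H x) (insPrecoder β ω (H x)) k j) P := by
  by_cases hj : j = k
  · subst hj
    simp only [rxPower_self_eq hM hω hG]
    exact (integrable_rowStats hY j ((measurable_signalAmp _ _).pow_const 2)
      (integrable_signalAmp_sq n m (1 / ω))).const_mul _
  · refine ((integrable_rowStats hY k (measurable_interferencePower (1 / ω) (m + 1))
      (integrable_interferencePower n m (1 / ω))).const_mul ((β * (1 / ω)) ^ 2)).mono' ?_
      (.of_forall fun x => ?_)
    · simp only [rxPower_insPrecoder hM hω, hG]
      have h1 : Measurable fun Y : Fin (n + 1) → Fin (m + 1) → ℂ =>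
          (β * (1 / ω)) ^ 2 * ‖effectiveChannel (1 / ω) (sampleGram Y) k j‖ ^ 2 :=
        (continuous_const.mul
          ((continuous_effectiveChannel_sampleGram (1 / ω) k j).norm.pow 2)).measurable
      exact (h1.comp_aemeasurable hY.aemeasurable).aestronglyMeasurable
    · have h0 : ∀ j, 0 ≤ rxPower (H x) (insPrecoder β ω (H x)) k j := fun j => sq_nonneg _
      rw [Real.norm_of_nonneg (h0 j), ← sum_rxPower_eq hM hω hG]
      exact Finset.single_le_sum (f := fun j => rxPower (H x) (insPrecoder β ω (H x)) k j)
        (fun j _ => h0 j) (Finset.mem_erase.2 ⟨hj, Finset.mem_univ _⟩)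

/-- The power normalization determines the scalar in front of the effective channel. -/
lemma PowerNormalized.mul_integral_transmitPower (hM : 0 < M) (hω : 0 < ω)
    (hG : ∀ x, gram (H x) = sampleGram (Y x))
    (hY : HasLaw Y (gaussianMatrix (n + 1) (m + 1)) P)
    (hP : PowerNormalized P fun x => insPrecoder β ω (H x)) :
    (β * (1 / ω)) ^ 2 / M * ((n + 1) *
      ∫ p, transmitPower (1 / ω) (m + 1) (bidiagonalStats p) ∂bidiagonalLaw n m) = 1 := by
  have h1 : ∀ x, (insPrecoder β ω (H x) * (insPrecoder β ω (H x))ᴴ).trace =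
      (((β * (1 / ω)) ^ 2 / M *
        ∑ k, transmitPower (1 / ω) (m + 1) (rowStats k (Y x)) : ℝ) : ℂ) := by
    intro x
    rw [trace_insPrecoder hM hω, hG, Matrix.trace]
    simp only [Matrix.diag_apply]
    rw [Finset.sum_congr rfl fun k _ => transmitPower_self (1 / ω) (Y x) k]
    push_cast
    rfl
  rw [PowerNormalized] at hP
  simp only [h1] at hP
  rw [integral_complex_ofReal, integral_const_mul, integral_finsetSum _ fun k _ =>
    integrable_rowStats hY k (measurable_transmitPower (1 / ω) (m + 1))
      (integrable_transmitPower n m (1 / ω))] at hP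
  simp only [integral_rowStats hY _ (measurable_transmitPower (1 / ω) (m + 1))] at hP
  simp only [Finset.sum_const, Finset.card_univ, Fintype.card_fin, nsmul_eq_mul] at hP
  exact_mod_cast hP

/-- In units in which the effective channel is `2G - q G²`, the noise has power `noiseExact`. -/
lemma PowerNormalized.one_div_eq (hM : 0 < M) (hω : 0 < ω) {K a : ℝ} (hK : K = n + 1)
    (ha : a = 1 / (m + 1)) (hG : ∀ x, gram (H x) = sampleGram (Y x))
    (hY : HasLaw Y (gaussianMatrix (n + 1) (m + 1)) P)
    (hP : PowerNormalized P fun x => insPrecoder β ω (H x)) :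
    1 / ρ = (β * (1 / ω)) ^ 2 * noiseExact ρ M (1 / ω) K a := by
  have h1 := hP.mul_integral_transmitPower hM hω hG hY
  rw [integral_transmitPower n m (1 / ω) hK ha, ← hK] at h1
  have h2 : (β * (1 / ω)) ^ 2 * noiseExact ρ M (1 / ω) K a = 1 / ρ * ((β * (1 / ω)) ^ 2 / M * (K *
    ((2 - 1 / ω - 1 / ω * (K * a)) ^ 2 + K * a * (1 / ω) ^ 2 + (1 / ω) ^ 2 * a ^ 2))) := by
    rw [noiseExact, ampLimit]; ring
  rw [h2, h1, mul_one]

variable {K a : ℝ}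

lemma sinr_insPrecoder_eq (hM : 0 < M) (hω : 0 < ω) (hρ : 0 < ρ) (hK : K = n + 1)
    (ha : a = 1 / (m + 1)) (hG : ∀ x, gram (H x) = sampleGram (Y x))
    (hY : HasLaw Y (gaussianMatrix (n + 1) (m + 1)) P)
    (hP : PowerNormalized P fun x => insPrecoder β ω (H x))
    (x : Ω) (k : Fin (n + 1)) :
    sinr ρ (H x) (insPrecoder β ω (H x)) k =
      signalAmp (1 / ω) (m + 1) (rowStats k (Y x)) ^ 2 / (noiseExact ρ M (1 / ω) K a +
        interferencePower (1 / ω) (m + 1) (rowStats k (Y x))) := by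
  have h1 := hP.one_div_eq (ρ := ρ) hM hω hK ha hG hY
  have hb : (β * (1 / ω)) ^ 2 ≠ 0 := by
    intro h0
    rw [h0, zero_mul] at h1
    exact (one_div_pos.2 hρ).ne' h1
  rw [sinr, rxPower_self_eq hM hω hG, sum_rxPower_eq hM hω hG, h1, ← mul_add,
    mul_div_mul_left _ _ hb]

lemma noiseExact_pos (hM : 0 < M) (hω : 0 < ω) (hρ : 0 < ρ) (hK : K = n + 1)
    (ha : a = 1 / (m + 1)) (hG : ∀ x, gram (H x) = sampleGram (Y x))
    (hY : HasLaw Y (gaussianMatrix (n + 1) (m + 1)) P)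
    (hP : PowerNormalized P fun x => insPrecoder β ω (H x)) :
    0 < noiseExact ρ M (1 / ω) K a := by
  have h1 := hP.one_div_eq (ρ := ρ) hM hω hK ha hG hY
  have h2 : 0 < 1 / ρ := by positivity
  rw [h1] at h2
  exact pos_of_mul_pos_right h2 (sq_nonneg _)

lemma integrable_logb_sinr (hM : 0 < M) (hω : 0 < ω) (hρ : 0 < ρ) (hK : K = n + 1)
    (ha : a = 1 / (m + 1)) (hG : ∀ x, gram (H x) = sampleGram (Y x))
    (hY : HasLaw Y (gaussianMatrix (n + 1) (m + 1)) P)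
    (hP : PowerNormalized P fun x => insPrecoder β ω (H x))
    (k : Fin (n + 1)) :
    Integrable (fun x => Real.logb 2 (1 + sinr ρ (H x) (insPrecoder β ω (H x)) k)) P := by
  simp only [sinr_insPrecoder_eq hM hω hρ hK ha hG hY hP]
  exact integrable_rowStats hY k (measurable_rate _ _ _)
    (integrable_logb_one_add_div (integrable_signalAmp_sq n m _) (.of_forall fun _ => sq_nonneg _)
      (integrable_interferencePower n m _) (interferencePower_nonneg n m _)
      (noiseExact_pos hM hω hρ hK ha hG hY hP))

lemma ergodicSumRate_eq (hM : 0 < M) (hω : 0 < ω) (hρ : 0 < ρ) (hK : K = n + 1)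
    (ha : a = 1 / (m + 1)) (hG : ∀ x, gram (H x) = sampleGram (Y x))
    (hY : HasLaw Y (gaussianMatrix (n + 1) (m + 1)) P)
    (hP : PowerNormalized P fun x => insPrecoder β ω (H x)) :
    ergodicSumRate P ρ H (fun x => insPrecoder β ω (H x)) =
    K * userRate n m (1 / ω) (noiseExact ρ M (1 / ω) K a) := by
  simp only [ergodicSumRate, sinr_insPrecoder_eq hM hω hρ hK ha hG hY hP]
  rw [Finset.sum_congr rfl fun k _ => integral_rowStats hY k
    (measurable_rate (1 / ω) (noiseExact ρ M (1 / ω) K a) (m + 1))]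
  simp [userRate, hK]

lemma meanPowerSumRate_eq (hM : 0 < M) (hω : 0 < ω) (hρ : 0 < ρ) (hK : K = n + 1)
    (ha : a = 1 / (m + 1)) (hG : ∀ x, gram (H x) = sampleGram (Y x))
    (hY : HasLaw Y (gaussianMatrix (n + 1) (m + 1)) P)
    (hP : PowerNormalized P fun x => insPrecoder β ω (H x)) :
    meanPowerSumRate P ρ H (fun x => insPrecoder β ω (H x)) =
    K * Real.logb 2 (1 +
      (∫ p, signalAmp (1 / ω) (m + 1) (bidiagonalStats p) ^ 2 ∂bidiagonalLaw n m) /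
        (noiseExact ρ M (1 / ω) K a +
          ∫ p, interferencePower (1 / ω) (m + 1) (bidiagonalStats p) ∂bidiagonalLaw n m)) := by
  have h1 := hP.one_div_eq (ρ := ρ) hM hω hK ha hG hY
  have hb : (β * (1 / ω)) ^ 2 ≠ 0 := by
    intro h0
    rw [h0, zero_mul] at h1
    exact (one_div_pos.2 hρ).ne' h1
  have h2 : ∀ k, ∫ x, rxPower (H x) (insPrecoder β ω (H x)) k k ∂P = (β * (1 / ω)) ^ 2 *
      ∫ p, signalAmp (1 / ω) (m + 1) (bidiagonalStats p) ^ 2 ∂bidiagonalLaw n m := by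
    intro k
    simp only [rxPower_self_eq hM hω hG]
    rw [integral_const_mul, integral_rowStats hY k ((measurable_signalAmp _ _).pow_const 2)]
  have h3 : ∀ k, ∑ j ∈ Finset.univ.erase k, ∫ x, rxPower (H x) (insPrecoder β ω (H x)) k j ∂P =
      (β * (1 / ω)) ^ 2 *
      ∫ p, interferencePower (1 / ω) (m + 1) (bidiagonalStats p) ∂bidiagonalLaw n m := by
    intro k
    rw [← integral_finsetSum _ fun j _ => integrable_rxPower hM hω hG hY k j]
    simp only [sum_rxPower_eq hM hω hG]
    rw [integral_const_mul, integral_rowStats hY k (measurable_interferencePower _ _)]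
  simp only [meanPowerSumRate, h2, h3, h1, ← mul_add, mul_div_mul_left _ _ hb]
  simp [hK]

end Transfer

/-- The setting in the normal form in which the estimates are stated. -/
lemma INSSetting.exists_regime {Ω : Type*} [MeasurableSpace Ω] {P : Measure Ω}
    [IsProbabilityMeasure P] {c₀ δ ρ c ω β : ℝ} {M K : ℕ} {H : Ω → Matrix (Fin M) (Fin K) ℂ}
    (hc₀ : 0 < c₀) (hδ : 0 < δ) (hρ : 0 < ρ) (h : INSSetting P c₀ δ c ω β H) :
    ((∀ k, Integrable (fun x => Real.logb 2 (1 + sinr ρ (H x) (insPrecoder β ω (H x)) k)) P) ∧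
      ∀ k j, Integrable (fun x => rxPower (H x) (insPrecoder β ω (H x)) k j) P) ∧
    ∃ (n m : ℕ) (a : ℝ), (K : ℝ) = n + 1 ∧ a = 1 / (m + 1) ∧ a = 1 / (c * M) ∧
      Regime (max 1 (1 / c₀)) (signalGap (max 1 (1 / c₀)) δ) n m M (1 / ω) ∧
      insUserRate ρ ω c M K = limitRate ρ M (1 / ω) K a ∧
      ergodicSumRate P ρ H (fun x => insPrecoder β ω (H x)) =
        K * userRate n m (1 / ω) (noiseExact ρ M (1 / ω) K a) ∧
      meanPowerSumRate P ρ H (fun x => insPrecoder β ω (H x)) = K * Real.logb 2 (1 +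
        (∫ p, signalAmp (1 / ω) (m + 1) (bidiagonalStats p) ^ 2 ∂bidiagonalLaw n m) /
          (noiseExact ρ M (1 / ω) K a +
            ∫ p, interferencePower (1 / ω) (m + 1) (bidiagonalStats p) ∂bidiagonalLaw n m)) := by
  have hM : 0 < M := lt_of_lt_of_le Nat.one_pos (h.one_le_users.trans h.users_le)
  have hM' : (0 : ℝ) < M := by exact_mod_cast hM
  have hc : 0 < c := hc₀.trans_le h.corr_ge
  obtain ⟨n, rfl⟩ : ∃ n, K = n + 1 := ⟨K - 1, by have := h.one_le_users; omega⟩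
  obtain ⟨m', Y, hm, hY, hG⟩ := h.channel.exists_gaussianMatrix hc
  have hm0 : m' ≠ 0 := by
    rintro rfl
    have : 0 < c * M := by positivity
    simp at hm
    rcases hm with hm | hm
    · exact hc.ne' hm
    · exact hM.ne' hm
  obtain ⟨m, rfl⟩ := Nat.exists_eq_succ_of_ne_zero hm0
  have hK : ((n + 1 : ℕ) : ℝ) = n + 1 := by push_cast; rfl
  have hma : (1 : ℝ) / (m + 1) = 1 / (c * M) := by rw [← hm]; push_cast; rfl
  have hma' : (m : ℝ) + 1 = c * M := by rw [← hm]; push_cast; rfl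
  have hω := h.relax_pos
  have hL : 1 / c₀ ≤ max 1 (1 / c₀) := le_max_right _ _
  have hant : (M : ℝ) ≤ max 1 (1 / c₀) * (m + 1) := by
    calc (M : ℝ) = 1 / c₀ * (c₀ * M) := by field_simp
      _ ≤ 1 / c₀ * (c * M) := by have := h.corr_ge; gcongr
      _ ≤ _ := by rw [hma']; gcongr
  have hKM : (n : ℝ) + 1 ≤ M := by exact_mod_cast h.users_le
  have hgap : 0 < signalGap (max 1 (1 / c₀)) δ := by unfold signalGap; positivity
  refine ⟨⟨fun k => integrable_logb_sinr hM hω hρ hK rfl hG hY h.power k,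
    fun k j => integrable_rxPower hM hω hG hY k j⟩, n, m, 1 / (m + 1), hK, rfl, hma,
    ⟨hgap, le_max_left _ _, hKM, hant, ?_⟩, insUserRate_eq hω hc hM' hma,
    ergodicSumRate_eq hM hω hρ hK rfl hG hY h.power,
    meanPowerSumRate_eq hM hω hρ hK rfl hG hY h.power⟩
  refine signalGap_mul_le hδ hω (by positivity) ?_ ?_
  · rw [mul_one_div, div_le_iff₀ (by positivity)]
    exact hKM.trans hant
  · rw [mul_one_div, hma', ← hK]
    exact h.relax_away

/-! ### Uniform closeness of the rates -/

open Filter Topology in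
lemma tendsto_one_add_log_div_sqrt :
    Tendsto (fun M : ℕ => (1 + Real.log M) / √M) atTop (𝓝 0) := by
  have hs : Tendsto (fun x : ℝ => √x) atTop atTop := Real.tendsto_sqrt_atTop
  have h1 : Tendsto (fun x : ℝ => 1 / √x) atTop (𝓝 0) :=
    tendsto_const_nhds.div_atTop hs
  have h2 : Tendsto (fun x : ℝ => Real.log x / √x) atTop (𝓝 0) := by
    have := (isLittleO_log_rpow_atTop (r := 1 / 2) (by norm_num)).tendsto_div_nhds_zero
    simpa only [Real.sqrt_eq_rpow] using this
  have h3 := (h1.add h2).comp (tendsto_natCast_atTop_atTop (R := ℝ))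
  simpa only [Function.comp_def, ← add_div, add_zero] using h3

namespace Regime

open Filter Topology in
/-- Mean rate and closed form are uniformly close. With few users and many antennas the rate itself
is large, so that a bounded absolute error is a small relative error. -/
theorem exists_forall_abs_userRate_sub_limitRate_le {L κ₁ ρ ε : ℝ} (hL : 1 ≤ L) (hκ₁ : 0 < κ₁)
    (hρ : 0 < ρ) (hε : 0 < ε) : ∃ N : ℕ, ∀ (n m M : ℕ) (q K a : ℝ), Regime L κ₁ n m M q →
      K = n + 1 → a = 1 / (m + 1) → N ≤ M →
      |userRate n m q (noiseExact ρ M q K a) - limitRate ρ M q K a| ≤ ε * limitRate ρ M q K a ∧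
      ((N : ℝ) ≤ K ∨ (0 < q ∧ q * (1 + K * a) = 1) →
        |userRate n m q (noiseExact ρ M q K a) - limitRate ρ M q K a| ≤ ε) := by
  obtain ⟨C, hC0, hC⟩ := exists_abs_userRate_sub_limitRate_le hL hκ₁ hρ
  set κ₂ := κ₁ / (1 / ρ * (4 + (1 + L) ^ 2 + L) + L * (4 + (2 + L) ^ 2 + L)) with hκ₂
  have hκ₂0 : 0 < κ₂ := by positivity
  set r₀ := Real.logb 2 (1 + κ₂) with hr₀
  have hr₀0 : 0 < r₀ := Real.logb_pos one_lt_two (by linarith)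
  set ε' := min ε (ε * r₀) with hε'
  have hε'0 : 0 < ε' := lt_min hε (by positivity)
  obtain ⟨N₁, hN₁0, hN₁⟩ : ∃ N₁ : ℕ, 0 < N₁ ∧ C / √(N₁ : ℝ) ≤ ε' / 2 := by
    have h1 : Tendsto (fun N : ℕ => C / √(N : ℝ)) atTop (𝓝 0) :=
      tendsto_const_nhds.div_atTop (Real.tendsto_sqrt_atTop.comp tendsto_natCast_atTop_atTop)
    obtain ⟨N, h⟩ := ((h1.eventually_le_const (half_pos hε'0)).and (eventually_gt_atTop 0)).exists
    exact ⟨N, h.2, h.1⟩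
  have hN₁' : (0 : ℝ) < N₁ := by exact_mod_cast hN₁0
  have e1 : ∀ᶠ M : ℕ in atTop, C * ((1 + Real.log M) / √M) ≤ ε' / 2 := by
    have h1 := tendsto_one_add_log_div_sqrt.const_mul C
    rw [mul_zero] at h1
    exact h1.eventually_le_const (half_pos hε'0)
  have e2 : ∀ᶠ M : ℕ in atTop, C * (N₁ / M) ≤ ε' / 2 := by
    have h1 : Tendsto (fun M : ℕ => C * ((N₁ : ℝ) / M)) atTop (𝓝 (C * 0)) :=
      (tendsto_const_nhds.div_atTop tendsto_natCast_atTop_atTop).const_mul C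
    rw [mul_zero] at h1
    exact h1.eventually_le_const (half_pos hε'0)
  have e3 : ∀ᶠ M : ℕ in atTop, ε' / 2 + C ≤ ε * Real.logb 2 (1 + κ₂ * (M / N₁)) := by
    have h1 : Tendsto (fun M : ℕ => 1 + κ₂ * ((M : ℝ) / N₁)) atTop atTop :=
      tendsto_atTop_add_const_left _ _
        ((tendsto_natCast_atTop_atTop.atTop_div_const hN₁').const_mul_atTop hκ₂0)
    exact (((Real.tendsto_logb_atTop one_lt_two).comp h1).const_mul_atTop hε).eventually_ge_atTop _
  obtain ⟨N₂, hN₂⟩ := eventually_atTop.1 (e1.and (e2.and e3))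
  refine ⟨max N₁ N₂, fun n m M q K a h hK ha hM => ?_⟩
  obtain ⟨f1, f2, f3⟩ := hN₂ M ((le_max_right _ _).trans hM)
  obtain ⟨g1, g2⟩ := hC n m M q K a h hK ha
  have hM0 := h.pos_M
  have hK1 : 1 ≤ K := by rw [hK]; simp
  have hK0 : 0 < K := by linarith
  have hKM : K ≤ M := by rw [hK]; exact h.users_le
  have hr := h.limitRate_ge hρ hK ha
  rw [← hκ₂] at hr
  have hrr₀ : r₀ ≤ limitRate ρ M q K a := by
    refine le_trans (Real.logb_le_logb_of_le one_lt_two (by positivity) ?_) hr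
    have : 1 ≤ (M : ℝ) / K := by rwa [one_le_div hK0]
    nlinarith
  have many : (N₁ : ℝ) ≤ K →
      |userRate n m q (noiseExact ρ M q K a) - limitRate ρ M q K a| ≤ ε' := by
    intro hNK
    have : C / √K ≤ C / √(N₁ : ℝ) := by gcongr
    linarith
  refine ⟨?_, fun hcase => ?_⟩
  · rcases le_or_gt (N₁ : ℝ) K with hNK | hNK
    · calc _ ≤ ε' := many hNK
        _ ≤ ε * r₀ := min_le_right _ _
        _ ≤ _ := by gcongr
    · have h1 : C / √K ≤ C := div_le_self hC0 (Real.one_le_sqrt.2 hK1)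
      have h2 : Real.logb 2 (1 + κ₂ * (M / N₁)) ≤ limitRate ρ M q K a := by
        refine le_trans (Real.logb_le_logb_of_le one_lt_two (by positivity) ?_) hr
        gcongr
      calc _ ≤ ε' / 2 + C := by linarith
        _ ≤ ε * Real.logb 2 (1 + κ₂ * (M / N₁)) := f3
        _ ≤ _ := by gcongr
  · refine le_trans ?_ (min_le_left _ _ : ε' ≤ ε)
    rcases le_or_gt (N₁ : ℝ) K with hNK | hNK
    · exact many hNK
    · rcases hcase with hcase | ⟨hq0, hq⟩
      · have : (N₁ : ℝ) ≤ (max N₁ N₂ : ℕ) := by exact_mod_cast le_max_left _ _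
        linarith
      · have h1 := g2 hq0 hq
        have h2 : C * (K / M) ≤ C * (N₁ / M) := by gcongr
        linarith

end Regime

end MassiveMIMO

end

theorem theorem1 (c₀ ρ δ : ℝ) (hc₀ : 0 < c₀) (hρ : 0 < ρ) (hδ : 0 < δ) :
    -- all the expectations involved exist
    (∀ (Ω : Type u) [MeasurableSpace Ω] (P : Measure Ω)
        [IsProbabilityMeasure P] (M K : ℕ) (c ω β : ℝ)
        (H : Ω → Matrix (Fin M) (Fin K) ℂ),
        MassiveMIMO.INSSetting P c₀ δ c ω β H →
        (∀ k, Integrable (fun x => Real.logb 2 (1 + MassiveMIMO.sinr ρ (H x)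
          (MassiveMIMO.insPrecoder β ω (H x)) k)) P) ∧
        (∀ k j, Integrable (fun x => MassiveMIMO.rxPower (H x)
          (MassiveMIMO.insPrecoder β ω (H x)) k j) P)) ∧
    -- for every `M` much larger than one and every number of users, up to a small relative error;
    -- the error per user is small if there are many users or if `ω = 1 + K / (cM)`
    (∀ ε : ℝ, 0 < ε → ∃ N : ℕ,
      ∀ (Ω : Type u) [MeasurableSpace Ω] (P : Measure Ω)
        [IsProbabilityMeasure P] (M K : ℕ) (c ω β : ℝ)
        (H : Ω → Matrix (Fin M) (Fin K) ℂ),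
        MassiveMIMO.INSSetting P c₀ δ c ω β H → N ≤ M →
        |MassiveMIMO.ergodicSumRate P ρ H (fun x => MassiveMIMO.insPrecoder β ω (H x))
            - K * MassiveMIMO.insUserRate ρ ω c M K|
          ≤ ε * (K * MassiveMIMO.insUserRate ρ ω c M K) ∧
        (N ≤ K ∨ ω = 1 + K / (c * M) →
          |MassiveMIMO.ergodicSumRate P ρ H (fun x => MassiveMIMO.insPrecoder β ω (H x))
            - K * MassiveMIMO.insUserRate ρ ω c M K| ≤ ε * K)) ∧
    -- the closed form against the sum-rate with mean powers
    (∃ B : ℝ, ∀ (Ω : Type u) [MeasurableSpace Ω] (P : Measure Ω)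
        [IsProbabilityMeasure P] (M K : ℕ) (c ω β : ℝ)
        (H : Ω → Matrix (Fin M) (Fin K) ℂ),
        MassiveMIMO.INSSetting P c₀ δ c ω β H →
        |MassiveMIMO.meanPowerSumRate P ρ H (fun x => MassiveMIMO.insPrecoder β ω (H x))
            - K * MassiveMIMO.insUserRate ρ ω c M K| ≤ B * K / M ^ 2) := by

  set L := max 1 (1 / c₀)
  have hL : 1 ≤ L := le_max_left _ _
  have hκ₁ : 0 < MassiveMIMO.signalGap L δ := by unfold MassiveMIMO.signalGap; positivity
  refine ⟨fun Ω _ P _ M K c ω β H h => (h.exists_regime hc₀ hδ hρ).1, fun ε hε => ?_, ?_⟩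
  · obtain ⟨N, hN⟩ :=
      MassiveMIMO.Regime.exists_forall_abs_userRate_sub_limitRate_le hL hκ₁ hρ hε
    refine ⟨N, fun Ω _ P _ M K c ω β H h hNM => ?_⟩
    obtain ⟨-, n, m, a, hK, ha, hac, hreg, hr, hE, -⟩ := h.exists_regime hc₀ hδ hρ
    obtain ⟨h1, h2⟩ := hN n m M (1 / ω) K a hreg hK ha hNM
    have hω := h.relax_pos
    have hK0 : (0 : ℝ) ≤ K := Nat.cast_nonneg K
    rw [hE, hr, ← mul_sub, abs_mul, abs_of_nonneg hK0]
    constructor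
    · rw [mul_left_comm]
      exact mul_le_mul_of_nonneg_left h1 hK0
    · intro hcase
      rw [mul_comm ε]
      refine mul_le_mul_of_nonneg_left (h2 ?_) hK0
      refine hcase.imp (fun h => by exact_mod_cast h) fun h => ⟨by positivity, ?_⟩
      rw [hac, mul_one_div, ← h]
      field_simp
  · refine ⟨((9 + 3 * L + 1 / ρ + 2 * L) / MassiveMIMO.signalGap L δ +
      (1 + 2 * ρ * L) / MassiveMIMO.signalGap L δ) / Real.log 2 * L ^ 2,
      fun Ω _ P _ M K c ω β H h => ?_⟩
    obtain ⟨-, n, m, a, hK, ha, hac, hreg, hr, -, hE⟩ := h.exists_regime hc₀ hδ hρ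
    have hM := hreg.pos_M
    have ha0 : 0 < a := by rw [ha]; positivity
    have hMa := hreg.antennas_mul_le ha
    have h1 := hreg.abs_meanPower_sub_limitRate_le hρ hK ha
    have hlog := Real.log_pos one_lt_two
    have haM : a ^ 2 ≤ L ^ 2 / (M : ℝ) ^ 2 := by
      rw [← div_pow]
      have : a ≤ L / M := by rwa [le_div_iff₀ hM, mul_comm]
      gcongr
    rw [hE, hr, ← mul_sub, abs_mul, abs_of_nonneg (Nat.cast_nonneg K)]
    calc _ ≤ (K : ℝ) * (((9 + 3 * L + 1 / ρ + 2 * L) / MassiveMIMO.signalGap L δ +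
          (1 + 2 * ρ * L) / MassiveMIMO.signalGap L δ) / Real.log 2 * (L ^ 2 / (M : ℝ) ^ 2)) := by
          refine mul_le_mul_of_nonneg_left (h1.trans ?_) (Nat.cast_nonneg K)
          gcongr
      _ = _ := by ring
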